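/- Let $k$ be an algebraically closed field. **Conventions.** A connected graded $k$-algebra $A=k\oplus A_1\oplus A_2\oplus\cdots$ is *regular* of dimension $d$ if it has global dimension $d$; it is Gorenstein, i.e. $\mathrm{Ext}^i_A(k,A)=0$ for $i\neq d$ and $\mathrm{Ext}^d_A(k,A)\cong k(l)$ for some integer $l$, both for left and for right modules; and there is $c>0$ with $\dim A_n<c\,n^c$ for all $n\ge 1$. A regular algebra $B$ of dimension four is *of type (14641)* if the trivial left module $k$ has a graded free resolution $$0\to B(-4)\to B(-3)^{4}\to B(-2)^{6}\to B(-1)^{4}\to B\to k\to 0.$$ Let $A\subseteq B$ be a graded subalgebra of a connected graded algebra. $B$ is a *right double extension* of $A$ (with generators $y_1,y_2$) if $B$ is generated by $A$ and homogeneous elements $y_1,y_2$ of positive degree; there is a homogeneous relation $$y_2y_1=p_{12}y_1y_2+p_{11}y_1^2+\tau_1y_1+\tau_2y_2+\tau_0\qquad(p_{12},p_{11}\in k,\ \tau_1,\tau_2,\tau_0\in A);\tag{R1}$$ $B$ is a free left $A$-module with basis $\{y_1^{n_1}y_2^{n_2}\}_{n_1,n_2\ge 0}$; and $y_1A+y_2A\subseteq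 Ay_1+Ay_2+A$. It is a *left double extension* if $B$ is generated by $A$ and homogeneous elements $y_1,y_2$ of positive degree; there is a homogeneous relation $y_1y_2=p'_{12}y_2y_1+p'_{11}y_1^2+y_1\tau'_1+y_2\tau'_2+\tau'_0$ with $p'_{12},p'_{11}\in k$ and $\tau'_i\in A$; $B$ is a free right $A$-module with basis $\{y_2^{n_1}y_1^{n_2}\}_{n_1,n_2\ge 0}$; and $Ay_1+Ay_2\subseteq y_1A+y_2A+A$. It is a *double extension* if it is both, with the same $y_1,y_2$. For a right double extension one writes $$y_ir=\sigma_{i1}(r)y_1+\sigma_{i2}(r)y_2+\delta_i(r)\qquad(r\in A,\ i=1,2),\tag{R2}$$ where $\sigma=(\sigma_{ij}):A\to M_2(A)$ is an algebra homomorphism and $\delta=(\delta_1,\delta_2)^T:A\to A^{2}$ is a $\sigma$-derivation, i.e. a $k$-linear map with $\delta(rs)=\sigma(r)\delta(s)+\delta(r)s$. The homomorphism $\sigma$ is *invertible* if there is an algebra homomorphism $\phi=(\phi_{ij}):A\to M_2(A)$ with $\sum_{l}\phi_{jl}(\sigma_{il}(r))=\sum_{l}\sigma_{lj}(\phi_{li}(r))=\delta_{ij}r$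 for all $r\in A$ and $i,j\in\{1,2\}$ (here $\delta_{ij}$ is the Kronecker symbol). **Theorem 2.8.** Let $B$ be a regular domain of type (14641). Suppose that one of the following holds: (i) $B$ is a right double extension of some graded subalgebra; (ii) there are $x_1,x_2\in B_1$ such that $\sum_{i,j}c_{ij}x_ix_j=0$ for some nonzero matrix $(c_{ij})\in M_2(k)$, and such that the algebra $B/(x_1,x_2)$, with the induced grading, is regular of dimension $2$. Then $B$ is a double extension of a graded subalgebra $A$ that is regular of dimension $2$ and generated in degree $1$; its DE-data $p_{12},p_{11},\tau,\sigma,\delta$ as in (R1) and (R2) exist and satisfy $p_{12}\neq 0$ and $\sigma$ is invertible. Moreover, however $B$ is written as a right double extension, with data as in (R1) and (R2), one has $p_{12}\neq 0$ and $\sigma$ is invertible. -/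

import Mathlib

open CategoryTheory

universe u v

noncomputable section

namespace DoubleExt

/-! ### Connected graded algebras -/

/-- `𝒜` is a grading `A = k ⊕ A₁ ⊕ A₂ ⊕ ⋯` of the `k`-algebra `A ≠ 0` by subspaces, with
`Aᵢ Aⱼ ⊆ Aᵢ₊ⱼ` and `A₀ = k`. -/
structure IsConnectedGraded {k : Type u} {A : Type v} [Field k] [Ring A] [Algebra k A]
    (𝒜 : ℕ → Submodule k A) : Prop where
  nontrivial : Nontrivial A
  gradedMonoid : SetLike.GradedMonoid 𝒜
  isInternal : DirectSum.IsInternal 𝒜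
  zero_eq : 𝒜 0 = 1

/-- The grading of a subalgebra `A ⊆ B` by `Aₙ = A ∩ Bₙ`. The subalgebra is a graded subalgebra
exactly when these subspaces do form a grading of `A`. -/
def subGrading {k : Type u} {B : Type v} [Field k] [Ring B] [Algebra k B]
    (ℬ : ℕ → Submodule k B) (A : Subalgebra k B) : ℕ → Submodule k A :=
  fun n => (ℬ n).comap A.val.toLinearMap

/-- The same grading on the opposite algebra; left modules over the opposite algebra are the right
modules over the algebra. -/
def opGrading {k : Type u} {A : Type v} [Field k] [Ring A] [Algebra k A]
    (𝒜 : ℕ → Submodule k A) : ℕ → Submodule k Aᵐᵒᵖ :=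
  fun n => (𝒜 n).map (MulOpposite.opLinearEquiv k).toLinearMap

/-- The image grading on the quotient of `B` by a two-sided ideal. -/
def quotGrading {k : Type u} {B : Type v} [Field k] [Ring B] [Algebra k B]
    (ℬ : ℕ → Submodule k B) (I : TwoSidedIdeal B) : ℕ → Submodule k I.ringCon.Quotient :=
  fun n => (ℬ n).map (I.ringCon.mkₐ (α := k)).toLinearMap

/-- The augmentation ideal `A_{≥ 1}`, as a left ideal. -/
def augIdeal {k : Type u} {A : Type v} [Field k] [Ring A] [Algebra k A]
    (𝒜 : ℕ → Submodule k A) : Submodule A A :=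
  Submodule.span A {a | ∃ n, 1 ≤ n ∧ a ∈ 𝒜 n}

/-- The trivial left module `k = A / A_{≥ 1}`. -/
def trivialModule {k : Type u} {A : Type v} [Field k] [Ring A] [Algebra k A]
    (𝒜 : ℕ → Submodule k A) : ModuleCat.{v} A :=
  ModuleCat.of A (A ⧸ augIdeal 𝒜)

/-! ### Artin-Schelter regularity -/

/-- The left global dimension of `A` is finite and equal to `d`. -/
def HasLeftGlobalDimension (A : Type v) [Ring A] (d : ℕ) : Prop :=
  IsLeast {n : ℕ | ∀ M : ModuleCat.{v} A, HasProjectiveDimensionLE M n} d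

/-- Right multiplication by `a`, an endomorphism of the left module `A`. By functoriality of
`Ext` in its second argument these maps give the right `A`-module structure of `Ext^i_A(M, A)`. -/
def rightMulHom {A : Type v} [Ring A] (a : A) : ModuleCat.of A A ⟶ ModuleCat.of A A :=
  ModuleCat.ofHom (LinearMap.toSpanSingleton A A a)

/-- The left Gorenstein condition: `Ext^i_A(k, A) = 0` for `i ≠ d`, and `Ext^d_A(k, A)` is a shift
of the trivial right module `k`, that is, it is one-dimensional over `k` and annihilated by
`A_{≥ 1}`.

The shift is by the degree `l` in which the one-dimensional space `Ext^d_A(k, A)` lives; asking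
that there be such an integer `l` is no further condition. Over an algebra of finite global
dimension the condition on `Ext` in the category of graded modules and the one on `Ext` in the
category of all modules, which is used here, agree. -/
structure IsLeftGorenstein {k : Type u} {A : Type v} [Field k] [Ring A] [Algebra k A]
    (𝒜 : ℕ → Submodule k A) (d : ℕ) : Prop where
  ext_eq_zero : ∀ i : ℕ, i ≠ d →
    Subsingleton (Abelian.Ext.{v} (trivialModule 𝒜) (ModuleCat.of A A) i)
  finrank_ext : Module.finrank k (Abelian.Ext.{v} (trivialModule 𝒜) (ModuleCat.of A A) d) = 1
  ext_smul : ∀ n : ℕ, 1 ≤ n → ∀ a ∈ 𝒜 n,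
    ∀ e : Abelian.Ext.{v} (trivialModule 𝒜) (ModuleCat.of A A) d,
      e.comp (Abelian.Ext.mk₀ (rightMulHom a)) (add_zero d) = 0

/-- `A` with the grading `𝒜` is Artin-Schelter regular of dimension `d`: a connected graded
algebra of global dimension `d` that is Gorenstein, on both sides, and that has finite
Gelfand-Kirillov dimension: `dim Aₙ < c n ^ c` for some `c` and all `n ≥ 1`. -/
structure IsASRegular {k : Type u} {A : Type v} [Field k] [Ring A] [Algebra k A]
    (𝒜 : ℕ → Submodule k A) (d : ℕ) : Prop where
  connected : IsConnectedGraded 𝒜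
  gldim_left : HasLeftGlobalDimension A d
  gldim_right : HasLeftGlobalDimension Aᵐᵒᵖ d
  gorenstein_left : IsLeftGorenstein 𝒜 d
  gorenstein_right : IsLeftGorenstein (opGrading 𝒜) d
  growth : ∃ c : ℕ, ∀ n : ℕ, 1 ≤ n →
    Module.Finite k (𝒜 n) ∧ Module.finrank k (𝒜 n) < c * n ^ c

/-! ### Type (14641) -/

/-- The trivial left module `k` has a graded free resolution
`0 → B(-4) → B(-3)^4 → B(-2)^6 → B(-1)^4 → B → k → 0`.
Elements of `B^n` are written as rows, and a homomorphism of left modules `B^m → B^n` is right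
multiplication by an `m × n` matrix; it is a graded map `B(-i-1)^m → B(-i)^n` exactly when all
entries of the matrix are of degree one. The kernel of `B → k` is `B_{≥ 1}`. -/
def Has14641Resolution {k : Type u} {B : Type v} [Field k] [Ring B] [Algebra k B]
    (ℬ : ℕ → Submodule k B) : Prop :=
  ∃ (x : Fin 4 → B) (F : Matrix (Fin 6) (Fin 4) B) (G : Matrix (Fin 4) (Fin 6) B)
    (x' : Fin 4 → B),
    (∀ i, x i ∈ ℬ 1) ∧ (∀ i j, F i j ∈ ℬ 1) ∧ (∀ i j, G i j ∈ ℬ 1) ∧ (∀ i, x' i ∈ ℬ 1) ∧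
    Function.Injective (fun (b : B) (j : Fin 4) => b * x' j) ∧
    Function.Exact (fun (b : B) (j : Fin 4) => b * x' j)
      (fun v : Fin 4 → B => Matrix.vecMul v G) ∧
    Function.Exact (fun v : Fin 4 → B => Matrix.vecMul v G)
      (fun v : Fin 6 → B => Matrix.vecMul v F) ∧
    Function.Exact (fun v : Fin 6 → B => Matrix.vecMul v F)
      (fun v : Fin 4 → B => ∑ i, v i * x i) ∧
    Set.range (fun v : Fin 4 → B => ∑ i, v i * x i) = (augIdeal ℬ : Set B)

/-- `B` is a regular algebra (of dimension four) of type (14641). -/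
structure IsRegularOfType14641 {k : Type u} {B : Type v} [Field k] [Ring B] [Algebra k B]
    (ℬ : ℕ → Submodule k B) : Prop where
  regular : IsASRegular ℬ 4
  resolution : Has14641Resolution ℬ

/-! ### Double extensions -/

/-- `B` is a right double extension of its graded subalgebra `A`, with the generators `y₁, y₂`. -/
def IsRightDoubleExtension {k : Type u} {B : Type v} [Field k] [Ring B] [Algebra k B]
    (ℬ : ℕ → Submodule k B) (A : Subalgebra k B) (y₁ y₂ : B) : Prop :=
  IsConnectedGraded (subGrading ℬ A) ∧
  -- `B` is generated by `A` and `y₁, y₂`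
  Algebra.adjoin k ((A : Set B) ∪ {y₁, y₂}) = ⊤ ∧
  -- `y₁, y₂` are homogeneous of positive degree and satisfy a homogeneous relation
  (∃ d₁ d₂ : ℕ, 1 ≤ d₁ ∧ 1 ≤ d₂ ∧ y₁ ∈ ℬ d₁ ∧ y₂ ∈ ℬ d₂ ∧
    ∃ (p₁₂ p₁₁ : k) (τ₁ τ₂ τ₀ : A),
      p₁₁ • y₁ ^ 2 ∈ ℬ (d₁ + d₂) ∧
      (τ₁ : B) ∈ ℬ d₂ ∧ (τ₂ : B) ∈ ℬ d₁ ∧ (τ₀ : B) ∈ ℬ (d₁ + d₂) ∧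
      y₂ * y₁ = p₁₂ • (y₁ * y₂) + p₁₁ • y₁ ^ 2 + τ₁ * y₁ + τ₂ * y₂ + τ₀) ∧
  -- `B` is a free left `A`-module with basis `y₁ ^ n₁ * y₂ ^ n₂`
  Function.Bijective
    (fun f : ℕ × ℕ →₀ A => f.sum fun n a => (a : B) * (y₁ ^ n.1 * y₂ ^ n.2)) ∧
  -- `y₁ A + y₂ A ⊆ A y₁ + A y₂ + A`
  (∀ r : A, ∃ a b c : A, y₁ * (r : B) = a * y₁ + b * y₂ + c) ∧
  (∀ r : A, ∃ a b c : A, y₂ * (r : B) = a * y₁ + b * y₂ + c)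

/-- `B` is a left double extension of its graded subalgebra `A`, with the generators `y₁, y₂`. -/
def IsLeftDoubleExtension {k : Type u} {B : Type v} [Field k] [Ring B] [Algebra k B]
    (ℬ : ℕ → Submodule k B) (A : Subalgebra k B) (y₁ y₂ : B) : Prop :=
  IsConnectedGraded (subGrading ℬ A) ∧
  -- `B` is generated by `A` and `y₁, y₂`
  Algebra.adjoin k ((A : Set B) ∪ {y₁, y₂}) = ⊤ ∧
  -- `y₁, y₂` are homogeneous of positive degree and satisfy a homogeneous relation
  (∃ d₁ d₂ : ℕ, 1 ≤ d₁ ∧ 1 ≤ d₂ ∧ y₁ ∈ ℬ d₁ ∧ y₂ ∈ ℬ d₂ ∧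
    ∃ (p₁₂ p₁₁ : k) (τ₁ τ₂ τ₀ : A),
      p₁₁ • y₁ ^ 2 ∈ ℬ (d₁ + d₂) ∧
      (τ₁ : B) ∈ ℬ d₂ ∧ (τ₂ : B) ∈ ℬ d₁ ∧ (τ₀ : B) ∈ ℬ (d₁ + d₂) ∧
      y₁ * y₂ = p₁₂ • (y₂ * y₁) + p₁₁ • y₁ ^ 2 + y₁ * τ₁ + y₂ * τ₂ + τ₀) ∧
  -- `B` is a free right `A`-module with basis `y₂ ^ n₁ * y₁ ^ n₂`
  Function.Bijective
    (fun f : ℕ × ℕ →₀ A => f.sum fun n a => (y₂ ^ n.1 * y₁ ^ n.2) * (a : B)) ∧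
  -- `A y₁ + A y₂ ⊆ y₁ A + y₂ A + A`
  (∀ r : A, ∃ a b c : A, (r : B) * y₁ = y₁ * a + y₂ * b + c) ∧
  (∀ r : A, ∃ a b c : A, (r : B) * y₂ = y₁ * a + y₂ * b + c)

/-- `B` is a double extension of `A`: a right and a left double extension with the same generating
set `{y₁, y₂}`. -/
def IsDoubleExtension {k : Type u} {B : Type v} [Field k] [Ring B] [Algebra k B]
    (ℬ : ℕ → Submodule k B) (A : Subalgebra k B) (y₁ y₂ : B) : Prop :=
  IsRightDoubleExtension ℬ A y₁ y₂ ∧ IsLeftDoubleExtension ℬ A y₁ y₂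

/-- The DE-data `{P, σ, δ, τ}`: a parameter `P = {p₁₂, p₁₁}`, a tail `τ = {τ₁, τ₂, τ₀}`, an algebra
homomorphism `σ : A → M₂(A)` and a `σ`-derivation `δ : A → A²` (columns). -/
structure DEData (k : Type u) (A : Type v) [Field k] [Ring A] [Algebra k A] where
  p₁₂ : k
  p₁₁ : k
  τ₁ : A
  τ₂ : A
  τ₀ : A
  σ : A →ₐ[k] Matrix (Fin 2) (Fin 2) A
  δ : A →ₗ[k] (Fin 2 → A)
  δ_mul : ∀ r s : A, ∀ i, δ (r * s) i = (∑ j, σ r i j * δ s j) + δ r i * s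

/-- The relation between `y₁` and `y₂`, and the relation that moves `y₁, y₂` past the elements of
`A`, hold in `B` with the DE-data `D`; that is, `B = A_P[y₁, y₂; σ, δ, τ]` as soon as
`B` is a right double extension of `A` with the generators `y₁, y₂`. -/
def DEData.Presents {k : Type u} {B : Type v} [Field k] [Ring B] [Algebra k B]
    {A : Subalgebra k B} (D : DEData k A) (y₁ y₂ : B) : Prop :=
  y₂ * y₁ = D.p₁₂ • (y₁ * y₂) + D.p₁₁ • y₁ ^ 2 + D.τ₁ * y₁ + D.τ₂ * y₂ + D.τ₀ ∧
  ∀ r : A,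
    y₁ * (r : B) = D.σ r 0 0 * y₁ + D.σ r 0 1 * y₂ + D.δ r 0 ∧
    y₂ * (r : B) = D.σ r 1 0 * y₁ + D.σ r 1 1 * y₂ + D.δ r 1

/-- Invertibility of an algebra homomorphism `σ : A → M₂(A)`: there is an algebra homomorphism
`φ : A → M₂(A)` such that `(φⱼₖ)` and the transpose of `(σₖⱼ)` are inverse to each other in the
matrix algebra `M₂(End_k(A))`. -/
def IsInvertibleHom {k : Type u} {A : Type v} [Field k] [Ring A] [Algebra k A]
    (σ : A →ₐ[k] Matrix (Fin 2) (Fin 2) A) : Prop :=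
  ∃ φ : A →ₐ[k] Matrix (Fin 2) (Fin 2) A, ∀ (i j : Fin 2) (r : A),
    (∑ l, φ (σ r i l) j l = if i = j then r else 0) ∧
    (∑ l, σ (φ r l i) l j = if i = j then r else 0)

end DoubleExt

end

/-! Let V = B₁, of dimension four, and let R ⊆ V ⊗ V be the six-dimensional space of quadratic
relations. The Gorenstein condition lets the resolution of k be written with the same basis of V at
both ends (`exists_isAdaptedResolution`). The coefficients of its two inner maps then combine into a
superpotential w in the fourth tensor power of V: any two adjacent slots of w lie in R, contractions
of w span R, and w is nondegenerate in its outer slots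
(`IsAdaptedResolution.exists_isSuperpotential`). Since B is a domain, R contains no nonzero tensor
of rank one. Most of the proof is linear algebra with w.

The hypotheses (i) and (ii) both lead to a frame (`IsFrame`): planes X and Y with X + Y = V and XV =
VX, a skew commutation relation inside X, and one inside Y modulo XV. Given a frame, ordered
monomials in X and Y span B, and since the Hilbert series of B is (1 - t)⁻⁴ there are exactly as
many of them as needed for a basis. So B is free over the algebra A generated by X. The frame axioms
pass to the opposite algebra, so the left-hand properties follow from the right-hand ones. The
algebra A is a quantum plane, and a Koszul resolution shows that it is regular. Moving the
generators of Y from one side of A to the other and back yields the inverse of σ.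

A plane X is normal (XV = VX) as soon as R modulo X ⊗ V + V ⊗ X is a line spanned by a nondegenerate
form q (`IsSuperpotential.exists_rel_right`). In case (ii) such a q exists because Ext²(k, C) of the
quotient C is one-dimensional and killed by the augmentation ideal
(`exists_form_of_gorenstein_two`).

In case (i) the form q is the quadratic part of (R1), and two things remain. Its nondegeneracy,
which means that p₁₂ is nonzero, follows from the superpotential because R ∩ (X ⊗ V) is a line
contained in X ⊗ X (`IsSuperpotential.nondegenerate`). That both generators have degree one is an
exclusion argument: if only one did, A₁ would have dimension three, and a dimension count in a
domain over an algebraically closed field (`IsSuperpotential.exists_rel_of_three`) would make B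
spanned over A by powers of that generator, against freeness. The frame keeps the given generators,
and freeness forces its subalgebra to be the given A; so every right double extension is a double
extension. -/

noncomputable section

namespace DoubleExt

open Abelian

/-! ### Ext groups computed from syzygies. -/

section Syzygy

variable {A : Type v} [Ring A] {K F F' M M' : Type v} [AddCommGroup K] [Module A K]
  [AddCommGroup F] [Module A F] [AddCommGroup M] [Module A M]
  [AddCommGroup F'] [Module A F'] [AddCommGroup M'] [Module A M']

/-- The short exact sequence of modules given by an injection, a surjection and exactness. -/
theorem shortExact_of_exact {i : K →ₗ[A] F} {p : F →ₗ[A] M} (hi : Function.Injective i)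
    (hip : Function.Exact i p) (hp : Function.Surjective p) :
    (ModuleCat.shortComplexOfCompEqZero i p hip.linearMap_comp_eq_zero).ShortExact :=
  ModuleCat.shortComplex_shortExact _ hip hi hp

section
variable {S : ShortComplex (ModuleCat.{v} A)} (hS : S.ShortExact)

/-- Dimension shifting: the obstruction to lifting lies in Ext in positive degree out of the
projective middle term. The next lemma gives the injectivity of the shift in degrees n ≥ 1. -/
theorem exists_extClass_comp [Projective S.X₂] (N : ModuleCat.{v} A) {n m : ℕ} (hn : 1 + n = m)
    (e : Ext.{v} S.X₃ N m) : ∃ e' : Ext.{v} S.X₁ N n, hS.extClass.comp e' hn = e := by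
  apply Ext.contravariant_sequence_exact₃ hS
  exact Ext.eq_zero_of_hasProjectiveDimensionLT _ 1 (by omega)

theorem eq_zero_of_extClass_comp_eq_zero [Projective S.X₂] {N : ModuleCat.{v} A} {n m : ℕ}
    (h1 : 1 ≤ n) (hn : 1 + n = m)
    (e : Ext.{v} S.X₁ N n) (h : hS.extClass.comp e hn = 0) : e = 0 := by
  obtain ⟨y, rfl⟩ := Ext.contravariant_sequence_exact₁ hS _ e hn h
  rw [Ext.eq_zero_of_hasProjectiveDimensionLT y 1 h1, Ext.comp_zero]

theorem extClass_comp_mk₀_eq_zero_iff {N : ModuleCat.{v} A} (g : S.X₁ ⟶ N) :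
    hS.extClass.comp (Ext.mk₀ g) (add_zero 1) = 0 ↔ ∃ h : S.X₂ ⟶ N, S.f ≫ h = g := by
  constructor
  · intro h
    obtain ⟨y, hy⟩ := Ext.contravariant_sequence_exact₁ hS _ _ _ h
    obtain ⟨y, rfl⟩ := Ext.addEquiv₀.symm.surjective y
    refine ⟨y, ?_⟩
    apply Ext.addEquiv₀.symm.injective
    simpa using hy
  · rintro ⟨h, rfl⟩
    rw [← Ext.mk₀_comp_mk₀]
    exact hS.extClass_comp_assoc _

end

/-- `α ∈ Ext^n(M, K)` is a syzygy class for `i : K → F` if composition with `α` identifies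
`Ext^n(M, N)` with the maps `K → N` modulo those that extend to `F`. -/
def IsSyzygyClass (i : K →ₗ[A] F) {n : ℕ}
    (α : Ext.{v} (ModuleCat.of A M) (ModuleCat.of A K) n) : Prop :=
  ∀ (N : Type v) [AddCommGroup N] [Module A N],
    (∀ g : K →ₗ[A] N, α.comp (Ext.mk₀ (ModuleCat.ofHom g)) (add_zero n) = 0 ↔
      ∃ h : F →ₗ[A] N, h ∘ₗ i = g) ∧
    (∀ e : Ext.{v} (ModuleCat.of A M) (ModuleCat.of A N) n,
      ∃ g : K →ₗ[A] N, α.comp (Ext.mk₀ (ModuleCat.ofHom g)) (add_zero n) = e)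

theorem exists_isSyzygyClass_one [Module.Projective A F] {i : K →ₗ[A] F} {p : F →ₗ[A] M}
    (hi : Function.Injective i) (hip : Function.Exact i p) (hp : Function.Surjective p) :
    ∃ α : Ext.{v} (ModuleCat.of A M) (ModuleCat.of A K) 1, IsSyzygyClass i α := by
  have hS := shortExact_of_exact hi hip hp
  have : Projective (ModuleCat.of A F) :=
    (IsProjective.iff_projective _).1 inferInstance
  refine ⟨hS.extClass, fun N _ _ => ⟨fun g => ?_, fun e => ?_⟩⟩
  · refine (extClass_comp_mk₀_eq_zero_iff hS (ModuleCat.ofHom g)).trans ?_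
    constructor
    · rintro ⟨h, hh⟩
      exact ⟨h.hom, by simpa using congrArg ModuleCat.Hom.hom hh⟩
    · rintro ⟨h, rfl⟩
      exact ⟨ModuleCat.ofHom h, rfl⟩
  · obtain ⟨e', he'⟩ := exists_extClass_comp hS (ModuleCat.of A N) (add_zero 1) e
    obtain ⟨y, rfl⟩ := Ext.addEquiv₀.symm.surjective e'
    exact ⟨y.hom, he'⟩

theorem IsSyzygyClass.shift [Module.Projective A F'] {i : K →ₗ[A] F} {n : ℕ} (hn : 1 ≤ n)
    {α : Ext.{v} (ModuleCat.of A M') (ModuleCat.of A K) n} (hα : IsSyzygyClass i α)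
    {j : M' →ₗ[A] F'} {p : F' →ₗ[A] M}
    (hj : Function.Injective j) (hjp : Function.Exact j p) (hp : Function.Surjective p) :
    ∃ β : Ext.{v} (ModuleCat.of A M) (ModuleCat.of A K) (1 + n), IsSyzygyClass i β := by
  have hS := shortExact_of_exact hj hjp hp
  have : Projective (ModuleCat.of A F') :=
    (IsProjective.iff_projective _).1 inferInstance
  refine ⟨hS.extClass.comp α rfl, fun N _ _ => ⟨fun g => ?_, fun e => ?_⟩⟩
  · rw [Ext.comp_assoc_of_third_deg_zero, ← (hα N).1 g]
    constructor
    · exact eq_zero_of_extClass_comp_eq_zero hS hn rfl _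
    · intro h; rw [h, Ext.comp_zero]
  · obtain ⟨e', rfl⟩ := exists_extClass_comp hS (ModuleCat.of A N) rfl e
    obtain ⟨g, rfl⟩ := (hα N).2 e'
    exact ⟨g, by rw [Ext.comp_assoc_of_third_deg_zero]⟩

end Syzygy

end DoubleExt
end

/-! ### Homogeneous components and the augmentation. -/

noncomputable section

namespace DoubleExt

namespace IsConnectedGraded

variable {k : Type u} {A : Type v} [Field k] [Ring A] [Algebra k A] {𝒜 : ℕ → Submodule k A}

/-- The `GradedAlgebra` structure of a connected graded algebra. -/
abbrev gradedAlgebra (h : IsConnectedGraded 𝒜) : GradedAlgebra 𝒜 :=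
  letI := h.gradedMonoid
  letI := h.isInternal.chooseDecomposition
  { }

/-- The homogeneous component of degree `n`. -/
def proj (h : IsConnectedGraded 𝒜) (n : ℕ) : A →ₗ[k] A :=
  letI := h.gradedAlgebra
  GradedAlgebra.proj 𝒜 n

variable (h : IsConnectedGraded 𝒜)
include h

theorem proj_mem (n : ℕ) (a : A) : h.proj n a ∈ 𝒜 n := by
  let _ := h.gradedAlgebra
  exact SetLike.coe_mem _

theorem proj_of_mem {n : ℕ} {a : A} (ha : a ∈ 𝒜 n) : h.proj n a = a := by
  let _ := h.gradedAlgebra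
  exact DirectSum.decompose_of_mem_same 𝒜 ha

theorem proj_of_mem_ne {n m : ℕ} {a : A} (ha : a ∈ 𝒜 n) (hnm : n ≠ m) : h.proj m a = 0 := by
  let _ := h.gradedAlgebra
  exact DirectSum.decompose_of_mem_ne 𝒜 ha hnm

theorem exists_eq_sum_proj (a : A) :
    ∃ N, ∀ n, N ≤ n → a = ∑ i ∈ Finset.range n, h.proj i a := by
  let _ := h.gradedAlgebra
  classical
  refine ⟨(DirectSum.decompose 𝒜 a).support.sup id + 1, fun n hn => ?_⟩
  conv_lhs => rw [← DirectSum.sum_support_decompose 𝒜 a]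
  apply Finset.sum_subset
  · intro i hi
    have := Finset.le_sup (f := id) hi
    simp only [id, Finset.mem_range] at *
    omega
  · intro i _ hi
    simpa using hi

theorem mul_mem {m n : ℕ} {a b : A} (ha : a ∈ 𝒜 m) (hb : b ∈ 𝒜 n) : a * b ∈ 𝒜 (m + n) :=
  h.gradedMonoid.mul_mem ha hb

theorem one_mem : (1 : A) ∈ 𝒜 0 := h.gradedMonoid.one_mem

theorem pow_mem {m : ℕ} {a : A} (ha : a ∈ 𝒜 m) (n : ℕ) : a ^ n ∈ 𝒜 (n * m) := by
  have := h.gradedMonoid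
  simpa using SetLike.pow_mem_graded n ha

theorem proj_mul_right {m : ℕ} (n : ℕ) (a : A) {b : A} (hb : b ∈ 𝒜 m) :
    h.proj (n + m) (a * b) = h.proj n a * b := by
  let _ := h.gradedAlgebra
  exact DirectSum.coe_decompose_mul_add_of_right_mem 𝒜 hb

theorem proj_mul_left {m : ℕ} (n : ℕ) {a : A} (ha : a ∈ 𝒜 m) (b : A) :
    h.proj (m + n) (a * b) = a * h.proj n b := by
  let _ := h.gradedAlgebra
  exact DirectSum.coe_decompose_mul_add_of_left_mem 𝒜 ha

theorem proj_mul_right_of_lt {m n : ℕ} (hmn : n < m) (a : A) {b : A} (hb : b ∈ 𝒜 m) :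
    h.proj n (a * b) = 0 := by
  let _ := h.gradedAlgebra
  exact DirectSum.coe_decompose_mul_of_right_mem_of_not_le 𝒜 hb (by omega)

theorem mem_zero_iff {a : A} : a ∈ 𝒜 0 ↔ ∃ t : k, algebraMap k A t = a := by
  rw [h.zero_eq]; exact Submodule.mem_one

theorem algebraMap_injective : Function.Injective (algebraMap k A) :=
  have := h.nontrivial
  FaithfulSMul.algebraMap_injective k A

theorem exists_algebraMap_eq_proj_zero (a : A) : ∃ t : k, algebraMap k A t = h.proj 0 a :=
  h.mem_zero_iff.1 (h.proj_mem 0 a)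

theorem proj_zero_mul (a b : A) : h.proj 0 (a * b) = h.proj 0 a * h.proj 0 b := by
  let _ := h.gradedAlgebra
  exact map_mul (GradedRing.projZeroRingHom 𝒜) a b

/-- The function underlying the augmentation. -/
def augFun (a : A) : k := (h.exists_algebraMap_eq_proj_zero a).choose

theorem algebraMap_augFun (a : A) : algebraMap k A (h.augFun a) = h.proj 0 a :=
  (h.exists_algebraMap_eq_proj_zero a).choose_spec

/-- The augmentation `A → k`. -/
def aug : A →ₐ[k] k :=
  AlgHom.ofLinearMap
    { toFun := h.augFun
      map_add' := fun a b => h.algebraMap_injective <| by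
        simp only [map_add, h.algebraMap_augFun]
      map_smul' := fun t a => h.algebraMap_injective <| by
        rw [RingHom.id_apply, smul_eq_mul, map_mul, h.algebraMap_augFun, h.algebraMap_augFun,
          map_smul, Algebra.smul_def] }
    (h.algebraMap_injective <| by
      simp [h.algebraMap_augFun, h.proj_of_mem h.one_mem])
    (fun a b => h.algebraMap_injective <| by
      simp [h.algebraMap_augFun, h.proj_zero_mul])

theorem algebraMap_aug (a : A) : algebraMap k A (h.aug a) = h.proj 0 a :=
  h.algebraMap_augFun a

theorem aug_of_mem {n : ℕ} (hn : 1 ≤ n) {a : A} (ha : a ∈ 𝒜 n) : h.aug a = 0 :=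
  h.algebraMap_injective <| by rw [h.algebraMap_aug, h.proj_of_mem_ne ha (by omega), map_zero]

/-- Passing to linear parts in this way converts identities with coefficients in the algebra into
identities with coefficients in k, which is how all tensors over k are extracted from the
resolution. -/
theorem proj_one_mul {a b : A} (hb : b ∈ 𝒜 1) : h.proj 1 (a * b) = h.aug a • b := by
  rw [show 1 = 0 + 1 from rfl, h.proj_mul_right 0 a hb, ← h.algebraMap_aug, Algebra.smul_def]

theorem proj_one_mul' {a b : A} (ha : a ∈ 𝒜 1) : h.proj 1 (a * b) = h.aug b • a := by
  rw [show 1 = 1 + 0 from rfl, h.proj_mul_left 0 ha b, ← h.algebraMap_aug, ← Algebra.commutes,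
    Algebra.smul_def]

theorem mem_augIdeal_iff {a : A} : a ∈ augIdeal 𝒜 ↔ h.aug a = 0 := by
  constructor
  · intro ha
    induction ha using Submodule.span_induction with
    | mem x hx => obtain ⟨n, hn, hx⟩ := hx; exact h.aug_of_mem hn hx
    | zero => simp
    | add x y _ _ hx hy => simp [hx, hy]
    | smul c x _ hx => simp [hx]
  · intro ha
    obtain ⟨N, hN⟩ := h.exists_eq_sum_proj a
    rw [hN N le_rfl]
    refine Submodule.sum_mem _ fun i _ => ?_
    rcases Nat.eq_zero_or_pos i with rfl | hi
    · rw [← h.algebraMap_aug, ha, map_zero]; exact zero_mem _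
    · exact Submodule.subset_span ⟨i, hi, h.proj_mem i a⟩

omit h in
theorem mem_augIdeal_of_mem {n : ℕ} (hn : 1 ≤ n) {a : A} (ha : a ∈ 𝒜 n) : a ∈ augIdeal 𝒜 :=
  Submodule.subset_span ⟨n, hn, ha⟩

end IsConnectedGraded

end DoubleExt
end

/-! ### Dualising the resolution by the Gorenstein condition. -/

noncomputable section

namespace DoubleExt

open Abelian

theorem exists_comp_eq_of_ker_le {A : Type*} [Ring A] {M N P : Type*} [AddCommGroup M]
    [AddCommGroup N] [AddCommGroup P] [Module A M] [Module A N] [Module A P]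
    (p : M →ₗ[A] N) (hp : Function.Surjective p) (φ : M →ₗ[A] P)
    (h : ∀ m, p m = 0 → φ m = 0) : ∃ g : N →ₗ[A] P, ∀ m, g (p m) = φ m := by
  refine ⟨(LinearMap.ker p).liftQ φ (fun m hm => h m hm) ∘ₗ
    (p.quotKerEquivOfSurjective hp).symm.toLinearMap, fun m => ?_⟩
  have : (p.quotKerEquivOfSurjective hp).symm (p m) = (LinearMap.ker p).mkQ m := by
    rw [LinearEquiv.symm_apply_eq]; rfl
  simp only [LinearMap.comp_apply, LinearEquiv.coe_coe, this]
  exact Submodule.liftQ_apply _ _ _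

/-- The linear map `v ↦ ∑ i, v i * x i` of left modules. -/
def rowSum {A ι : Type*} [Ring A] [Fintype ι] (x : ι → A) : (ι → A) →ₗ[A] A :=
  Fintype.linearCombination A x

@[simp] theorem rowSum_apply {A ι : Type*} [Ring A] [Fintype ι] (x : ι → A) (v : ι → A) :
    rowSum x v = ∑ i, v i * x i := by
  simp [rowSum, Fintype.linearCombination_apply]

theorem exists_eq_rowSum {A ι : Type*} [Ring A] [Fintype ι] [DecidableEq ι]
    (h : (ι → A) →ₗ[A] A) (v : ι → A) : h v = ∑ i, v i * h (Pi.single i 1) := by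
  conv_lhs => rw [pi_eq_sum_univ' v]
  rw [map_sum]
  refine Finset.sum_congr rfl fun i _ => ?_
  rw [map_smul, smul_eq_mul]

section Dual

variable {k : Type u} {B : Type v} [Field k] [Ring B] [Algebra k B] {ℬ : ℕ → Submodule k B}
  {ι κ : Type} [Fintype ι] [Fintype κ]

/-- The surjection onto the augmentation ideal given by generators. -/
def toAugIdeal {x : ι → B} (hx : Set.range (fun v : ι → B => ∑ i, v i * x i) = augIdeal ℬ) :
    (ι → B) →ₗ[B] augIdeal ℬ :=
  (rowSum x).codRestrict (augIdeal ℬ) fun v => by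
    rw [← SetLike.mem_coe, ← hx]; exact ⟨v, by simp⟩

@[simp] theorem coe_toAugIdeal {x : ι → B}
    (hx : Set.range (fun v : ι → B => ∑ i, v i * x i) = augIdeal ℬ) (v : ι → B) :
    (toAugIdeal hx v : B) = ∑ i, v i * x i := by
  simp [toAugIdeal]

theorem toAugIdeal_surjective {x : ι → B}
    (hx : Set.range (fun v : ι → B => ∑ i, v i * x i) = augIdeal ℬ) :
    Function.Surjective (toAugIdeal hx) := by
  rintro ⟨b, hb⟩
  rw [← SetLike.mem_coe, ← hx] at hb
  obtain ⟨v, hv⟩ := hb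
  exact ⟨v, Subtype.ext (by simpa using hv)⟩

theorem toAugIdeal_eq_zero_iff {x : ι → B}
    (hx : Set.range (fun v : ι → B => ∑ i, v i * x i) = augIdeal ℬ) (v : ι → B) :
    toAugIdeal hx v = 0 ↔ ∑ i, v i * x i = 0 := by
  rw [← coe_toAugIdeal hx v, Submodule.coe_eq_zero]

variable (ℬ) in
theorem exact_augIdeal : Function.Exact (augIdeal ℬ).subtype (augIdeal ℬ).mkQ :=
  LinearMap.exact_subtype_mkQ _

/-- Vanishing of `Ext¹(k, B)`: the left syzygies of the generators generate their relations also
from the right. -/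
theorem exists_eq_mul_of_ext_one [DecidableEq ι]
    (h1 : Subsingleton (Ext.{v} (trivialModule ℬ) (ModuleCat.of B B) 1))
    {x : ι → B} (hx : Set.range (fun v : ι → B => ∑ i, v i * x i) = augIdeal ℬ)
    {u : ι → B} (hu : ∀ v : ι → B, ∑ i, v i * x i = 0 → ∑ i, v i * u i = 0) :
    ∃ b, ∀ i, u i = x i * b := by
  obtain ⟨g, hg⟩ := exists_comp_eq_of_ker_le (toAugIdeal hx) (toAugIdeal_surjective hx)
    (rowSum u) (fun m hm => by
      rw [rowSum_apply]; exact hu _ ((toAugIdeal_eq_zero_iff hx m).1 hm))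
  obtain ⟨α, hα⟩ := exists_isSyzygyClass_one (augIdeal ℬ).injective_subtype (exact_augIdeal ℬ)
    (augIdeal ℬ).mkQ_surjective
  obtain ⟨h, hh⟩ := ((hα B).1 g).1 (h1.elim _ _)
  refine ⟨h 1, fun i => ?_⟩
  have h2 := hg (Pi.single i 1)
  rw [← hh] at h2
  simp only [LinearMap.comp_apply, Submodule.subtype_apply, coe_toAugIdeal, rowSum_apply,
    Pi.single_apply, ite_mul, one_mul, zero_mul, Finset.sum_ite_eq', Finset.mem_univ, if_true] at h2
  rw [← h2, ← smul_eq_mul, ← map_smul, smul_eq_mul, mul_one]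

theorem coe_rangeRestrict {A M N : Type*} [Ring A] [AddCommGroup M]
    [AddCommGroup N] [Module A M] [Module A N] (f : M →ₗ[A] N) (m : M) :
    (f.rangeRestrict m : N) = f m := rfl

theorem exact_subtype_rangeRestrict {A M N P : Type*} [Ring A] [AddCommGroup M]
    [AddCommGroup N] [AddCommGroup P] [Module A M] [Module A N] [Module A P]
    {f : M →ₗ[A] N} {g : N →ₗ[A] P} (h : Function.Exact f g) :
    Function.Exact f.range.subtype g.rangeRestrict := by
  intro y
  rw [← Submodule.coe_eq_zero, coe_rangeRestrict, h y]
  simp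

theorem exact_rangeRestrict {A M N P : Type*} [Ring A] [AddCommGroup M]
    [AddCommGroup N] [AddCommGroup P] [Module A M] [Module A N] [Module A P]
    {f : M →ₗ[A] N} {g : N →ₗ[A] P} (h : Function.Exact f g) :
    Function.Exact f g.rangeRestrict := by
  intro y
  rw [← Submodule.coe_eq_zero, coe_rangeRestrict, h y]

/-- The columns of a resolution `0 → B → B^ι → B^κ → B^ι → B → k → 0` satisfying the Gorenstein
condition: the dual complex is exact where needed. -/
theorem dual_exact [DecidableEq ι] [DecidableEq κ] (hG : IsLeftGorenstein ℬ 4)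
    {x x' : ι → B} {F : Matrix κ ι B} {G : Matrix ι κ B}
    (hx' : Function.Injective fun (b : B) (j : ι) => b * x' j)
    (hG' : Function.Exact (fun (b : B) (j : ι) => b * x' j) fun v : ι → B => Matrix.vecMul v G)
    (hF : Function.Exact (fun v : ι → B => Matrix.vecMul v G) fun v => Matrix.vecMul v F)
    (hX : Function.Exact (fun v : κ → B => Matrix.vecMul v F) fun v => ∑ i, v i * x i)
    (hx : Set.range (fun v : ι → B => ∑ i, v i * x i) = augIdeal ℬ) :
    (∀ u : ι → B, F.mulVec u = 0 → ∃ b, ∀ i, u i = x i * b) ∧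
    (∀ u : ι → B, ∑ i, x' i * u i = 0 → ∃ h, G.mulVec h = u) ∧
    (∀ a ∈ ℬ 1, ∃ u : ι → B, ∑ i, x' i * u i = a) := by
  let d3 : B →ₗ[B] (ι → B) := LinearMap.toSpanSingleton B (ι → B) x'
  have hd3 : (d3 : B → ι → B) = fun (b : B) (j : ι) => b * x' j := by
    ext b j; simp [d3]
  have e3 : Function.Exact d3 G.vecMulLinear := by rw [hd3]; exact hG'
  have e2 : Function.Exact G.vecMulLinear F.vecMulLinear := hF
  have e1 : Function.Exact F.vecMulLinear (toAugIdeal hx) := by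
    intro v
    rw [toAugIdeal_eq_zero_iff]
    exact hX v
  have e1' : Function.Exact F.vecMulLinear.range.subtype (toAugIdeal hx) := by
    intro v
    rw [e1 v]; simp
  have i3 : Function.Injective d3 := by rw [hd3]; exact hx'
  -- The classes `α3` in Ext³(k, im G) and `β4` in Ext⁴(k, B) are built up one syzygy at a time.
  -- They identify Ext³ and Ext⁴ of k with maps out of im G and out of the last copy of B, modulo
  -- the maps that extend to the next free module.
  obtain ⟨α1, hα1⟩ := exists_isSyzygyClass_one (G.vecMulLinear.range).injective_subtype
    (exact_subtype_rangeRestrict e2) F.vecMulLinear.surjective_rangeRestrict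
  obtain ⟨α2, hα2⟩ := hα1.shift le_rfl (Submodule.injective_subtype _) e1'
    (toAugIdeal_surjective hx)
  obtain ⟨α3, hα3⟩ := hα2.shift (by omega) (augIdeal ℬ).injective_subtype (exact_augIdeal ℬ)
    (augIdeal ℬ).mkQ_surjective
  obtain ⟨β1, hβ1⟩ := exists_isSyzygyClass_one i3 (exact_rangeRestrict e3)
    G.vecMulLinear.surjective_rangeRestrict
  obtain ⟨β2, hβ2⟩ := hβ1.shift le_rfl (G.vecMulLinear.range).injective_subtype
    (exact_subtype_rangeRestrict e2) F.vecMulLinear.surjective_rangeRestrict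
  obtain ⟨β3, hβ3⟩ := hβ2.shift (by omega) (Submodule.injective_subtype _) e1'
    (toAugIdeal_surjective hx)
  obtain ⟨β4, hβ4⟩ := hβ3.shift (by omega) (augIdeal ℬ).injective_subtype (exact_augIdeal ℬ)
    (augIdeal ℬ).mkQ_surjective
  refine ⟨fun u hu => ?_, fun u hu => ?_, fun a ha => ?_⟩
  · refine exists_eq_mul_of_ext_one (hG.ext_eq_zero 1 (by norm_num)) hx fun v hv => ?_
    obtain ⟨s, rfl⟩ := (hX v).1 hv
    have := Matrix.dotProduct_mulVec s F u
    rw [hu] at this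
    simpa [dotProduct] using this.symm
  · obtain ⟨g, hg⟩ := exists_comp_eq_of_ker_le G.vecMulLinear.rangeRestrict
      G.vecMulLinear.surjective_rangeRestrict (rowSum u) (fun m hm => by
        rw [← Submodule.coe_eq_zero, coe_rangeRestrict] at hm
        obtain ⟨b, rfl⟩ := (e3 m).1 hm
        simp [d3, hu])
    have : Subsingleton (Ext.{v} (trivialModule ℬ) (ModuleCat.of B B) 3) :=
      hG.ext_eq_zero 3 (by norm_num)
    obtain ⟨h, hh⟩ := ((hα3 B).1 g).1 (this.elim _ _)
    refine ⟨fun b => h (Pi.single b 1), ?_⟩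
    ext i
    have h2 := hg (Pi.single i 1)
    rw [← hh, LinearMap.comp_apply, exists_eq_rowSum h] at h2
    simp only [Submodule.subtype_apply, coe_rangeRestrict, rowSum_apply,
      Pi.single_apply, ite_mul, one_mul, zero_mul, Finset.sum_ite_eq', Finset.mem_univ,
      if_true] at h2
    rw [← h2]
    simp [Matrix.mulVec, dotProduct]
  · have h0 : β4.comp (Ext.mk₀ (rightMulHom a)) (add_zero 4) = 0 :=
      hG.ext_smul 1 le_rfl a ha β4
    obtain ⟨h, hh⟩ := ((hβ4 B).1 (LinearMap.toSpanSingleton B B a)).1 h0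
    refine ⟨fun i => h (Pi.single i 1), ?_⟩
    have := LinearMap.congr_fun hh 1
    rw [LinearMap.comp_apply, exists_eq_rowSum] at this
    simpa [d3] using this

end Dual

end DoubleExt
end

/-! ### Using one basis of B₁ at both ends of the resolution. -/

noncomputable section

namespace DoubleExt

open Matrix

variable {k : Type u} {B : Type v} [Field k] [Ring B] [Algebra k B] {ℬ : ℕ → Submodule k B}

/-- A resolution `0 → B → B^ι → B⁶ → B^ι → B → k → 0` with linear entries whose first and last
maps are given by the same elements `x`, together with the exactness of the dual complex that
follows from the Gorenstein condition. -/
structure IsAdaptedResolution {ι : Type} [Fintype ι] (ℬ : ℕ → Submodule k B) (x : ι → B)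
    (F : Matrix (Fin 6) ι B) (G : Matrix ι (Fin 6) B) : Prop where
  F_mem : ∀ i j, F i j ∈ ℬ 1
  G_mem : ∀ i j, G i j ∈ ℬ 1
  gen : ∀ b ∈ augIdeal ℬ, ∃ u : ι → B, u ⬝ᵥ x = b
  rel : ∀ u : ι → B, u ⬝ᵥ x = 0 ↔ ∃ s, s ᵥ* F = u
  rel₂ : ∀ s, s ᵥ* F = 0 ↔ ∃ t, t ᵥ* G = s
  rel₃ : ∀ t, t ᵥ* G = 0 ↔ ∃ b, ∀ i, b * x i = t i
  dual₁ : ∀ u, F *ᵥ u = 0 → ∃ b, ∀ i, u i = x i * b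
  dual₃ : ∀ u : ι → B, x ⬝ᵥ u = 0 → ∃ h, G *ᵥ h = u

/-- Two bases of a subspace differ by an invertible matrix. -/
theorem exists_change_basis {ι κ : Type*} [Fintype ι] [Fintype κ] [DecidableEq ι] [DecidableEq κ]
    {V : Submodule k B} (b : Module.Basis ι k V) (c : Module.Basis κ k V) :
    ∃ (Q : Matrix κ ι k) (Q' : Matrix ι κ k), Q * Q' = 1 ∧ Q' * Q = 1 ∧
      (∀ i, (c i : B) = ∑ j, Q i j • (b j : B)) ∧ (∀ i, (b i : B) = ∑ j, Q' i j • (c j : B)) := by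
  refine ⟨(b.toMatrix c)ᵀ, (c.toMatrix b)ᵀ, ?_, ?_, fun i => ?_, fun i => ?_⟩
  · rw [← transpose_mul, Module.Basis.toMatrix_mul_toMatrix_flip, transpose_one]
  · rw [← transpose_mul, Module.Basis.toMatrix_mul_toMatrix_flip, transpose_one]
  · conv_lhs => rw [← b.sum_toMatrix_smul_self c i]
    simp only [Submodule.coe_sum, Submodule.coe_smul, transpose_apply]
  · conv_lhs => rw [← c.sum_toMatrix_smul_self b i]
    simp only [Submodule.coe_sum, Submodule.coe_smul, transpose_apply]

/-- The entries of the first map generate B₊ and are independent because their syzygies have no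
constant terms, so they form a basis of B₁. The entries of the last map span B₁ because B₊ kills
Ext⁴(k, B), hence are a basis too. Each change of basis is absorbed by the neighbouring matrix F or
G, while the middle module B⁶ is left alone, so F and G still compose to zero. -/
theorem exists_isAdaptedResolution (hc : IsConnectedGraded ℬ) (hG : IsLeftGorenstein ℬ 4)
    (hr : Has14641Resolution ℬ) :
    Module.finrank k (ℬ 1) = 4 ∧ ∀ {ι : Type} [Fintype ι] [DecidableEq ι]
      (b : Module.Basis ι k (ℬ 1)), ∃ F G, IsAdaptedResolution ℬ (fun i => (b i : B)) F G := by
  obtain ⟨x, F, G, x', hxm, hFm, hGm, hxm', h4, h3, h2, h1, h0⟩ := hr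
  obtain ⟨D1, D3, D4⟩ := dual_exact hG h4 h3 h2 h1 h0
  -- the `x i` form a basis of `B₁`
  have hxs : ∀ a ∈ ℬ 1, ∃ c : Fin 4 → k, ∑ i, c i • x i = a := by
    intro a ha
    have h5 : a ∈ (augIdeal ℬ : Set B) := IsConnectedGraded.mem_augIdeal_of_mem le_rfl ha
    rw [← h0] at h5
    obtain ⟨u, hu⟩ := h5
    refine ⟨fun i => hc.aug (u i), ?_⟩
    rw [← hc.proj_of_mem ha, ← hu, map_sum]
    exact Finset.sum_congr rfl fun i _ => (hc.proj_one_mul (hxm i)).symm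
  have hxs' : ∀ a ∈ ℬ 1, ∃ c : Fin 4 → k, ∑ i, c i • x' i = a := by
    intro a ha
    obtain ⟨u, hu⟩ := D4 a ha
    refine ⟨fun i => hc.aug (u i), ?_⟩
    rw [← hc.proj_of_mem ha, ← hu, map_sum]
    exact Finset.sum_congr rfl fun i _ => (hc.proj_one_mul' (hxm' i)).symm
  have hxi : LinearIndependent k (fun i => (⟨x i, hxm i⟩ : ℬ 1)) := by
    rw [Fintype.linearIndependent_iff]
    intro c hcx i
    have h5 : ∑ i, algebraMap k B (c i) * x i = 0 := by
      simpa [Algebra.smul_def] using congrArg Subtype.val hcx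
    obtain ⟨s, hs⟩ := (h1 (fun i => algebraMap k B (c i))).1 h5
    have h6 := congrArg hc.aug (congrFun hs i)
    simpa [vecMul, dotProduct, hc.aug_of_mem le_rfl (hFm _ _)] using h6.symm
  have htop : ∀ {y : Fin 4 → B} (hy : ∀ i, y i ∈ ℬ 1)
      (hys : ∀ a ∈ ℬ 1, ∃ c : Fin 4 → k, ∑ i, c i • y i = a),
      ⊤ ≤ Submodule.span k (Set.range fun i => (⟨y i, hy i⟩ : ℬ 1)) := by
    rintro y hy hys ⟨a, ha⟩ -
    obtain ⟨c, rfl⟩ := hys a ha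
    rw [Submodule.mem_span_range_iff_exists_fun]
    exact ⟨c, Subtype.ext (by simp)⟩
  let bx : Module.Basis (Fin 4) k (ℬ 1) := Module.Basis.mk hxi (htop hxm hxs)
  have hdim : Module.finrank k (ℬ 1) = 4 := by
    simpa using Module.finrank_eq_card_basis bx
  let bx' : Module.Basis (Fin 4) k (ℬ 1) := basisOfTopLeSpanOfCardEqFinrank _ (htop hxm' hxs')
    (by simp [hdim])
  have hbx : ∀ i, (bx i : B) = x i := fun i => by simp [bx]
  have hbx' : ∀ i, (bx' i : B) = x' i := fun i => by simp [bx']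
  refine ⟨hdim, fun {ι} _ _ b => ?_⟩
  obtain ⟨Q, Q', hQ1, hQ2, hQ3, hQ4⟩ := exists_change_basis b bx
  obtain ⟨P, P', hP1, hP2, hP3, hP4⟩ := exists_change_basis b bx'
  let φ := algebraMap k B
  let v : ι → B := fun i => (b i : B)
  have q1 : Q.map φ * Q'.map φ = 1 := by rw [← Matrix.map_mul, hQ1]; simp
  have q2 : Q'.map φ * Q.map φ = 1 := by rw [← Matrix.map_mul, hQ2]; simp
  have p1 : Pᵀ.map φ * P'ᵀ.map φ = 1 := by
    rw [← Matrix.map_mul, ← transpose_mul, hP2]; simp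
  have p2 : P'ᵀ.map φ * Pᵀ.map φ = 1 := by
    rw [← Matrix.map_mul, ← transpose_mul, hP1]; simp
  have xQ : x = Q.map φ *ᵥ v := by
    ext i; rw [← hbx, hQ3]; simp [mulVec, dotProduct, Algebra.smul_def, v, φ]
  have vQ : v = Q'.map φ *ᵥ x := by
    rw [xQ, mulVec_mulVec, q2, one_mulVec]
  have xP : x' = v ᵥ* Pᵀ.map φ := by
    ext i; rw [← hbx', hP3]; simp [vecMul, dotProduct, Algebra.smul_def, v, φ, Algebra.commutes]
  have vP : v = x' ᵥ* P'ᵀ.map φ := by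
    rw [xP, vecMul_vecMul, p1, vecMul_one]
  have smulP : ∀ (a : B), (fun i => a * x' i) = (fun i => a * v i) ᵥ* Pᵀ.map φ := by
    intro a; rw [xP]; ext i
    simp [vecMul, dotProduct, Finset.mul_sum, mul_assoc]
  refine ⟨F * Q.map φ, Pᵀ.map φ * G, ⟨fun i j => ?_, fun i j => ?_, fun a ha => ?_, fun u => ?_,
    fun s => ?_, fun t => ?_, fun u hu => ?_, fun u hu => ?_⟩⟩
  · simp only [mul_apply, map_apply]
    exact Submodule.sum_mem _ fun l _ => by
      rw [← Algebra.commutes, ← Algebra.smul_def]; exact Submodule.smul_mem _ _ (hFm _ _)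
  · simp only [mul_apply, map_apply]
    exact Submodule.sum_mem _ fun l _ => by
      rw [← Algebra.smul_def]; exact Submodule.smul_mem _ _ (hGm _ _)
  · rw [← SetLike.mem_coe, ← h0] at ha
    obtain ⟨u, hu⟩ := ha
    refine ⟨u ᵥ* Q.map φ, ?_⟩
    change _ ⬝ᵥ v = _
    rw [← dotProduct_mulVec, ← xQ]; exact hu
  · change u ⬝ᵥ v = 0 ↔ _
    rw [vQ, dotProduct_mulVec]
    refine (h1 (u ᵥ* Q'.map φ)).trans ⟨?_, ?_⟩
    · rintro ⟨s, hs⟩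
      refine ⟨s, ?_⟩
      change s ᵥ* F = _ at hs
      rw [← vecMul_vecMul, hs, vecMul_vecMul, q2, vecMul_one]
    · rintro ⟨s, rfl⟩
      refine ⟨s, ?_⟩
      change s ᵥ* F = _
      rw [vecMul_vecMul, Matrix.mul_assoc, q1, Matrix.mul_one]
  · have : s ᵥ* (F * Q.map φ) = 0 ↔ s ᵥ* F = 0 := by
      rw [← vecMul_vecMul]
      refine ⟨fun h => ?_, fun h => by rw [h, zero_vecMul]⟩
      rw [← vecMul_one (s ᵥ* F), ← q1, ← vecMul_vecMul, h, zero_vecMul]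
    rw [this]
    refine (h2 s).trans ⟨?_, ?_⟩
    · rintro ⟨t, rfl⟩
      refine ⟨t ᵥ* P'ᵀ.map φ, ?_⟩
      change _ = t ᵥ* G
      rw [← vecMul_vecMul, vecMul_vecMul t, p2, vecMul_one]
    · rintro ⟨t, rfl⟩
      exact ⟨t ᵥ* Pᵀ.map φ, by simp⟩
  · rw [← vecMul_vecMul]
    refine (h3 _).trans ⟨?_, ?_⟩
    · rintro ⟨a, ha⟩
      refine ⟨a, fun i => congrFun (f := fun i => a * v i) ?_ i⟩
      have ha : (fun i => a * x' i) = t ᵥ* Pᵀ.map φ := ha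
      rw [smulP] at ha
      rw [← vecMul_one (fun i => a * v i), ← p1, ← vecMul_vecMul, ha, vecMul_vecMul, p1,
        vecMul_one]
    · rintro ⟨a, ha⟩
      refine ⟨a, ?_⟩
      change (fun i => a * x' i) = _
      rw [smulP]; congr 1; ext i; exact ha i
  · rw [← mulVec_mulVec] at hu
    obtain ⟨a, ha⟩ := D1 _ hu
    refine ⟨a, fun i => ?_⟩
    have h5 : Q.map φ *ᵥ u = Q.map φ *ᵥ (fun i => v i * a) := by
      ext i
      rw [ha i, xQ]
      simp [mulVec, dotProduct, Finset.sum_mul, mul_assoc]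
    have h6 := congrArg (Q'.map φ *ᵥ ·) h5
    simp only [mulVec_mulVec, q2, one_mulVec] at h6
    exact congrFun h6 i
  · change v ⬝ᵥ u = 0 at hu
    rw [vP, ← dotProduct_mulVec] at hu
    obtain ⟨h, hh⟩ := D3 _ hu
    refine ⟨h, ?_⟩
    rw [← mulVec_mulVec, hh, mulVec_mulVec, p1, one_mulVec]

end DoubleExt
end

/-! ### The Hilbert function. -/

noncomputable section

namespace DoubleExt

open Matrix

variable {k : Type u} {B : Type v} [Field k] [Ring B] [Algebra k B] {ℬ : ℕ → Submodule k B}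

/-- Rank-nullity in a single degree. The last hypothesis holds for graded maps: a homogeneous image
has a homogeneous preimage. -/
theorem finrank_ker_inf_add {P Q : Type*} [AddCommGroup P] [AddCommGroup Q] [Module k P]
    [Module k Q] (φ : P →ₗ[k] Q) (p : Submodule k P) [FiniteDimensional k p]
    (q : Submodule k Q) (h1 : ∀ v ∈ p, φ v ∈ q)
    (h2 : ∀ w ∈ q, w ∈ LinearMap.range φ → ∃ v ∈ p, φ v = w) :
    Module.finrank k ↥(LinearMap.ker φ ⊓ p) + Module.finrank k ↥(LinearMap.range φ ⊓ q) =
      Module.finrank k p := by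
  rw [← LinearMap.finrank_range_add_finrank_ker (φ.domRestrict p), add_comm]
  congr 1
  · suffices e : LinearMap.range φ ⊓ q = LinearMap.range (φ.domRestrict p) by rw [e]
    ext w
    constructor
    · rintro ⟨hw, hwq⟩
      obtain ⟨v, hv, rfl⟩ := h2 w hwq hw
      exact ⟨⟨v, hv⟩, rfl⟩
    · rintro ⟨⟨v, hv⟩, rfl⟩
      exact ⟨⟨v, rfl⟩, h1 v hv⟩
  · refine LinearEquiv.finrank_eq
      { toFun := fun v => ⟨⟨v.1, v.2.2⟩, v.2.1⟩
        invFun := fun v => ⟨v.1.1, v.2, v.1.2⟩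
        map_add' := fun _ _ => rfl
        map_smul' := fun _ _ => rfl
        left_inv := fun _ => rfl
        right_inv := fun _ => rfl }

/-- Vectors with homogeneous entries of degree `n`. -/
def gradedVec (ι : Type) (ℬ : ℕ → Submodule k B) (n : ℕ) : Submodule k (ι → B) :=
  Submodule.pi Set.univ fun _ => ℬ n

theorem mem_gradedVec {ι : Type} {n : ℕ} {w : ι → B} :
    w ∈ gradedVec ι ℬ n ↔ ∀ i, w i ∈ ℬ n := by
  simp [gradedVec]

/-- Vectors with homogeneous entries as a product. -/
def gradedVecEquiv (ι : Type) (ℬ : ℕ → Submodule k B) (n : ℕ) :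
    gradedVec ι ℬ n ≃ₗ[k] (ι → ℬ n) where
  toFun v i := ⟨v.1 i, mem_gradedVec.1 v.2 i⟩
  invFun v := ⟨fun i => v i, mem_gradedVec.2 fun i => (v i).2⟩
  map_add' _ _ := rfl
  map_smul' _ _ := rfl
  left_inv _ := rfl
  right_inv _ := rfl

theorem finrank_gradedVec (ι : Type) [Fintype ι] (n : ℕ) [Module.Finite k (ℬ n)] :
    Module.finrank k (gradedVec ι ℬ n) = Fintype.card ι * Module.finrank k (ℬ n) := by
  rw [(gradedVecEquiv ι ℬ n).finrank_eq, Module.finrank_pi_fintype]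
  simp

namespace IsConnectedGraded

variable (hc : IsConnectedGraded ℬ) {ι κ : Type} [Fintype ι]
include hc

theorem vecMul_mem {M : Matrix ι κ B} (hM : ∀ i j, M i j ∈ ℬ 1) {n : ℕ} {w : ι → B}
    (hw : w ∈ gradedVec ι ℬ n) : w ᵥ* M ∈ gradedVec κ ℬ (n + 1) :=
  mem_gradedVec.2 fun j => Submodule.sum_mem _ fun i _ =>
    hc.mul_mem (mem_gradedVec.1 hw i) (hM i j)

theorem dotProduct_mem {x : ι → B} (hx : ∀ i, x i ∈ ℬ 1) {n : ℕ} {w : ι → B}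
    (hw : w ∈ gradedVec ι ℬ n) : w ⬝ᵥ x ∈ ℬ (n + 1) :=
  Submodule.sum_mem _ fun i _ => hc.mul_mem (mem_gradedVec.1 hw i) (hx i)

theorem proj_dotProduct {x : ι → B} (hx : ∀ i, x i ∈ ℬ 1) (n : ℕ) (w : ι → B) :
    hc.proj (n + 1) (w ⬝ᵥ x) = (fun i => hc.proj n (w i)) ⬝ᵥ x := by
  simp only [dotProduct, map_sum]
  exact Finset.sum_congr rfl fun i _ => hc.proj_mul_right n _ (hx i)

theorem proj_zero_dotProduct {x : ι → B} (hx : ∀ i, x i ∈ ℬ 1) (w : ι → B) :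
    hc.proj 0 (w ⬝ᵥ x) = 0 := by
  simp only [dotProduct, map_sum]
  exact Finset.sum_eq_zero fun i _ => hc.proj_mul_right_of_lt (by omega) _ (hx i)

theorem exists_vecMul_of_mem {M : Matrix ι κ B} (hM : ∀ i j, M i j ∈ ℬ 1) {n : ℕ} {w : ι → B}
    (hw : w ᵥ* M ∈ gradedVec κ ℬ (n + 1)) : ∃ s ∈ gradedVec ι ℬ n, s ᵥ* M = w ᵥ* M := by
  refine ⟨fun i => hc.proj n (w i), mem_gradedVec.2 fun i => hc.proj_mem _ _, ?_⟩
  ext j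
  rw [← hc.proj_of_mem (mem_gradedVec.1 hw j)]
  exact (hc.proj_dotProduct (fun i => hM i j) n w).symm

theorem vecMul_eq_zero_of_mem {M : Matrix ι κ B} (hM : ∀ i j, M i j ∈ ℬ 1) {w : ι → B}
    (hw : w ᵥ* M ∈ gradedVec κ ℬ 0) : w ᵥ* M = 0 := by
  ext j
  rw [← hc.proj_of_mem (mem_gradedVec.1 hw j)]
  exact hc.proj_zero_dotProduct (fun i => hM i j) w

end IsConnectedGraded

/-- Here `b`, `u`, `s`, `t` stand for the dimensions in degree n of B and of the kernels of the
successive maps of the resolution. The recurrences encode the Hilbert series (1 - t)⁻⁴; the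
induction closes only if closed forms for the kernels are carried along. -/
theorem choose_three_succ_recurrence {b u s t : ℕ → ℕ} (b0 : b 0 = 1) (u0 : u 0 = 0)
    (s0 : s 0 = 0) (t0 : t 0 = 0) (hb : ∀ n, u n + b (n + 1) = 4 * b n)
    (hu : ∀ n, s n + u (n + 1) = 6 * b n) (hs : ∀ n, t n + s (n + 1) = 4 * b n)
    (ht : ∀ n, t (n + 1) = b n) (n : ℕ) : 6 * b n = (n + 1) * (n + 2) * (n + 3) := by
  suffices h : 6 * b n = (n + 1) * (n + 2) * (n + 3) ∧ 2 * u n = n * (n + 2) * (n + 3) ∧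
      2 * s n = n * (n + 1) * (n + 3) ∧ 6 * t n = n * (n + 1) * (n + 2) from h.1
  induction n with
  | zero => simp [b0, u0, s0, t0]
  | succ n ih =>
    obtain ⟨h1, h2, h3, h4⟩ := ih
    have e1 := hb n
    have e2 := hu n
    have e3 := hs n
    have e4 := ht n
    zify at *
    refine ⟨?_, ?_, ?_, ?_⟩ <;> linarith

theorem IsAdaptedResolution.six_mul_finrank [IsDomain B] (hc : IsConnectedGraded ℬ)
    (hfin : ∀ n, Module.Finite k (ℬ n)) {ι : Type} [Fintype ι] (hι : Fintype.card ι = 4)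
    {x : ι → B} (hx : ∀ i, x i ∈ ℬ 1) {F : Matrix (Fin 6) ι B} {G : Matrix ι (Fin 6) B}
    (h : IsAdaptedResolution ℬ x F G) (n : ℕ) :
    6 * Module.finrank k (ℬ n) = (n + 1) * (n + 2) * (n + 3) := by
  have fin (κ : Type) [Fintype κ] (n : ℕ) : Module.Finite k (gradedVec κ ℬ n) :=
    Module.Finite.equiv (gradedVecEquiv κ ℬ n).symm
  let d0 : (ι → B) →ₗ[k] B := (rowSum x).restrictScalars k
  let d1 : (Fin 6 → B) →ₗ[k] (ι → B) := F.vecMulLinear.restrictScalars k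
  let d2 : (ι → B) →ₗ[k] (Fin 6 → B) := G.vecMulLinear.restrictScalars k
  let d3 : B →ₗ[k] (ι → B) := (LinearMap.toSpanSingleton B (ι → B) x).restrictScalars k
  have hd0 : ∀ w, d0 w = w ⬝ᵥ x := fun w => by simp [d0, dotProduct]
  have hd1 : ∀ w, d1 w = w ᵥ* F := fun w => rfl
  have hd2 : ∀ w, d2 w = w ᵥ* G := fun w => rfl
  have hd3 : ∀ b i, d3 b i = b * x i := fun b i => by simp [d3]
  have r1 : LinearMap.range d1 = LinearMap.ker d0 := by
    ext w; simpa [hd0, hd1] using (h.rel w).symm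
  have r2 : LinearMap.range d2 = LinearMap.ker d1 := by
    ext w; simpa [hd2, hd1] using (h.rel₂ w).symm
  have r3 : LinearMap.range d3 = LinearMap.ker d2 := by
    ext w
    simp only [LinearMap.mem_range, LinearMap.mem_ker, hd2, h.rel₃ w, funext_iff, hd3]
  have k3 : LinearMap.ker d3 = ⊥ := by
    rw [LinearMap.ker_eq_bot']
    intro b hb
    by_contra hb0
    -- The last map can fail to be injective on a domain only if all `x i` vanish. Then the vector
    -- with all entries 1 would be a syzygy, hence a combination of rows of F, whose entries have
    -- augmentation zero.
    have hx0 : ∀ i, x i = 0 := fun i => by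
      have := congrFun hb i
      rw [hd3] at this
      simpa [hb0] using this
    have h2 := (h.rel (fun _ => 1)).1 (by simp [dotProduct, hx0])
    obtain ⟨s, hs⟩ := h2
    have hne : Nonempty ι := Fintype.card_pos_iff.1 (by omega)
    have h3 := congrArg (hc.aug) (congrFun hs hne.some)
    simp [vecMul, dotProduct, hc.aug_of_mem le_rfl (h.F_mem _ _)] at h3
  refine choose_three_succ_recurrence (b := fun n => Module.finrank k (ℬ n))
    (u := fun n => Module.finrank k ↥(LinearMap.ker d0 ⊓ gradedVec ι ℬ n))
    (s := fun n => Module.finrank k ↥(LinearMap.ker d1 ⊓ gradedVec (Fin 6) ℬ n))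
    (t := fun n => Module.finrank k ↥(LinearMap.ker d2 ⊓ gradedVec ι ℬ n))
    ?_ ?_ ?_ ?_ (fun n => ?_) (fun n => ?_) (fun n => ?_) (fun n => ?_) n
  · have := hc.nontrivial
    change Module.finrank k (ℬ 0) = 1
    rw [hc.zero_eq]
    rw [Submodule.one_eq_span, finrank_span_singleton one_ne_zero]
  · rw [Submodule.finrank_eq_zero, eq_bot_iff]
    rintro w ⟨hw, hw2⟩
    rw [← r1] at hw
    obtain ⟨s, rfl⟩ := hw
    exact hc.vecMul_eq_zero_of_mem h.F_mem hw2
  · rw [Submodule.finrank_eq_zero, eq_bot_iff]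
    rintro w ⟨hw, hw2⟩
    rw [← r2] at hw
    obtain ⟨s, rfl⟩ := hw
    exact hc.vecMul_eq_zero_of_mem h.G_mem hw2
  · rw [Submodule.finrank_eq_zero, eq_bot_iff]
    rintro w ⟨hw, hw2⟩
    rw [← r3] at hw
    obtain ⟨s, rfl⟩ := hw
    ext i
    rw [← hc.proj_of_mem (mem_gradedVec.1 hw2 i), hd3]
    exact hc.proj_mul_right_of_lt (by omega) _ (hx i)
  · have := fin ι n
    have e := finrank_ker_inf_add d0 (gradedVec ι ℬ n) (ℬ (n + 1))
      (fun w hw => by rw [hd0]; exact hc.dotProduct_mem hx hw) (by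
        rintro w hw ⟨s, rfl⟩
        refine ⟨fun i => hc.proj n (s i), mem_gradedVec.2 fun i => hc.proj_mem _ _, ?_⟩
        rw [← hc.proj_of_mem hw, hd0, hd0, hc.proj_dotProduct hx])
    rw [finrank_gradedVec, hι] at e
    rw [← e]
    suffices e : LinearMap.range d0 ⊓ ℬ (n + 1) = ℬ (n + 1) by rw [e]
    rw [inf_eq_right]
    intro b hb
    obtain ⟨s, hs⟩ := h.gen b (IsConnectedGraded.mem_augIdeal_of_mem (by omega) hb)
    exact ⟨s, by rw [hd0]; exact hs⟩
  · have := fin (Fin 6) n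
    have e := finrank_ker_inf_add d1 (gradedVec (Fin 6) ℬ n) (gradedVec ι ℬ (n + 1))
      (fun w hw => hc.vecMul_mem h.F_mem hw) (by
        rintro w hw ⟨s, rfl⟩
        exact hc.exists_vecMul_of_mem h.F_mem hw)
    rwa [finrank_gradedVec, r1, Fintype.card_fin] at e
  · have := fin ι n
    have e := finrank_ker_inf_add d2 (gradedVec ι ℬ n) (gradedVec (Fin 6) ℬ (n + 1))
      (fun w hw => hc.vecMul_mem h.G_mem hw) (by
        rintro w hw ⟨s, rfl⟩
        exact hc.exists_vecMul_of_mem h.G_mem hw)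
    rwa [finrank_gradedVec, r2, hι] at e
  · have e := finrank_ker_inf_add d3 (ℬ n) (gradedVec ι ℬ (n + 1))
      (fun w hw => mem_gradedVec.2 fun i => by rw [hd3]; exact hc.mul_mem hw (hx i)) (by
        rintro w hw ⟨s, rfl⟩
        refine ⟨hc.proj n s, hc.proj_mem _ _, ?_⟩
        ext i
        rw [← hc.proj_of_mem (mem_gradedVec.1 hw i), hd3, hd3, hc.proj_mul_right n _ (hx i)])
    rw [k3, r3, bot_inf_eq, finrank_bot, zero_add] at e
    exact e

end DoubleExt
end

/-! ### The superpotential attached to an adapted resolution. -/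

noncomputable section

namespace DoubleExt

open Matrix

/-- A tensor `w` whose contractions span the space `R` of quadratic relations, and which is
nondegenerate; moreover `R` contains no relation of rank one. -/
structure IsSuperpotential {k ι : Type*} [Field k] [Fintype ι] (R : Submodule k (ι → ι → k))
    (w : ι → ι → ι → ι → k) : Prop where
  finrank_eq : Module.finrank k R = 6
  rank_one : ∀ a b : ι → k, (fun i j => a i * b j) ∈ R → ∀ i j, a i * b j = 0
  mem_left : ∀ i j, w i j ∈ R
  mem_mid : ∀ i l, (fun j m => w i j m l) ∈ R
  mem_right : ∀ m l, (fun i j => w i j m l) ∈ R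
  nondeg_left : ∀ T : ι → ι → k, (∀ m l, ∑ i, ∑ j, T i j * w i j m l = 0) →
    ∀ r ∈ R, ∑ i, ∑ j, T i j * r i j = 0
  nondeg_right : ∀ T : ι → ι → k, (∀ i j, ∑ m, ∑ l, T m l * w i j m l = 0) →
    ∀ r ∈ R, ∑ m, ∑ l, T m l * r m l = 0
  left : ∀ f : ι → k, (∀ j m l, ∑ i, f i * w i j m l = 0) → f = 0
  right : ∀ f : ι → k, (∀ i j m, ∑ l, f l * w i j m l = 0) → f = 0

variable {k : Type u} {B : Type v} [Field k] [Ring B] [Algebra k B] {ℬ : ℕ → Submodule k B}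

/-- The quadratic relations between the elements `x i`. -/
def relSpace {ι : Type} [Fintype ι] (x : ι → B) : Submodule k (ι → ι → k) where
  carrier := {r | ∑ i, ∑ j, r i j • (x i * x j) = 0}
  add_mem' := by
    intro r s hr hs
    simp only [Set.mem_ofPred_eq, Pi.add_apply, add_smul, Finset.sum_add_distrib] at *
    rw [hr, hs, add_zero]
  zero_mem' := by simp
  smul_mem' := by
    intro c r hr
    simp only [Set.mem_ofPred_eq, Pi.smul_apply, smul_assoc, ← Finset.smul_sum] at *
    rw [hr, smul_zero]

theorem mem_relSpace {ι : Type} [Fintype ι] {x : ι → B} {r : ι → ι → k} :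
    r ∈ relSpace x ↔ ∑ i, ∑ j, r i j • (x i * x j) = 0 := Iff.rfl

/-- Grouping by the last factor makes a relation a left syzygy of `x`; grouping by the first factor,
as in the primed version, makes it a right syzygy. -/
theorem sum_smul_mul_eq_dotProduct {ι : Type} [Fintype ι] (x : ι → B) (r : ι → ι → k) :
    ∑ i, ∑ j, r i j • (x i * x j) = (fun j => ∑ i, r i j • x i) ⬝ᵥ x := by
  rw [Finset.sum_comm]
  simp [dotProduct, Finset.sum_mul]

theorem sum_smul_mul_eq_dotProduct' {ι : Type} [Fintype ι] (x : ι → B) (r : ι → ι → k) :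
    ∑ i, ∑ j, r i j • (x i * x j) = x ⬝ᵥ (fun i => ∑ j, r i j • x j) := by
  simp [dotProduct, Finset.mul_sum]

section

variable {ι : Type} [Fintype ι] {x : ι → B}

/-- A relation of rank one is a vanishing product of two linear forms. -/
theorem rank_one_of_isDomain [IsDomain B] (hli : LinearIndependent k x) (a b : ι → k)
    (h : (fun i j => a i * b j) ∈ relSpace x) (i j : ι) : a i * b j = 0 := by
  have h1 : (∑ i, a i • x i) * (∑ j, b j • x j) = 0 := by
    rw [← mem_relSpace.1 h, Finset.sum_mul_sum]
    simp [smul_smul, mul_comm]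
  rw [Fintype.linearIndependent_iff] at hli
  rcases mul_eq_zero.1 h1 with h1 | h1
  · rw [hli a h1 i, zero_mul]
  · rw [hli b h1 j, mul_zero]

/-- The rows of F generate the left syzygies of `x`, so they give a basis of R. The columns of G are
right syzygies of `x` and span R by the dual exactness, so they give another basis. The tensor w
pairs the two bases along B⁶; its middle slices lie in R because GF = 0, and its outer nondegeneracy
comes from exactness at the ends. A cubic tensor in V ⊗ R and R ⊗ V is a linear syzygy of the rows
of F, hence a combination of rows of G. -/
theorem IsAdaptedResolution.exists_isSuperpotential [IsDomain B] (hc : IsConnectedGraded ℬ)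
    (hx : ∀ i, x i ∈ ℬ 1) (hli : LinearIndependent k x)
    (hsp : ∀ a ∈ ℬ 1, ∃ c : ι → k, ∑ i, c i • x i = a)
    {F : Matrix (Fin 6) ι B} {G : Matrix ι (Fin 6) B} (h : IsAdaptedResolution ℬ x F G) :
    ∃ w, IsSuperpotential (relSpace (k := k) x) w ∧
      ∀ t : ι → ι → ι → k, (∀ i, t i ∈ relSpace x) → (∀ l, (fun i j => t i j l) ∈ relSpace x) →
        ∃ f : ι → k, ∀ i j l, t i j l = ∑ a, f a * w a i j l := by
  classical
  choose f hf using fun l c => hsp _ (h.F_mem l c)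
  choose g hg using fun a l => hsp _ (h.G_mem a l)
  have hli' := Fintype.linearIndependent_iff.1 hli
  have ext_coeff : ∀ c d : ι → k, ∑ i, c i • x i = ∑ i, d i • x i → c = d := by
    intro c d hcd
    rw [← sub_eq_zero, ← Finset.sum_sub_distrib] at hcd
    ext i
    exact sub_eq_zero.1 (hli' (c - d) (by simpa [sub_smul] using hcd) i)
  have fmem : ∀ l, (fun a c => f l c a) ∈ relSpace x := fun l => by
    rw [mem_relSpace, sum_smul_mul_eq_dotProduct, h.rel]
    refine ⟨Pi.single l 1, ?_⟩
    ext c; simp [hf]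
  have gmem : ∀ l, (fun a c => g a l c) ∈ relSpace x := fun l => by
    rw [mem_relSpace, sum_smul_mul_eq_dotProduct']
    have := congrFun ((h.rel₃ x).2 ⟨1, by simp⟩) l
    simpa [vecMul, dotProduct, hg] using this
  have fspan : ∀ r ∈ relSpace x, ∃ β : Fin 6 → k, ∀ a c, r a c = ∑ l, β l * f l c a := by
    intro r hr
    rw [mem_relSpace, sum_smul_mul_eq_dotProduct, h.rel] at hr
    obtain ⟨s, hs⟩ := hr
    refine ⟨fun l => hc.aug (s l), fun a c => ?_⟩
    suffices (fun a => r a c) = fun a => ∑ l, hc.aug (s l) * f l c a from congrFun this a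
    apply ext_coeff
    have h1 := congrArg (hc.proj 1) (congrFun hs c)
    rw [hc.proj_of_mem (Submodule.sum_mem _ fun i _ => Submodule.smul_mem _ _ (hx i))] at h1
    rw [← h1]
    simp only [vecMul, dotProduct, map_sum, hc.proj_one_mul (h.F_mem _ _)]
    simp only [← hf, Finset.smul_sum, Finset.sum_smul, smul_smul]
    rw [Finset.sum_comm]
  have gspan : ∀ r ∈ relSpace x, ∃ β : Fin 6 → k, ∀ a c, r a c = ∑ l, β l * g a l c := by
    intro r hr
    rw [mem_relSpace, sum_smul_mul_eq_dotProduct'] at hr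
    obtain ⟨s, hs⟩ := h.dual₃ _ hr
    refine ⟨fun l => hc.aug (s l), fun a c => ?_⟩
    suffices r a = fun c => ∑ l, hc.aug (s l) * g a l c from congrFun this c
    apply ext_coeff
    have h1 := congrArg (hc.proj 1) (congrFun hs a)
    rw [hc.proj_of_mem (Submodule.sum_mem _ fun i _ => Submodule.smul_mem _ _ (hx i))] at h1
    rw [← h1]
    simp only [mulVec, dotProduct, map_sum, hc.proj_one_mul' (h.G_mem _ _)]
    simp only [← hg, Finset.smul_sum, Finset.sum_smul, smul_smul]
    rw [Finset.sum_comm]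
  have find : ∀ β : Fin 6 → k, (∀ a c, ∑ l, β l * f l c a = 0) → β = 0 := by
    intro β hβ
    have h1 : (fun l => algebraMap k B (β l)) ᵥ* F = 0 := by
      ext c
      simp only [vecMul, dotProduct, ← hf, ← Algebra.smul_def, Finset.smul_sum, smul_smul]
      rw [Finset.sum_comm]
      simp [← Finset.sum_smul, hβ]
    obtain ⟨t, ht⟩ := (h.rel₂ _).1 h1
    ext l
    have := congrArg hc.aug (congrFun ht l)
    simpa [vecMul, dotProduct, hc.aug_of_mem le_rfl (h.G_mem _ _)] using this.symm
  let Φ : (Fin 6 → k) →ₗ[k] relSpace (k := k) x :=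
    Fintype.linearCombination k fun l => ⟨fun a c => f l c a, fmem l⟩
  let Γ : (Fin 6 → k) →ₗ[k] relSpace (k := k) x :=
    Fintype.linearCombination k fun l => ⟨fun a c => g a l c, gmem l⟩
  have hΦ : ∀ β a c, (Φ β : ι → ι → k) a c = ∑ l, β l * f l c a := fun β a c => by
    simp [Φ, Fintype.linearCombination_apply]
  have hΓ : ∀ β a c, (Γ β : ι → ι → k) a c = ∑ l, β l * g a l c := fun β a c => by
    simp [Γ, Fintype.linearCombination_apply]
  have Φinj : Function.Injective Φ := by
    rw [← LinearMap.ker_eq_bot, LinearMap.ker_eq_bot']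
    intro β hβ
    exact find β fun a c => by rw [← hΦ, hβ]; rfl
  have Φsurj : Function.Surjective Φ := by
    rintro ⟨r, hr⟩
    obtain ⟨β, hβ⟩ := fspan r hr
    exact ⟨β, Subtype.ext (by ext a c; exact (hΦ _ _ _).trans (hβ _ _).symm)⟩
  have Γsurj : Function.Surjective Γ := by
    rintro ⟨r, hr⟩
    obtain ⟨β, hβ⟩ := gspan r hr
    exact ⟨β, Subtype.ext (by ext a c; exact (hΓ _ _ _).trans (hβ _ _).symm)⟩
  have hrank : Module.finrank k (relSpace (k := k) x) = 6 := by
    rw [← (LinearEquiv.ofBijective Φ ⟨Φinj, Φsurj⟩).finrank_eq]; simp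
  have gind : ∀ β : Fin 6 → k, (∀ a c, ∑ l, β l * g a l c = 0) → β = 0 := by
    intro β hβ
    have Γinj := (LinearMap.injective_iff_surjective_of_finrank_eq_finrank
      (by rw [hrank]; simp)).2 Γsurj
    apply Γinj
    rw [map_zero]
    exact Subtype.ext (by ext a c; rw [hΓ, hβ]; rfl)
  -- The column index of F is the last factor of a relation, the row index of G the first; hence `f
  -- l d c` next to `g a l b`.
  refine ⟨fun a b c d => ∑ l, g a l b * f l d c, ⟨hrank, rank_one_of_isDomain hli,
    fun i j => ?_, fun i l => ?_, fun m l => ?_, fun T hT r hr => ?_, fun T hT r hr => ?_,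
    fun φ hφ => ?_, fun φ hφ => ?_⟩, fun t ht1 ht2 => ?_⟩
  · have := (Φ fun l => g i l j).2
    convert this using 1
    ext a c; rw [hΦ]
  · rw [mem_relSpace, sum_smul_mul_eq_dotProduct]
    have h1 : ∀ m, ∑ j, (∑ s, g i s j * f s l m) • x j = ∑ s, f s l m • G i s := by
      intro m
      simp only [← hg, Finset.smul_sum, Finset.sum_smul, smul_smul, mul_comm]
      rw [Finset.sum_comm]
    simp only [h1, dotProduct, Finset.sum_mul]
    rw [Finset.sum_comm]
    have h2 : ((Pi.single i 1 : ι → B) ᵥ* G) ᵥ* F = 0 := (h.rel₂ _).2 ⟨_, rfl⟩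
    have h3 := congrFun h2 l
    rw [single_one_vecMul] at h3
    simp only [vecMul, dotProduct, Pi.zero_apply] at h3
    rw [← h3]
    refine Finset.sum_congr rfl fun s _ => ?_
    change _ = G i s * F s l
    rw [← hf s l, Finset.mul_sum]
    simp
  · have := (Γ fun s => f s l m).2
    convert this using 1
    ext a c; rw [hΓ]; simp [mul_comm]
  · have h1 : (fun s => ∑ i, ∑ j, T i j * g i s j) = 0 := find _ fun m l => by
      rw [← hT m l]
      simp only [Finset.sum_mul, Finset.mul_sum]
      rw [← Finset.sum_comm_cycle]
      simp [mul_assoc]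
    obtain ⟨β, hβ⟩ := gspan r hr
    simp only [hβ, Finset.mul_sum]
    rw [Finset.sum_comm_cycle]
    refine Finset.sum_eq_zero fun s _ => ?_
    have h2 := congrArg (β s * ·) (congrFun h1 s)
    simpa [Finset.mul_sum, mul_left_comm] using h2
  · have h1 : (fun s => ∑ m, ∑ l, T m l * f s l m) = 0 := gind _ fun i j => by
      rw [← hT i j]
      simp only [Finset.sum_mul, Finset.mul_sum]
      rw [← Finset.sum_comm_cycle]
      simp [mul_comm, mul_left_comm]
    obtain ⟨β, hβ⟩ := fspan r hr
    simp only [hβ, Finset.mul_sum]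
    rw [Finset.sum_comm_cycle]
    refine Finset.sum_eq_zero fun s _ => ?_
    have h2 := congrArg (β s * ·) (congrFun h1 s)
    simpa [Finset.mul_sum, mul_left_comm] using h2
  · have h1 : ∀ j s, ∑ i, φ i * g i s j = 0 := fun j => by
      refine congrFun (find (fun s => ∑ i, φ i * g i s j) fun m l => ?_)
      rw [← hφ j m l]
      simp only [Finset.sum_mul, Finset.mul_sum]
      rw [Finset.sum_comm]
      simp [mul_assoc]
    have h2 : (fun i => algebraMap k B (φ i)) ᵥ* G = 0 := by
      ext s
      simp only [vecMul, dotProduct, ← hg, ← Algebra.smul_def, Finset.smul_sum, smul_smul]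
      rw [Finset.sum_comm]
      simp [← Finset.sum_smul, h1]
    obtain ⟨b, hb⟩ := (h.rel₃ _).1 h2
    ext i
    have := congrArg hc.aug (hb i)
    simpa [hc.aug_of_mem le_rfl (hx _)] using this.symm
  · have h1 : ∀ m s, ∑ l, φ l * f s l m = 0 := fun m => by
      refine congrFun (gind (fun s => ∑ l, φ l * f s l m) fun i j => ?_)
      rw [← hφ i j m]
      simp only [Finset.sum_mul, Finset.mul_sum]
      rw [Finset.sum_comm]
      exact Finset.sum_congr rfl fun _ _ => Finset.sum_congr rfl fun _ _ => by ring
    have h2 : F *ᵥ (fun i => algebraMap k B (φ i)) = 0 := by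
      ext s
      simp only [mulVec, dotProduct, ← hf, ← Algebra.commutes, ← Algebra.smul_def, Finset.smul_sum,
        smul_smul]
      rw [Finset.sum_comm]
      simp [← Finset.sum_smul, h1]
    obtain ⟨b, hb⟩ := h.dual₁ _ h2
    ext i
    have := congrArg hc.aug (hb i)
    simpa [hc.aug_of_mem le_rfl (hx _)] using this
  · choose β hβ using fun i => fspan (t i) (ht1 i)
    -- Membership of t in R ⊗ V says that the linear forms with coefficients β are a syzygy of the
    -- rows of F.
    have h1 : (fun s => ∑ i, β i s • x i) ᵥ* F = 0 := by
      ext c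
      have h2 := mem_relSpace.1 (ht2 c)
      simp only [vecMul, dotProduct, ← hf, Finset.sum_mul_sum, Pi.zero_apply]
      simp only [hβ, Finset.sum_smul] at h2
      rw [Finset.sum_comm_cycle] at h2
      rw [← h2]
      simp [smul_smul, mul_comm]
    obtain ⟨s, hs⟩ := (h.rel₂ _).1 h1
    have h3 : ∀ i l, β i l = ∑ j, hc.aug (s j) * g j l i := by
      intro i l
      refine congrFun (ext_coeff (fun i => β i l) (fun i => ∑ j, hc.aug (s j) * g j l i) ?_) i
      have h2 := congrArg (hc.proj 1) (congrFun hs l)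
      rw [hc.proj_of_mem (Submodule.sum_mem _ fun i _ => Submodule.smul_mem _ _ (hx i))] at h2
      rw [← h2]
      simp only [vecMul, dotProduct, map_sum, hc.proj_one_mul (h.G_mem _ _)]
      simp only [← hg, Finset.smul_sum, Finset.sum_smul, smul_smul]
      rw [Finset.sum_comm]
    refine ⟨fun j => hc.aug (s j), fun i j l => ?_⟩
    rw [hβ]
    simp only [h3, Finset.sum_mul, Finset.mul_sum]
    rw [Finset.sum_comm]
    simp [mul_assoc]

end

end DoubleExt
end

/-! ### Linear algebra of a superpotential relative to a splitting of the generators. -/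

noncomputable section

namespace DoubleExt

section Flip

variable {k ι : Type*} [Field k]

/-- Interchange of the two tensor factors. -/
def flipEquiv (k ι : Type*) [Field k] : (ι → ι → k) ≃ₗ[k] (ι → ι → k) where
  toFun r i j := r j i
  invFun r i j := r j i
  map_add' _ _ := rfl
  map_smul' _ _ := rfl
  left_inv _ := rfl
  right_inv _ := rfl

theorem mem_map_flip {R : Submodule k (ι → ι → k)} {r : ι → ι → k} :
    r ∈ R.map (flipEquiv k ι).toLinearMap ↔ (fun i j => r j i) ∈ R := by
  constructor
  · rintro ⟨s, hs, rfl⟩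
    exact hs
  · intro h
    exact ⟨_, h, rfl⟩

theorem IsSuperpotential.flip [Fintype ι] {R : Submodule k (ι → ι → k)} {w : ι → ι → ι → ι → k}
    (h : IsSuperpotential R w) :
    IsSuperpotential (R.map (flipEquiv k ι).toLinearMap) fun i j m l => w l m j i where
  finrank_eq := by rw [← h.finrank_eq, LinearEquiv.finrank_map_eq]
  rank_one a b hab i j := by
    rw [mem_map_flip] at hab
    rw [mul_comm]
    exact h.rank_one b a (by simpa [mul_comm] using hab) j i
  mem_left i j := mem_map_flip.2 (h.mem_right j i)
  mem_mid i l := mem_map_flip.2 (h.mem_mid l i)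
  mem_right m l := mem_map_flip.2 (h.mem_left l m)
  nondeg_left T hT r hr := by
    rw [Finset.sum_comm]
    refine h.nondeg_right (fun m l => T l m) (fun i j => ?_) _ (mem_map_flip.1 hr)
    rw [← hT j i, Finset.sum_comm]
  nondeg_right T hT r hr := by
    rw [Finset.sum_comm]
    refine h.nondeg_left (fun m l => T l m) (fun i j => ?_) _ (mem_map_flip.1 hr)
    rw [← hT j i, Finset.sum_comm]
  left f hf := h.right f fun i j m => hf m j i
  right f hf := h.left f fun i j m => hf m j i

end Flip

section Pencil

variable {k : Type*} [Field k] {α β : Type*} [Fintype α] [Fintype β]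
  {R : Submodule k (α ⊕ β → α ⊕ β → k)}
  {w : α ⊕ β → α ⊕ β → α ⊕ β → α ⊕ β → k}

open Sum

/-- A relation all of whose rows are proportional vanishes. -/
theorem IsSuperpotential.eq_zero_of_rank_le_one {ι : Type*} [Fintype ι]
    {R : Submodule k (ι → ι → k)} {w : ι → ι → ι → ι → k} (h : IsSuperpotential R w)
    {r : ι → ι → k} (hr : r ∈ R) (a b : ι → k) (hab : ∀ i j, r i j = a i * b j) : r = 0 := by
  ext i j
  rw [hab]
  refine h.rank_one a b ?_ i j
  convert hr using 3
  exact (hab _ _).symm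

/-- If the relations modulo those involving the `α`-generators form a line spanned by a
nondegenerate form, then every product `y x` can be rewritten with an `α`-generator on the left. -/
theorem IsSuperpotential.exists_rel_right
    {R : Submodule k (Fin 2 ⊕ Fin 2 → Fin 2 ⊕ Fin 2 → k)}
    {w : Fin 2 ⊕ Fin 2 → Fin 2 ⊕ Fin 2 → Fin 2 ⊕ Fin 2 → Fin 2 ⊕ Fin 2 → k}
    (h : IsSuperpotential R w)
    (q : Fin 2 → Fin 2 → k) (hq1 : ∀ f : Fin 2 → k, (∀ j, ∑ i, f i * q i j = 0) → f = 0)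
    (hq2 : ∀ f : Fin 2 → k, (∀ i, ∑ j, q i j * f j = 0) → f = 0)
    (hR : ∀ r ∈ R, ∃ t : k, ∀ i j, r (inr i) (inr j) = t * q i j)
    {r₀ : Fin 2 ⊕ Fin 2 → Fin 2 ⊕ Fin 2 → k} (hr₀ : r₀ ∈ R) {i₀ j₀ : Fin 2}
    (h₀ : r₀ (inr i₀) (inr j₀) ≠ 0) (m : Fin 2 → Fin 2 → k) :
    ∃ r ∈ R, (∀ i j, r (inr i) (inr j) = 0) ∧ ∀ i j, r (inr i) (inl j) = m i j := by
  let R' : Submodule k (Fin 2 ⊕ Fin 2 → Fin 2 ⊕ Fin 2 → k) :=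
    { carrier := {r | r ∈ R ∧ ∀ i j, r (inr i) (inr j) = 0}
      add_mem' := fun ha hb => ⟨R.add_mem ha.1 hb.1, fun i j => by simp [ha.2, hb.2]⟩
      zero_mem' := ⟨R.zero_mem, fun _ _ => rfl⟩
      smul_mem' := fun c _ ha => ⟨R.smul_mem c ha.1, fun i j => by simp [ha.2]⟩ }
  let ψ : (Fin 2 ⊕ Fin 2 → Fin 2 ⊕ Fin 2 → k) →ₗ[k] (Fin 2 → Fin 2 → k) :=
    { toFun := fun r i j => r (inr i) (inl j)
      map_add' := fun _ _ => rfl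
      map_smul' := fun _ _ => rfl }
  suffices htop : R'.map ψ = ⊤ by
    obtain ⟨r, hr, hm⟩ : m ∈ R'.map ψ := htop ▸ Submodule.mem_top
    exact ⟨r, hr.1, hr.2, fun i j => congrFun (congrFun hm i) j⟩
  by_contra hne
  obtain ⟨φ, hφ0, hφ⟩ := Submodule.exists_le_ker_of_lt_top _ (lt_top_iff_ne_top.2 hne)
  let t : Fin 2 → Fin 2 → k := fun i j => φ (Pi.single i (Pi.single j 1))
  have hφt : ∀ z, φ z = ∑ i, ∑ j, t i j * z i j := by
    intro z
    have : z = ∑ i, ∑ j, z i j • (Pi.single i (Pi.single j (1 : k)) : Fin 2 → Fin 2 → k) := by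
      ext a b; fin_cases a <;> fin_cases b <;> simp
    conv_lhs => rw [this]
    simp only [map_sum, map_smul, smul_eq_mul, t, mul_comm]
  have hφR : ∀ r ∈ R, (∀ i j, r (inr i) (inr j) = 0) →
      ∑ i, ∑ j, t i j * r (inr i) (inl j) = 0 := by
    intro r hr hr2
    have : φ (ψ r) = 0 := hφ (Submodule.mem_map_of_mem ⟨hr, hr2⟩)
    rwa [hφt] at this
  obtain ⟨t₀, ht₀⟩ := hR r₀ hr₀
  have hq0 : q i₀ j₀ ≠ 0 := fun h0 => h₀ (by rw [ht₀, h0, mul_zero])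
  -- a functional on the tensors which vanishes on `R`
  obtain ⟨s, hs⟩ : ∃ s : k, ∀ r ∈ R,
      (∑ i, ∑ j, t i j * r (inr i) (inl j)) + s * r (inr i₀) (inr j₀) = 0 := by
    refine ⟨-(∑ i, ∑ j, t i j * r₀ (inr i) (inl j)) / r₀ (inr i₀) (inr j₀), fun r hr => ?_⟩
    obtain ⟨t₁, ht₁⟩ := hR r hr
    have ht0 : t₀ ≠ 0 := fun h0 => h₀ (by rw [ht₀, h0, zero_mul])
    have h1 := hφR (r - (t₁ / t₀) • r₀) (R.sub_mem hr (R.smul_mem _ hr₀)) fun i j => by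
      simp only [Pi.sub_apply, Pi.smul_apply, smul_eq_mul, ht₀, ht₁]
      field_simp
      ring
    simp only [Pi.sub_apply, Pi.smul_apply, smul_eq_mul, mul_sub, Finset.sum_sub_distrib,
      mul_left_comm _ (t₁ / t₀), ← Finset.mul_sum] at h1
    rw [ht₁ i₀ j₀, ht₀ i₀ j₀]
    rw [sub_eq_zero] at h1
    rw [h1]
    field_simp
    ring
  -- Write x for the generators `inl` and y for the `inr` ones. As a tensor in its first two slots,
  -- w(y, y, m, l) is a multiple of q, so w restricted to y ⊗ y in front is q ⊗ Λ.
  choose Λ hΛ using fun m l => hR _ (h.mem_right m l)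
  have hΛR : Λ ∈ R := by
    have : Λ = (q i₀ j₀)⁻¹ • w (inr i₀) (inr j₀) := by
      ext m l
      simp [hΛ, mul_comm (Λ m l), hq0]
    rw [this]
    exact R.smul_mem _ (h.mem_left _ _)
  have hΛ0 : Λ ≠ 0 := by
    intro h0
    have := h.nondeg_left (Pi.single (inr i₀) (Pi.single (inr j₀) 1)) (fun m l => by
      simp [Pi.single_apply, ite_apply, hΛ, h0]) r₀ hr₀
    simp [Pi.single_apply, ite_apply] at this
    exact h₀ this
  -- The tensor w(yᵢ, yⱼ, yₙ, l) is a multiple of q in the slots 1, 2 and also in the slots 2, 3.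
  -- For fixed i and l this would factor q as a tensor of rank one unless the multiple vanishes, and
  -- q is nondegenerate of size two.
  have hΛinr : ∀ m l, Λ (inr m) l = 0 := by
    intro m l
    choose σ hσ using fun i => hR _ (h.mem_mid (inr i) l)
    have h1 : ∀ i j n, Λ (inr n) l * q i j = σ i * q j n := fun i j n => by
      rw [← hσ i j n, ← hΛ]
    have hσ0 : ∀ i, σ i = 0 := by
      intro i
      by_contra hi
      have h2 : (![q i 1, -q i 0] : Fin 2 → k) = 0 := hq1 _ fun n => by
        have e0 := h1 i 0 n
        have e1 := h1 i 1 n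
        apply mul_left_cancel₀ hi
        simp only [Fin.sum_univ_two, Matrix.cons_val_zero, Matrix.cons_val_one]
        linear_combination q i 0 * e1 - q i 1 * e0
      have h3 := congrFun h2 0
      have h4 := congrFun h2 1
      have h5 : (Pi.single i 1 : Fin 2 → k) = 0 := hq1 _ fun j => by
        simp only [Pi.single_apply, ite_mul, one_mul, zero_mul, Finset.sum_ite_eq',
          Finset.mem_univ, if_true]
        fin_cases j
        · simpa using h4
        · simpa using h3
      have := congrFun h5 i
      simp at this
    have h6 := h1 i₀ j₀ m
    rw [hσ0, zero_mul] at h6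
    exact (mul_eq_zero.1 h6).resolve_right hq0
  -- Apply the functional to the middle slice w(yᵢ, ·, ·, l) = Σ qᵢₐ Λ. Only its y ⊗ x part
  -- survives, and the nondegenerate q can be cancelled.
  have ht : ∀ i l, ∑ j, t i j * Λ (inl j) l = 0 := by
    intro i l
    suffices (fun i => ∑ j, t i j * Λ (inl j) l) = 0 from congrFun this i
    refine hq2 _ fun i => ?_
    have h1 := hs _ (h.mem_mid (inr i) l)
    simp only [hΛ, hΛinr, zero_mul, mul_zero, add_zero] at h1
    rw [← h1]
    refine Finset.sum_congr rfl fun j _ => ?_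
    rw [Finset.mul_sum]
    exact Finset.sum_congr rfl fun n _ => by ring
  obtain ⟨i, j, hij⟩ : ∃ i j, t i j ≠ 0 := by
    by_contra! h0
    exact hφ0 (LinearMap.ext fun z => by rw [hφt]; simp [h0])
  apply hΛ0
  -- A nonzero entry of t makes the two remaining rows of Λ proportional, so Λ has rank one and must
  -- vanish.
  have ht' : ∀ l, t i 0 * Λ (inl 0) l + t i 1 * Λ (inl 1) l = 0 := fun l => by
    simpa using ht i l
  fin_cases j
  · have hij : t i 0 ≠ 0 := hij
    refine h.eq_zero_of_rank_le_one hΛR (Sum.elim ![-t i 1 / t i 0, 1] 0) (Λ (inl 1)) ?_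
    rintro (a | a) l
    · fin_cases a
      · simp
        field_simp
        linear_combination ht' l
      · simp
    · simp [hΛinr]
  · have hij : t i 1 ≠ 0 := hij
    refine h.eq_zero_of_rank_le_one hΛR (Sum.elim ![1, -t i 0 / t i 1] 0) (Λ (inl 0)) ?_
    rintro (a | a) l
    · fin_cases a
      · simp
      · simp
        field_simp
        linear_combination ht' l
    · simp [hΛinr]

/-- If no relation involves only the products with an `α`-generator on the left except multiples
of a single relation between the `α`-generators, then the quotient relation is nondegenerate. -/
theorem IsSuperpotential.nondegenerate (h : IsSuperpotential R w)
    (q : β → β → k) (hR : ∀ r ∈ R, ∃ t : k, ∀ i j, r (inr i) (inr j) = t * q i j)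
    (c : α ⊕ β → α ⊕ β → k) (hc : c ∈ R)
    (hcα : ∀ i j, c i (inr j) = 0)
    (hX : ∀ r ∈ R, (∀ i j, r (inr i) j = 0) → ∃ t : k, r = t • c)
    (f : β → k) (hf : ∀ j, ∑ i, f i * q i j = 0) : f = 0 := by
  classical
  -- The contraction of w by f vanishes when its first index is in β, because f kills q. Its slices
  -- in the first two slots are therefore multiples of c, so t = c ⊗ μ. Since c involves only
  -- α-generators, the slices in the last two slots are multiples of c as well, so t = ν ⊗ c. If t
  -- were nonzero, this would make c of rank one.
  let t : α ⊕ β → α ⊕ β → α ⊕ β → k := fun j m l => ∑ i, f i * w (inr i) j m l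
  have hinr : ∀ j m l, t (inr j) m l = 0 := by
    intro j m l
    obtain ⟨s, hs⟩ := hR _ (h.mem_right m l)
    simp only [t, hs]
    have := congrArg (s * ·) (hf j)
    simpa [Finset.mul_sum, mul_left_comm] using this
  have t1 : ∀ l, (fun j m => t j m l) ∈ R := by
    intro l
    have : (fun j m => t j m l) = ∑ i, f i • fun j m => w (inr i) j m l := by
      ext j m; simp [t]
    rw [this]
    exact Submodule.sum_mem _ fun i _ => Submodule.smul_mem _ _ (h.mem_mid _ _)
  have t2 : ∀ j, t j ∈ R := by
    intro j
    have : t j = ∑ i, f i • w (inr i) j := by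
      ext m l; simp [t]
    rw [this]
    exact Submodule.sum_mem _ fun i _ => Submodule.smul_mem _ _ (h.mem_left _ _)
  choose μ hμ using fun l => hX _ (t1 l) fun i j => hinr i j l
  have hμ' : ∀ j m l, t j m l = μ l * c j m := fun j m l => congrFun (congrFun (hμ l) j) m
  have h3 : ∀ j m l, t j (inr m) l = 0 := fun j m l => by rw [hμ', hcα, mul_zero]
  choose ν hν using fun j => hX _ (t2 j) fun i l => h3 j i l
  have hν' : ∀ j m l, t j m l = ν j * c m l := fun j m l => congrFun (congrFun (hν j) m) l
  have ht : ∀ j m l, t j m l = 0 := by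
    by_contra! hne
    obtain ⟨j, m, l, hne⟩ := hne
    have hl : μ l ≠ 0 := fun h0 => hne (by rw [hμ', h0, zero_mul])
    have hc0 : c = 0 := h.eq_zero_of_rank_le_one hc ν (fun m => (μ l)⁻¹ * c m l) fun j m => by
      have := (hμ' j m l).symm.trans (hν' j m l)
      rw [mul_left_comm, ← this, inv_mul_cancel_left₀ hl]
    exact hne (by rw [hμ', hc0]; simp)
  have := h.left (Sum.elim 0 f) fun j m l => by
    simpa [t] using ht j m l
  ext i
  exact congrFun this (inr i)

end Pencil

end DoubleExt
end

/-! ### Three generators of a subalgebra and one generator outside it. -/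

noncomputable section

namespace DoubleExt

open Sum

section

variable {k : Type u} {B : Type v} [Field k] [Ring B] [Algebra k B]

/-- If all last columns were multiples of one vector, the middle slices of w with last index `inr
()` would have rank one and vanish, against nondegeneracy on the right. -/
theorem IsSuperpotential.two_le_finrank_column {k α : Type*} [Field k] [Fintype α]
    {R : Submodule k (α ⊕ Unit → α ⊕ Unit → k)}
    {w : α ⊕ Unit → α ⊕ Unit → α ⊕ Unit → α ⊕ Unit → k} (h : IsSuperpotential R w)
    (col : R →ₗ[k] (α ⊕ Unit → k))
    (hcol : ∀ r i, col r i = (r : α ⊕ Unit → α ⊕ Unit → k) i (inr ())) :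
    2 ≤ Module.finrank k (LinearMap.range col) := by
  classical
  by_contra! hlt
  obtain ⟨⟨b, hb⟩, hv⟩ := finrank_le_one_iff.1 (Nat.lt_succ_iff.1 hlt)
  have h1 : ∀ r ∈ R, ∃ c : k, ∀ i, r i (inr ()) = c * b i := by
    intro r hr
    obtain ⟨c, hc⟩ := hv ⟨col ⟨r, hr⟩, ⟨_, rfl⟩⟩
    refine ⟨c, fun i => ?_⟩
    have := congrFun (congrArg Subtype.val hc) i
    exact (hcol ⟨r, hr⟩ i).symm.trans this.symm
  choose c hc using fun i j => h1 _ (h.mem_left i j)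
  have h2 : ∀ i, (fun j m => w i j m (inr ())) = 0 := fun i =>
    h.eq_zero_of_rank_le_one (h.mem_mid i (inr ())) (c i) b fun j m => hc i j m
  have h3 := h.right (Pi.single (inr ()) 1) fun i j m => by
    simpa using congrFun (congrFun (h2 i) j) m
  have := congrFun h3 (inr ())
  simp at this

/-- Tensors all of whose slices lie in `S`, as a product. -/
theorem finrank_forall_mem {k V : Type*} [Field k] [AddCommGroup V] [Module k V]
    [FiniteDimensional k V] (S : Submodule k V) (n : ℕ) :
    Module.finrank k (Submodule.pi (Set.univ : Set (Fin n)) fun _ => S) =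
      n * Module.finrank k S := by
  have e : (Submodule.pi (Set.univ : Set (Fin n)) fun _ => S) ≃ₗ[k] (Fin n → S) :=
    { toFun := fun v i => ⟨v.1 i, v.2 i trivial⟩
      invFun := fun v => ⟨fun i => v i, fun i _ => (v i).2⟩
      map_add' := fun _ _ => rfl
      map_smul' := fun _ _ => rfl
      left_inv := fun _ => rfl
      right_inv := fun _ => rfl }
  rw [e.finrank_eq, Module.finrank_pi_fintype]
  simp

/-- The last two factors of a threefold tensor moved to the front. -/
def rotateEquiv (k : Type*) [Field k] (n : ℕ) :
    (Fin n → Fin n → Fin n → k) ≃ₗ[k] (Fin n → Fin n → Fin n → k) where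
  toFun t l i j := t i j l
  invFun t i j l := t l i j
  map_add' _ _ := rfl
  map_smul' _ _ := rfl
  left_inv _ := rfl
  right_inv _ := rfl

/-- Three linearly independent elements `y` of degree one in a domain cannot satisfy four
quadratic relations when the space of cubic tensors that are doubly relations has dimension at most
two. -/
theorem finrank_relSpace_lt_four [IsAlgClosed k] [IsDomain B] {y : Fin 3 → B}
    (hy : LinearIndependent k y)
    (h2 : Module.finrank k ↥((Submodule.pi (Set.univ : Set (Fin 3)) fun _ => relSpace (k := k) y) ⊓
      (Submodule.pi (Set.univ : Set (Fin 3)) fun _ => relSpace (k := k) y).comap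
        (rotateEquiv k 3).toLinearMap) ≤ 2) :
    Module.finrank k (relSpace (k := k) y) < 4 := by
  by_contra! h4
  set P1 := Submodule.pi (Set.univ : Set (Fin 3)) fun _ => relSpace (k := k) y
  set P2 := P1.comap (rotateEquiv k 3).toLinearMap
  have hP1 : Module.finrank k P1 = 3 * Module.finrank k (relSpace (k := k) y) :=
    finrank_forall_mem _ _
  have hP2 : Module.finrank k P2 = 3 * Module.finrank k (relSpace (k := k) y) := by
    rw [← hP1]
    have : P2 = P1.map (rotateEquiv k 3).symm.toLinearMap :=
      Submodule.comap_equiv_eq_map_symm _ _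
    rw [this, LinearEquiv.finrank_map_eq]
  let Ψ : (Fin 3 → Fin 3 → k) →ₗ[k] B :=
    { toFun := fun r => ∑ i, ∑ j, r i j • (y i * y j)
      map_add' := fun r s => by simp [add_smul, Finset.sum_add_distrib]
      map_smul' := fun c r => by simp [Finset.smul_sum, smul_smul] }
  have hΨ : ∀ r, Ψ r = ∑ i, ∑ j, r i j • (y i * y j) := fun _ => rfl
  have hker : LinearMap.ker Ψ = relSpace (k := k) y := by
    ext r; rfl
  let Φ : (Fin 3 → Fin 3 → Fin 3 → k) →ₗ[k] B :=
    { toFun := fun t => ∑ i, y i * Ψ (t i)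
      map_add' := fun r s => by simp [mul_add, Finset.sum_add_distrib]
      map_smul' := fun c r => by simp [Finset.smul_sum] }
  have hΦ : ∀ t, Φ t = ∑ i, y i * Ψ (t i) := fun _ => rfl
  have hΦ' : ∀ t, Φ t = ∑ l, Ψ (fun i j => t i j l) * y l := by
    intro t
    simp only [hΦ, hΨ, Finset.mul_sum, Finset.sum_mul, smul_mul_assoc, mul_smul_comm, mul_assoc]
    rw [Finset.sum_comm_cycle]
  have hle : P1 ⊔ P2 ≤ LinearMap.ker Φ := by
    refine sup_le (fun t ht => ?_) fun t ht => ?_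
    · rw [LinearMap.mem_ker, hΦ]
      refine Finset.sum_eq_zero fun i _ => ?_
      have : t i ∈ LinearMap.ker Ψ := hker ▸ ht i trivial
      rw [LinearMap.mem_ker.1 this, mul_zero]
    · rw [LinearMap.mem_ker, hΦ']
      refine Finset.sum_eq_zero fun i _ => ?_
      have : (fun a b => t a b i) ∈ LinearMap.ker Ψ := hker ▸ ht i trivial
      rw [LinearMap.mem_ker.1 this, zero_mul]
  have e1 := Submodule.finrank_sup_add_finrank_inf_eq P1 P2
  have e2 := Submodule.finrank_mono hle
  have e3 := LinearMap.finrank_range_add_finrank_ker Φ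
  have e4 := LinearMap.finrank_range_add_finrank_ker Ψ
  rw [hker] at e4
  simp only [Module.finrank_pi_fintype, Module.finrank_self, Finset.sum_const, Finset.card_univ,
    Fintype.card_fin, smul_eq_mul, mul_one] at e3 e4
  -- With ρ relations there are 9 - ρ independent quadratic products and at most 27 - (6ρ - 2) cubic
  -- ones; the latter number does not exceed the former once ρ ≥ 4.
  have hUT : Module.finrank k (LinearMap.range Φ) ≤ Module.finrank k (LinearMap.range Ψ) := by
    omega
  let L (i : Fin 3) : LinearMap.range Ψ →ₗ[k] LinearMap.range Φ :=
    ((LinearMap.mulLeft k (y i)).restrict (p := LinearMap.range Ψ) (q := LinearMap.range Φ) (by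
      rintro _ ⟨r, rfl⟩
      refine ⟨Pi.single i r, ?_⟩
      rw [hΦ, Finset.sum_eq_single i]
      · simp
      · intro j _ hj; simp [hj]
      · simp))
  have hL : ∀ i v, (L i v : B) = y i * v := fun _ _ => rfl
  have hinj : Function.Injective (L 0) := by
    rw [← LinearMap.ker_eq_bot, LinearMap.ker_eq_bot']
    intro v hv
    have h0 := congrArg Subtype.val hv
    rw [hL] at h0
    exact Subtype.ext ((mul_eq_zero.1 h0).resolve_left (hy.ne_zero 0))
  have heq : Module.finrank k (LinearMap.range Ψ) = Module.finrank k (LinearMap.range Φ) :=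
    le_antisymm (LinearMap.finrank_le_finrank_of_injective hinj) hUT
  let e := LinearEquiv.ofBijective (L 0)
    ⟨hinj, (LinearMap.injective_iff_surjective_of_finrank_eq_finrank heq).1 hinj⟩
  have hnt : Nontrivial (LinearMap.range Ψ) := by
    refine ⟨⟨⟨y 0 * y 0, ⟨Pi.single 0 (Pi.single 0 1), ?_⟩⟩, 0, fun h0 => ?_⟩⟩
    · simp [hΨ, Fin.sum_univ_three]
    · have := congrArg Subtype.val h0
      simp [hy.ne_zero 0] at this
  -- Left multiplication by y₀ is a bijection from quadratic to cubic products, so y₀⁻¹y₁ is an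
  -- endomorphism. An eigenvector v gives (y₁ - c y₀) v = 0, impossible in a domain.
  obtain ⟨c, hc⟩ := Module.End.exists_eigenvalue (e.symm.toLinearMap ∘ₗ L 1)
  obtain ⟨v, hv⟩ := hc.exists_hasEigenvector
  have h5 : e.symm (L 1 v) = c • v := hv.apply_eq_smul
  rw [LinearEquiv.symm_apply_eq, map_smul] at h5
  have h6 : y 1 * (v : B) = c • (y 0 * (v : B)) := congrArg Subtype.val h5
  rw [← smul_mul_assoc, ← sub_eq_zero, ← sub_mul] at h6
  have hv0 : (v : B) ≠ 0 := fun h0 => hv.2 (Subtype.ext h0)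
  have h7 := (mul_eq_zero.1 h6).resolve_right hv0
  have h8 := Fintype.linearIndependent_iff.1 hy ![-c, 1, 0] (by
    simp [Fin.sum_univ_three, ← h7]; abel) 1
  simp at h8

/-- With three of the four generators spanning the degree one part of a graded subalgebra, the
remaining generator moves past them. -/
theorem IsSuperpotential.exists_rel_of_three [IsAlgClosed k] [IsDomain B]
    {x : Fin 3 ⊕ Unit → B} (hli : LinearIndependent k x)
    {w : Fin 3 ⊕ Unit → Fin 3 ⊕ Unit → Fin 3 ⊕ Unit → Fin 3 ⊕ Unit → k}
    (h : IsSuperpotential (relSpace (k := k) x) w)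
    (ht : ∀ t : Fin 3 ⊕ Unit → Fin 3 ⊕ Unit → Fin 3 ⊕ Unit → k, (∀ i, t i ∈ relSpace x) →
      (∀ l, (fun i j => t i j l) ∈ relSpace x) →
        ∃ f : Fin 3 ⊕ Unit → k, ∀ i j l, t i j l = ∑ a, f a * w a i j l)
    (h1 : ∀ r ∈ relSpace (k := k) x, r (inr ()) (inr ()) = 0)
    (h2 : ∀ r ∈ relSpace (k := k) x, (∀ j, r (inr ()) j = 0) → ∀ i, r i (inr ()) = 0)
    (m : Fin 3 → k) :
    ∃ r ∈ relSpace (k := k) x, ∀ j, r (inr ()) (inl j) = m j := by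
  classical
  let row : relSpace (k := k) x →ₗ[k] (Fin 3 → k) :=
    { toFun := fun r j => (r : Fin 3 ⊕ Unit → Fin 3 ⊕ Unit → k) (inr ()) (inl j)
      map_add' := fun _ _ => rfl
      map_smul' := fun _ _ => rfl }
  let col : relSpace (k := k) x →ₗ[k] (Fin 3 ⊕ Unit → k) :=
    { toFun := fun r i => (r : Fin 3 ⊕ Unit → Fin 3 ⊕ Unit → k) i (inr ())
      map_add' := fun _ _ => rfl
      map_smul' := fun _ _ => rfl }
  suffices htop : LinearMap.range row = ⊤ by
    obtain ⟨r, hr⟩ : m ∈ LinearMap.range row := htop ▸ Submodule.mem_top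
    exact ⟨r, r.2, congrFun hr⟩
  by_contra hne
  have hlt := Submodule.finrank_lt hne
  have e1 := LinearMap.finrank_range_add_finrank_ker row
  rw [h.finrank_eq] at e1
  simp only [Module.finrank_pi_fintype, Module.finrank_self, Finset.sum_const, Finset.card_univ,
    Fintype.card_fin, smul_eq_mul, mul_one] at hlt
  let y : Fin 3 → B := fun i => x (inl i)
  have hyli : LinearIndependent k y := hli.comp _ inl_injective
  -- A relation whose entries `inr ()`, `inl j` vanish involves only the three generators, so a
  -- deficient row space forces at least 6 - 2 = 4 relations among these three.
  have hker : ∀ r : relSpace (k := k) x, row r = 0 →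
      (∀ j, (r : Fin 3 ⊕ Unit → Fin 3 ⊕ Unit → k) (inr ()) j = 0) ∧
      ∀ i, (r : Fin 3 ⊕ Unit → Fin 3 ⊕ Unit → k) i (inr ()) = 0 := by
    intro r hr
    have h3 : ∀ j, (r : Fin 3 ⊕ Unit → Fin 3 ⊕ Unit → k) (inr ()) j = 0 := by
      rintro (j | j)
      · exact congrFun hr j
      · exact h1 r r.2
    exact ⟨h3, h2 r r.2 h3⟩
  let ρ : LinearMap.ker row →ₗ[k] relSpace (k := k) y :=
    { toFun := fun r => ⟨fun i j => (r.1 : Fin 3 ⊕ Unit → Fin 3 ⊕ Unit → k) (inl i) (inl j), by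
        have h3 := mem_relSpace.1 r.1.2
        obtain ⟨h4, h5⟩ := hker r.1 r.2
        rw [mem_relSpace]
        simpa [Fintype.sum_sum_type, h4, h5] using h3⟩
      map_add' := fun _ _ => rfl
      map_smul' := fun _ _ => rfl }
  have hρ : Function.Injective ρ := by
    intro r s hrs
    obtain ⟨h4, h5⟩ := hker r.1 r.2
    obtain ⟨h6, h7⟩ := hker s.1 s.2
    refine Subtype.ext (Subtype.ext ?_)
    ext i j
    rcases i with i | i
    · rcases j with j | j
      · exact congrFun (congrFun (congrArg Subtype.val hrs) i) j
      · exact (h5 _).trans (h7 _).symm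
    · exact (h4 _).trans (h6 _).symm
  have h4 : 4 ≤ Module.finrank k (relSpace (k := k) y) :=
    le_trans (by omega) (LinearMap.finrank_le_finrank_of_injective hρ)
  refine absurd (finrank_relSpace_lt_four hyli ?_) (not_lt.2 h4)
  -- the cubic tensors come from functionals vanishing on the last column
  obtain ⟨s, hs⟩ := exists_linearIndependent_of_le_finrank
    (h.two_le_finrank_column col fun _ _ => rfl)
  let M : Matrix (Fin 2) (Fin 3 ⊕ Unit) k := fun i => s i
  have hM : LinearIndependent k M :=
    hs.map' (LinearMap.range col).subtype (Submodule.ker_subtype _)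
  have hrank : M.rank = 2 := by simpa using hM.rank_matrix
  have e2 := LinearMap.finrank_range_add_finrank_ker M.mulVecLin
  rw [← Matrix.rank, hrank] at e2
  simp only [Module.finrank_pi_fintype, Module.finrank_self, Finset.sum_const, Finset.card_univ,
    Fintype.card_sum, Fintype.card_fin, Fintype.card_unit, smul_eq_mul, mul_one] at e2
  let τ : (Fin 3 ⊕ Unit → k) →ₗ[k] (Fin 3 → Fin 3 → Fin 3 → k) :=
    { toFun := fun f i j l => ∑ a, f a * w a (inl i) (inl j) (inl l)
      map_add' := fun f g => by ext i j l; simp [add_mul, Finset.sum_add_distrib]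
      map_smul' := fun c f => by ext i j l; simp [Finset.mul_sum, mul_add, mul_assoc] }
  refine le_trans (Submodule.finrank_mono (t := (LinearMap.ker M.mulVecLin).map τ) ?_)
    (le_trans (Submodule.finrank_map_le _ _) (by omega))
  rintro t ⟨ht1, ht2⟩
  let t' : Fin 3 ⊕ Unit → Fin 3 ⊕ Unit → Fin 3 ⊕ Unit → k :=
    Sum.elim (fun i => Sum.elim (fun j => Sum.elim (fun l => t i j l) 0) 0) 0
  obtain ⟨f, hf⟩ := ht t' (by
      rintro (i | i)
      · have := mem_relSpace.1 (ht1 i trivial)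
        rw [mem_relSpace]
        simpa [Fintype.sum_sum_type, t'] using this
      · exact Submodule.zero_mem _) (by
      rintro (l | l)
      · have := mem_relSpace.1 (ht2 l trivial)
        rw [mem_relSpace]
        simpa [Fintype.sum_sum_type, t', rotateEquiv, y] using this
      · have : (fun i j => t' i j (inr l)) = 0 := by
          ext i j; rcases i with i | i <;> rcases j with j | j <;> rfl
        rw [this]; exact Submodule.zero_mem _)
  refine ⟨f, ?_, ?_⟩
  · change M.mulVec f = 0
    ext i
    obtain ⟨r, hr⟩ := (s i).2
    -- As `t'` vanishes when its first index is `inr ()`, the functional placing f on the last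
    -- column kills w, hence R. So f is orthogonal to two independent columns, which leaves a space
    -- of dimension two.
    have h5 := h.nondeg_left (fun a b => if b = inr () then f a else 0) (fun m l => by
      simp only [ite_mul, zero_mul, Finset.sum_ite_eq', Finset.mem_univ, if_true]
      exact (hf (inr ()) m l).symm) r r.2
    simp only [ite_mul, zero_mul, Finset.sum_ite_eq', Finset.mem_univ, if_true] at h5
    simp only [Matrix.mulVec, dotProduct, M, ← hr, Pi.zero_apply]
    rw [← h5]
    exact Finset.sum_congr rfl fun a _ => mul_comm _ _
  · ext i j l
    exact (hf (inl i) (inl j) (inl l)).symm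

end

end DoubleExt
end

/-! ### Quadratic relations in global dimension two. -/

noncomputable section

namespace DoubleExt

open Abelian

section GlobalDimensionTwo

variable {k : Type u} {C : Type v} [Field k] [Ring C] [Algebra k C] {𝒞 : ℕ → Submodule k C}
  {β κ : Type} [Fintype β] [Fintype κ]

/-- Two syzygy steps use up the projective dimension of k. Projectivity suffices: a dual basis
replaces a free basis in the argument for the quadratic form. -/
theorem projective_ker_of_projectiveDimension {y : β → C}
    (hpd : HasProjectiveDimensionLE (trivialModule 𝒞) 2)
    (hy : Set.range (fun v : β → C => ∑ i, v i * y i) = augIdeal 𝒞) :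
    Module.Projective C (LinearMap.ker (toAugIdeal hy)) := by
  have h1 := shortExact_of_exact (augIdeal 𝒞).injective_subtype (exact_augIdeal 𝒞)
    (augIdeal 𝒞).mkQ_surjective
  have h2 := shortExact_of_exact (LinearMap.ker (toAugIdeal hy)).injective_subtype
    (LinearMap.exact_subtype_ker_map (toAugIdeal hy)) (toAugIdeal_surjective hy)
  have p1 : Projective (ModuleCat.of C C) := (IsProjective.iff_projective _).1 inferInstance
  have p2 : Projective (ModuleCat.of C (β → C)) := (IsProjective.iff_projective _).1 inferInstance
  have q1 : HasProjectiveDimensionLT (ModuleCat.of C (augIdeal 𝒞)) 2 :=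
    h1.hasProjectiveDimensionLT_X₁ 2
      (hasProjectiveDimensionLT_of_ge (ModuleCat.of C C) 1 2 (by norm_num)) hpd
  have q2 : HasProjectiveDimensionLT (ModuleCat.of C (LinearMap.ker (toAugIdeal hy))) 1 :=
    h2.hasProjectiveDimensionLT_X₁ 1
      (hasProjectiveDimensionLT_of_ge (ModuleCat.of C (β → C)) 1 1 (by norm_num)) q1
  exact (IsProjective.iff_projective _).2 (projective_iff_hasProjectiveDimensionLT_one.2 q2)

/-- Compatibility of syzygy classes with linear combinations. -/
theorem IsSyzygyClass.comp_smul_add {K F M : Type v} [AddCommGroup K] [Module C K]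
    [AddCommGroup F] [Module C F] [AddCommGroup M] [Module C M] {n : ℕ}
    (α : Ext.{v} (ModuleCat.of C M) (ModuleCat.of C K) n) (s t : k) (f g : K →ₗ[C] C) :
    α.comp (Ext.mk₀ (ModuleCat.ofHom (s • f + t • g))) (add_zero n) =
      s • α.comp (Ext.mk₀ (ModuleCat.ofHom f)) (add_zero n) +
      t • α.comp (Ext.mk₀ (ModuleCat.ofHom g)) (add_zero n) := by
  have : Ext.mk₀ (ModuleCat.ofHom (s • f + t • g)) =
      s • Ext.mk₀ (ModuleCat.ofHom f) + t • Ext.mk₀ (ModuleCat.ofHom g) := by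
    rw [← Ext.mk₀_smul, ← Ext.mk₀_smul, ← Ext.mk₀_add]
    congr 1
    ext u
    simp only [ModuleCat.hom_ofHom, ModuleCat.hom_add, LinearMap.add_apply, LinearMap.smul_apply,
      Algebra.smul_def]
    rfl
  rw [this, Ext.comp_add, Ext.comp_smul, Ext.comp_smul]

theorem extClass_comp_comp {X : ModuleCat.{v} C} {K : Type v} [AddCommGroup K] [Module C K]
    {L N : Type v} [AddCommGroup L] [Module C L] [AddCommGroup N] [Module C N] {n : ℕ}
    (α : Ext.{v} X (ModuleCat.of C K) n) (g : K →ₗ[C] L) (f : L →ₗ[C] N) :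
    (α.comp (Ext.mk₀ (ModuleCat.ofHom g)) (add_zero n)).comp (Ext.mk₀ (ModuleCat.ofHom f))
      (add_zero n) = α.comp (Ext.mk₀ (ModuleCat.ofHom (f ∘ₗ g))) (add_zero n) := by
  rw [Ext.comp_assoc_of_second_deg_zero, Ext.mk₀_comp_mk₀]
  rfl

/-- The quadratic relations of an algebra of global dimension two generated in degree one that
satisfies the Gorenstein condition: they are multiples of one nondegenerate relation. -/
theorem exists_form_of_gorenstein_two [DecidableEq β] [DecidableEq κ] (hC : IsConnectedGraded 𝒞)
    (hpd : HasProjectiveDimensionLE (trivialModule 𝒞) 2) (hG : IsLeftGorenstein 𝒞 2)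
    {y : β → C} (hy : ∀ i, y i ∈ 𝒞 1) (hli : LinearIndependent k y)
    (hgen : Set.range (fun v : β → C => ∑ i, v i * y i) = augIdeal 𝒞)
    {f : κ → β → C} (hf : ∀ l j, f l j ∈ 𝒞 1)
    (hrel : ∀ u : β → C, ∑ j, u j * y j = 0 ↔ ∃ s : κ → C, ∀ j, u j = ∑ l, s l * f l j) :
    ∃ q : β → β → k, (∀ r ∈ relSpace (k := k) y, ∃ t : k, ∀ i j, r i j = t * q i j) ∧
      (∃ l j, f l j ≠ 0) ∧
      ∀ φ : β → k, ∃ ψ : β → k, ∀ i, ∑ j, q i j * ψ j = φ i := by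
  have hproj := projective_ker_of_projectiveDimension hpd hgen
  set K := LinearMap.ker (toAugIdeal hgen) with hK
  have memK : ∀ u : β → C, u ∈ K ↔ ∑ j, u j * y j = 0 := fun u => by
    rw [hK, LinearMap.mem_ker, toAugIdeal_eq_zero_iff]
  obtain ⟨α1, hα1⟩ := exists_isSyzygyClass_one K.injective_subtype
    (LinearMap.exact_subtype_ker_map (toAugIdeal hgen)) (toAugIdeal_surjective hgen)
  obtain ⟨α, hα⟩ := hα1.shift le_rfl (augIdeal 𝒞).injective_subtype (exact_augIdeal 𝒞)
    (augIdeal 𝒞).mkQ_surjective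
  let cls (g : K →ₗ[C] C) : Ext.{v} (trivialModule 𝒞) (ModuleCat.of C C) 2 :=
    α.comp (Ext.mk₀ (ModuleCat.ofHom g)) (add_zero 2)
  have cls_zero : ∀ g, cls g = 0 → ∃ h : β → C, ∀ u : K, g u = ∑ j, (u : β → C) j * h j := by
    intro g hg
    obtain ⟨h, rfl⟩ := ((hα C).1 g).1 hg
    exact ⟨fun j => h (Pi.single j 1), fun u => exists_eq_rowSum h u⟩
  have cls_surj : ∀ e, ∃ g, cls g = e := (hα C).2
  have cls_lin : ∀ (s t : k) (g h : K →ₗ[C] C), cls (s • g + t • h) = s • cls g + t • cls h :=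
    fun s t g h => IsSyzygyClass.comp_smul_add (F := β → C) α s t g h
  obtain ⟨e, he0, he⟩ := finrank_eq_one_iff'.1 hG.finrank_ext
  -- a dual basis of the projective module `K`
  let F : κ → K := fun l => ⟨f l, (memK _).2 ((hrel _).2 ⟨Pi.single l 1,
    fun j => by simp [Pi.single_apply]⟩)⟩
  let p : (κ → C) →ₗ[C] K := Fintype.linearCombination C F
  have hp : ∀ (s : κ → C) j, (p s : β → C) j = ∑ l, s l * f l j := fun s j => by
    simp [p, Fintype.linearCombination_apply, F]
  have psurj : Function.Surjective p := by
    rintro ⟨u, hu⟩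
    obtain ⟨s, hs⟩ := (hrel u).1 ((memK u).1 hu)
    exact ⟨s, Subtype.ext (funext fun j => (hp s j).trans (hs j).symm)⟩
  obtain ⟨σ, hσ⟩ := Module.projective_lifting_property p LinearMap.id psurj
  let g : κ → K →ₗ[C] C := fun l => LinearMap.proj l ∘ₗ σ
  have hg : ∀ (u : K) j, (u : β → C) j = ∑ l, g l u * f l j := by
    intro u j
    rw [← hp]
    exact (congrFun (congrArg Subtype.val (LinearMap.congr_fun hσ u)) j).symm
  have augK : ∀ (u : K) j, hC.aug ((u : β → C) j) = 0 := by
    intro u j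
    rw [hg u j, map_sum]
    exact Finset.sum_eq_zero fun l _ => by rw [map_mul, hC.aug_of_mem le_rfl (hf l j), mul_zero]
  have deg1 : ∀ (u : K) j, hC.proj 1 ((u : β → C) j) = ∑ l, hC.aug (g l u) • f l j := by
    intro u j
    conv_lhs => rw [hg u j]
    rw [map_sum]
    exact Finset.sum_congr rfl fun l _ => hC.proj_one_mul (hf l j)
  choose t ht using fun l => he (cls (g l))
  -- A combination of coordinate functions with trivial class extends to the free module. Since
  -- vectors in K have entries of augmentation zero, it then takes values of augmentation zero on K.
  have hprop : ∀ l m (u : K), t m * hC.aug (g l u) = t l * hC.aug (g m u) := by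
    intro l m u
    obtain ⟨h, hh⟩ := cls_zero (t m • g l + (-t l) • g m) (by
      rw [cls_lin, ← ht, ← ht, smul_smul, smul_smul, ← add_smul]
      rw [show t m * t l + -t l * t m = 0 by ring, zero_smul])
    have h1 := congrArg hC.aug (hh u)
    simp only [LinearMap.add_apply, LinearMap.smul_apply, map_add, map_smul, map_sum, map_mul,
      augK, zero_mul, Finset.sum_const_zero, smul_eq_mul] at h1
    linear_combination h1
  have hsp : ∀ a ∈ 𝒞 1, ∃ c : β → k, ∑ i, c i • y i = a := by
    intro a ha
    have h5 : a ∈ (augIdeal 𝒞 : Set C) := IsConnectedGraded.mem_augIdeal_of_mem le_rfl ha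
    rw [← hgen] at h5
    obtain ⟨u, hu⟩ := h5
    refine ⟨fun i => hC.aug (u i), ?_⟩
    rw [← hC.proj_of_mem ha, ← hu, map_sum]
    exact Finset.sum_congr rfl fun i _ => (hC.proj_one_mul (hy i)).symm
  have ext_coeff : ∀ c d : β → k, ∑ i, c i • y i = ∑ i, d i • y i → c = d := by
    intro c d hcd
    rw [← sub_eq_zero, ← Finset.sum_sub_distrib] at hcd
    ext i
    exact sub_eq_zero.1 (Fintype.linearIndependent_iff.1 hli (c - d)
      (by simpa [sub_smul] using hcd) i)
  -- some coordinate function of the dual basis represents a generator of `Ext²`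
  obtain ⟨l₀, hl₀⟩ : ∃ l, t l ≠ 0 := by
    by_contra! h0
    have hf0 : ∀ l j, f l j = 0 := by
      intro l j
      have h1 : ∀ m (u : K), hC.aug (g m u) = 0 := by
        intro m u
        obtain ⟨h, hh⟩ := cls_zero (g m) (by rw [← ht, h0, zero_smul])
        rw [hh, map_sum]
        exact Finset.sum_eq_zero fun j _ => by rw [map_mul, augK, zero_mul]
      have h2 := deg1 (F l) j
      simp only [h1, zero_smul, Finset.sum_const_zero] at h2
      rwa [hC.proj_of_mem (hf l j)] at h2
    obtain ⟨g', hg'⟩ := cls_surj e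
    have : g' = 0 := by
      ext u
      have hu : u = 0 := by
        refine Subtype.ext (funext fun j => ?_)
        rw [hg u j]
        exact Finset.sum_eq_zero fun l _ => by rw [hf0, mul_zero]
      rw [hu, map_zero, map_zero]
    apply he0
    rw [← hg', this]
    exact ((hα C).1 _).2 ⟨0, rfl⟩
  choose c hc using fun l j => hsp _ (hf l j)
  -- By `hprop` the augmented coordinate functions are `t l / t l₀` times the one with index `l₀`;
  -- weighting the coefficients of the generating relations accordingly gives the form of which all
  -- relations are multiples.
  let q : β → β → k := fun i j => ∑ l, t l / t l₀ * c l j i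
  let vec (r : β → β → k) : β → C := fun j => ∑ i, r i j • y i
  have hvec : ∀ r ∈ relSpace (k := k) y, vec r ∈ K := by
    intro r hr
    rw [memK]
    rw [mem_relSpace, sum_smul_mul_eq_dotProduct] at hr
    exact hr
  have hvec1 : ∀ r j, vec r j ∈ 𝒞 1 := fun r j =>
    Submodule.sum_mem _ fun i _ => Submodule.smul_mem _ _ (hy i)
  have hq : ∀ r (hr : r ∈ relSpace (k := k) y) i j,
      r i j = hC.aug (g l₀ ⟨vec r, hvec r hr⟩) * q i j := by
    intro r hr i j
    refine congrFun (ext_coeff (fun i => r i j)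
      (fun i => hC.aug (g l₀ ⟨vec r, hvec r hr⟩) * q i j) ?_) i
    have h1 := deg1 ⟨vec r, hvec r hr⟩ j
    rw [hC.proj_of_mem (hvec1 r j)] at h1
    refine h1.trans ?_
    have h2 : ∀ l, hC.aug (g l ⟨vec r, hvec r hr⟩) =
        hC.aug (g l₀ ⟨vec r, hvec r hr⟩) * (t l / t l₀) := fun l => by
      field_simp
      linear_combination hprop l l₀ ⟨vec r, hvec r hr⟩
    refine (Finset.sum_congr rfl fun l _ => by rw [h2 l]).trans ?_
    simp only [q, Finset.mul_sum, Finset.sum_smul]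
    rw [Finset.sum_comm]
    refine Finset.sum_congr rfl fun l _ => ?_
    rw [← hc l j, Finset.smul_sum]
    exact Finset.sum_congr rfl fun i _ => by rw [smul_smul, mul_assoc]
  obtain ⟨l₁, j₁, hf1⟩ : ∃ l j, f l j ≠ 0 := by
    by_contra! h0
    apply hl₀
    have hcls : cls (g l₀) = 0 := by
      refine ((hα C).1 _).2 ⟨0, ?_⟩
      ext u
      have hu : u = 0 := by
        refine Subtype.ext (funext fun j => ?_)
        rw [hg u j]
        exact Finset.sum_eq_zero fun l _ => by rw [h0, mul_zero]
      rw [hu, map_zero, map_zero]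
    have := ht l₀
    rw [hcls] at this
    exact (smul_eq_zero.1 this).resolve_right he0
  have hr₁ : (fun i j => c l₁ j i) ∈ relSpace (k := k) y := by
    rw [mem_relSpace, sum_smul_mul_eq_dotProduct]
    have : (fun j => ∑ i, c l₁ j i • y i) = f l₁ := funext fun j => hc l₁ j
    rw [this]
    exact (memK _).1 (F l₁).2
  obtain ⟨i₁, hi₁⟩ : ∃ i, c l₁ j₁ i ≠ 0 := by
    by_contra! h0
    exact hf1 (by rw [← hc]; simp [h0])
  refine ⟨q, fun r hr => ⟨_, hq r hr⟩, ⟨l₁, j₁, hf1⟩, fun φ => ?_⟩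
  set u : K := ⟨_, hvec _ hr₁⟩
  have hu0 : hC.aug (g l₀ u) ≠ 0 := fun h0 => hi₁ (by
    have := hq _ hr₁ i₁ j₁
    simpa [u, h0] using this)
  have ha : ∑ i, φ i • y i ∈ 𝒞 1 := Submodule.sum_mem _ fun i _ => Submodule.smul_mem _ _ (hy i)
  -- Ext² is killed by elements of degree one on the right, so `g l₀` followed by right
  -- multiplication by the linear form φ extends to the free module. The linear part of this at a
  -- nonzero relation solves the system with matrix q.
  obtain ⟨h, hh⟩ := cls_zero (LinearMap.toSpanSingleton C C (∑ i, φ i • y i) ∘ₗ g l₀) (by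
    have h1 := hG.ext_smul 1 le_rfl _ ha (cls (g l₀))
    rw [← h1]
    exact (extClass_comp_comp α (g l₀) _).symm)
  refine ⟨fun j => hC.aug (h j), fun i => ?_⟩
  refine congrFun (ext_coeff (fun i => ∑ j, q i j * hC.aug (h j)) φ ?_) i
  have h1 := congrArg (hC.proj 1) (hh u)
  simp only [LinearMap.comp_apply, LinearMap.toSpanSingleton_apply, smul_eq_mul] at h1
  rw [hC.proj_one_mul ha, map_sum] at h1
  have h2 : ∀ j, hC.proj 1 ((u : β → C) j * h j) = hC.aug (h j) • vec (fun i j => c l₁ j i) j :=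
    fun j =>
    hC.proj_one_mul' (hvec1 (fun i j => c l₁ j i) j)
  simp only [h2] at h1
  apply smul_right_injective _ hu0
  change hC.aug (g l₀ u) • _ = hC.aug (g l₀ u) • _
  rw [h1]
  have h3 : ∀ i j, c l₁ j i = hC.aug (g l₀ u) * q i j := fun i j => hq _ hr₁ i j
  simp only [vec, h3, Finset.smul_sum, Finset.sum_smul, smul_smul]
  rw [Finset.sum_comm]
  exact Finset.sum_congr rfl fun _ _ => Finset.sum_congr rfl fun _ _ => by ring_nf

end GlobalDimensionTwo

end DoubleExt
end

/-! ### The quotient by some of the generators. -/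

noncomputable section

namespace DoubleExt

open Matrix

variable {k : Type u} {B : Type v} [Field k] [Ring B] [Algebra k B] {ℬ : ℕ → Submodule k B}

theorem IsConnectedGraded.proj_one_mul_eq (h : IsConnectedGraded ℬ) (a b : B) :
    h.proj 1 (a * b) = h.aug a • h.proj 1 b + h.aug b • h.proj 1 a := by
  obtain ⟨N, hN⟩ := h.exists_eq_sum_proj b
  have hb := hN (N + 2) (by omega)
  rw [Finset.sum_range_succ', Finset.sum_range_succ'] at hb
  conv_lhs => rw [hb]
  simp only [mul_add, Finset.mul_sum, map_add, map_sum]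
  rw [Finset.sum_eq_zero fun i _ => h.proj_mul_right_of_lt (by omega) a (h.proj_mem _ b),
    h.proj_one_mul (h.proj_mem _ b), ← h.algebraMap_aug, ← Algebra.commutes, ← Algebra.smul_def,
    map_smul, zero_add]

/-- Graded linear maps commute with the projections. -/
theorem IsConnectedGraded.proj_map {C : Type*} [Ring C] [Algebra k C] {𝒞 : ℕ → Submodule k C}
    (hc : IsConnectedGraded ℬ) (hC : IsConnectedGraded 𝒞) (f : B →ₗ[k] C)
    (hf : ∀ n, ∀ b ∈ ℬ n, f b ∈ 𝒞 n) (n : ℕ) (b : B) : hC.proj n (f b) = f (hc.proj n b) := by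
  obtain ⟨N, hN⟩ := hc.exists_eq_sum_proj b
  have hb := hN (N + n + 1) (by omega)
  conv_lhs => rw [hb]
  rw [map_sum, map_sum, Finset.sum_eq_single n]
  · exact hC.proj_of_mem (hf n _ (hc.proj_mem n b))
  · intro m _ hm
    exact hC.proj_of_mem_ne (hf m _ (hc.proj_mem m b)) hm
  · intro hn
    exact absurd (Finset.mem_range.2 (by omega)) hn

section Quotient

variable {I : TwoSidedIdeal B}

theorem mkₐ_eq_zero_iff {b : B} : I.ringCon.mkₐ (α := k) b = 0 ↔ b ∈ I := by
  rw [← map_zero (I.ringCon.mkₐ (α := k)), TwoSidedIdeal.mem_iff]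
  exact RingCon.eq _

theorem mkₐ_surjective : Function.Surjective (I.ringCon.mkₐ (α := k)) := by
  intro c
  obtain ⟨b, rfl⟩ := Quotient.exists_rep c
  exact ⟨b, rfl⟩

variable (hc : IsConnectedGraded ℬ) (hC : IsConnectedGraded (quotGrading ℬ I))
include hc hC

theorem proj_mkₐ (n : ℕ) (b : B) :
    hC.proj n (I.ringCon.mkₐ (α := k) b) = I.ringCon.mkₐ (α := k) (hc.proj n b) :=
  hc.proj_map hC (I.ringCon.mkₐ (α := k)).toLinearMap (fun _ a ha => ⟨a, ha, rfl⟩) n b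

theorem aug_mkₐ (b : B) : hC.aug (I.ringCon.mkₐ (α := k) b) = hc.aug b := by
  apply hC.algebraMap_injective
  rw [hC.algebraMap_aug, proj_mkₐ hc hC, ← hc.algebraMap_aug, AlgHom.commutes]

end Quotient

variable {α β : Type} [Fintype α] [Fintype β]

open Sum

/-- Elements of the ideal generated by a subspace of `B₁` have degree one part in the subspace. -/
theorem proj_one_mem_of_mem_span (hc : IsConnectedGraded ℬ) {S : Set B} {X : Submodule k B}
    (hS : S ⊆ X) (hX : X ≤ ℬ 1) {b : B} (hb : b ∈ TwoSidedIdeal.span S) :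
    hc.aug b = 0 ∧ hc.proj 1 b ∈ X := by
  let J : TwoSidedIdeal B := TwoSidedIdeal.mk' {b | hc.aug b = 0 ∧ hc.proj 1 b ∈ X}
    ⟨by simp, by simp⟩
    (fun {a b} ha hb => ⟨by rw [map_add, ha.1, hb.1, add_zero], by
      rw [map_add]; exact X.add_mem ha.2 hb.2⟩)
    (fun {a} ha => ⟨by rw [map_neg, ha.1, neg_zero], by rw [map_neg]; exact X.neg_mem ha.2⟩)
    (fun {a b} hb => ⟨by rw [map_mul, hb.1, mul_zero], by
      rw [hc.proj_one_mul_eq, hb.1, zero_smul, add_zero]; exact X.smul_mem _ hb.2⟩)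
    (fun {a b} ha => ⟨by rw [map_mul, ha.1, zero_mul], by
      rw [hc.proj_one_mul_eq, ha.1, zero_smul, zero_add]; exact X.smul_mem _ ha.2⟩)
  have hJ : b ∈ J := TwoSidedIdeal.mem_span_iff.1 hb J fun s hs => by
    refine (TwoSidedIdeal.mem_mk' _ _ _ _ _ _ _).2 ⟨?_, ?_⟩
    · exact hc.aug_of_mem le_rfl (hX (hS hs))
    · rw [hc.proj_of_mem (hX (hS hs))]; exact hS hs
  simpa only [J, TwoSidedIdeal.mem_mk', Set.mem_ofPred_eq] using hJ

/-- The ideal generated by some of the generators of degree one. -/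
theorem exists_eq_add_of_mem_span (hc : IsConnectedGraded ℬ) {x : α ⊕ β → B}
    (hgen : ∀ b ∈ augIdeal ℬ, ∃ u : α ⊕ β → B, u ⬝ᵥ x = b) {I : TwoSidedIdeal B}
    (hx : ∀ a, x (inl a) ∈ I) {S : Set B} (hI : I = TwoSidedIdeal.span S)
    (hS : S ⊆ Submodule.span k (Set.range (x ∘ inl))) {b : B} (hb : b ∈ I) :
    ∃ (c : α → B) (e : β → B), (∀ j, e j ∈ I) ∧
      b = ∑ i, c i * x (inl i) + ∑ j, e j * x (inr j) := by
  let J : TwoSidedIdeal B := TwoSidedIdeal.mk'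
    {b | ∃ (c : α → B) (e : β → B), (∀ j, e j ∈ I) ∧
      b = ∑ i, c i * x (inl i) + ∑ j, e j * x (inr j)}
    ⟨0, 0, fun _ => I.zero_mem, by simp⟩
    (by
      rintro _ _ ⟨c, e, he, rfl⟩ ⟨c', e', he', rfl⟩
      refine ⟨c + c', e + e', fun j => I.add_mem (he j) (he' j), ?_⟩
      simp only [Pi.add_apply, add_mul, Finset.sum_add_distrib]
      abel)
    (by
      rintro _ ⟨c, e, he, rfl⟩
      refine ⟨-c, -e, fun j => I.neg_mem (he j), ?_⟩
      simp only [Pi.neg_apply, neg_mul, Finset.sum_neg_distrib]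
      abel)
    (by
      rintro a _ ⟨c, e, he, rfl⟩
      refine ⟨fun i => a * c i, fun j => a * e j, fun j => I.mul_mem_left _ _ (he j), ?_⟩
      simp only [mul_add, Finset.mul_sum, mul_assoc])
    (by
      rintro b a ⟨c, e, he, hb⟩
      have hbI : b ∈ I := by
        rw [hb]
        exact I.add_mem (sum_mem fun i _ => I.mul_mem_left _ _ (hx i))
          (sum_mem fun j _ => I.mul_mem_right _ _ (he j))
      -- Closure under right multiplication: a is a scalar plus Σ uᵢxᵢ, and in b Σ uᵢxᵢ the factors
      -- b uᵢ again lie in the ideal.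
      obtain ⟨u, hu⟩ := hgen (a - algebraMap k B (hc.aug a)) (hc.mem_augIdeal_iff.2 (by simp))
      refine ⟨fun i => hc.aug a • c i + b * u (inl i), fun j => hc.aug a • e j + b * u (inr j),
        fun j => I.add_mem ?_ (I.mul_mem_right _ _ hbI), ?_⟩
      · rw [Algebra.smul_def]; exact I.mul_mem_left _ _ (he j)
      · have : a = algebraMap k B (hc.aug a) + (∑ i, u (inl i) * x (inl i) +
            ∑ j, u (inr j) * x (inr j)) := by
          rw [← Fintype.sum_sum_type (fun i => u i * x i)]
          rw [dotProduct] at hu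
          rw [hu]; abel
        conv_lhs => rw [this]
        rw [mul_add, ← Algebra.commutes, ← Algebra.smul_def]
        conv_lhs => rw [hb]; enter [2]; rw [← hb]
        simp only [mul_add, Finset.mul_sum, add_mul, Finset.sum_add_distrib, smul_add,
          Finset.smul_sum, smul_mul_assoc, mul_assoc]
        abel)
  have hJ : b ∈ J := TwoSidedIdeal.mem_span_iff.1 (hI ▸ hb) J fun s hs => by
    refine (TwoSidedIdeal.mem_mk' _ _ _ _ _ _ _).2 ?_
    obtain ⟨c, hc'⟩ := (Submodule.mem_span_range_iff_exists_fun k).1 (hS hs)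
    refine ⟨fun i => algebraMap k B (c i), 0, fun _ => I.zero_mem, ?_⟩
    simp [← hc', Algebra.smul_def]
  simpa only [J, TwoSidedIdeal.mem_mk', Set.mem_ofPred_eq] using hJ

/-- If the quotient by the generators `x (inl a)` is regular of dimension two, then the quadratic
relations modulo these generators are spanned by one nondegenerate form. -/
theorem IsAdaptedResolution.exists_form_of_quotient [DecidableEq β] (hc : IsConnectedGraded ℬ)
    {x : α ⊕ β → B} (hx : ∀ i, x i ∈ ℬ 1) (hli : LinearIndependent k x) {F : Matrix (Fin 6) (α ⊕ β) B}
    {G : Matrix (α ⊕ β) (Fin 6) B} (h : IsAdaptedResolution ℬ x F G) {S : Set B}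
    (hS : Submodule.span k S = Submodule.span k (Set.range (x ∘ inl)))
    (hreg : IsASRegular (quotGrading ℬ (TwoSidedIdeal.span S)) 2) :
    ∃ q : β → β → k, (∀ r ∈ relSpace (k := k) x, ∃ t : k, ∀ i j, r (inr i) (inr j) = t * q i j) ∧
      (∃ r ∈ relSpace (k := k) x, ∃ i j, r (inr i) (inr j) ≠ 0) ∧
      ∀ φ : β → k, ∃ ψ : β → k, ∀ i, ∑ j, q i j * ψ j = φ i := by
  obtain ⟨I, hI⟩ : ∃ I : TwoSidedIdeal B, I = TwoSidedIdeal.span S := ⟨_, rfl⟩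
  rw [← hI] at hreg
  have hC := hreg.connected
  let π := I.ringCon.mkₐ (α := k)
  have hSX : S ⊆ Submodule.span k (Set.range (x ∘ inl)) := hS ▸ Submodule.subset_span
  have hX1 : Submodule.span k (Set.range (x ∘ inl)) ≤ ℬ 1 :=
    Submodule.span_le.2 (by rintro _ ⟨a, rfl⟩; exact hx _)
  have hxI : ∀ a, x (inl a) ∈ I := by
    intro a
    have h1 : x (inl a) ∈ Submodule.span k S := hS ▸ Submodule.subset_span ⟨a, rfl⟩
    generalize x (inl a) = b at h1
    induction h1 using Submodule.span_induction with
    | mem b hb => exact hI ▸ TwoSidedIdeal.subset_span hb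
    | zero => exact I.zero_mem
    | add a b _ _ ha hb => exact I.add_mem ha hb
    | smul t a _ ha => rw [Algebra.smul_def]; exact I.mul_mem_left _ _ ha
  have hπx : ∀ a, π (x (inl a)) = 0 := fun a => mkₐ_eq_zero_iff.2 (hxI a)
  have hI1 : ∀ c : β → k, ∑ j, c j • x (inr j) ∈ I → c = 0 := by
    intro c hcI
    have h1 := (proj_one_mem_of_mem_span hc hSX hX1 (hI ▸ hcI)).2
    rw [hc.proj_of_mem (Submodule.sum_mem _ fun j _ => Submodule.smul_mem _ _ (hx _)),
      Submodule.mem_span_range_iff_exists_fun] at h1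
    obtain ⟨d, hd⟩ := h1
    have h2 := Fintype.linearIndependent_iff.1 hli (Sum.elim (-d) c) (by
      rw [Fintype.sum_sum_type]
      simp only [Sum.elim_inl, Sum.elim_inr, Pi.neg_apply, neg_smul, Finset.sum_neg_distrib, ← hd,
        Function.comp_apply]
      exact neg_add_cancel _)
    ext j
    exact h2 (inr j)
  let y : β → I.ringCon.Quotient := fun j => π (x (inr j))
  have hmem : ∀ {n b}, b ∈ ℬ n → π b ∈ quotGrading ℬ I n := fun hb => ⟨_, hb, rfl⟩
  have hdot : ∀ u : α ⊕ β → B, π (u ⬝ᵥ x) = ∑ j, π (u (inr j)) * y j := by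
    intro u
    rw [dotProduct, Fintype.sum_sum_type, map_add, map_sum, map_sum]
    simp only [map_mul, hπx, mul_zero, Finset.sum_const_zero, zero_add, y]
  -- The six rows of F, reduced modulo the ideal, generate the syzygies of the remaining generators.
  -- They may be redundant, which the lemma on global dimension two allows.
  obtain ⟨q, hq1, ⟨l, j, hlj⟩, hq3⟩ := exists_form_of_gorenstein_two (κ := Fin 6) hC
    (hreg.gldim_left.1 _) hreg.gorenstein_left (y := y) (fun j => hmem (hx _))
    (by
      rw [Fintype.linearIndependent_iff]
      intro c hc' j
      refine congrFun (hI1 c ?_) j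
      rw [← mkₐ_eq_zero_iff (k := k), ← hc', map_sum]
      simp [y, π])
    (by
      ext c
      constructor
      · rintro ⟨v, rfl⟩
        exact Submodule.sum_mem _ fun j _ => Submodule.smul_mem _ (v j)
          (IsConnectedGraded.mem_augIdeal_of_mem le_rfl (hmem (hx _)))
      · intro hcaug
        obtain ⟨b, rfl⟩ := mkₐ_surjective (k := k) c
        have h1 := hC.mem_augIdeal_iff.1 hcaug
        rw [aug_mkₐ hc hC] at h1
        obtain ⟨u, hu⟩ := h.gen b (hc.mem_augIdeal_iff.2 h1)
        exact ⟨fun j => π (u (inr j)), by rw [← hu]; exact (hdot u).symm⟩)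
    (f := fun l j => π (F l (inr j))) (fun l j => hmem (h.F_mem _ _))
    (by
      intro u
      constructor
      · intro hu
        choose v hv using fun j => mkₐ_surjective (k := k) (u j)
        have h1 : ∑ j, v j * x (inr j) ∈ I := by
          rw [← mkₐ_eq_zero_iff (k := k), ← hu, map_sum]
          exact Finset.sum_congr rfl fun j _ => by rw [map_mul, hv]
        -- A syzygy of the quotient lifts to an element of the ideal. Writing that element with
        -- coefficients in the ideal on the surviving generators corrects the lift to a true syzygy
        -- over B without changing its reduction.
        obtain ⟨c, e, he, hce⟩ := exists_eq_add_of_mem_span hc h.gen hxI hI hSX h1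
        obtain ⟨s, hs⟩ := (h.rel (Sum.elim (-c) (v - e))).1 (by
          rw [dotProduct, Fintype.sum_sum_type]
          simp only [Sum.elim_inl, Sum.elim_inr, Pi.neg_apply, Pi.sub_apply, neg_mul, sub_mul,
            Finset.sum_neg_distrib, Finset.sum_sub_distrib, hce]
          abel)
        refine ⟨fun l => π (s l), fun j => ?_⟩
        have h2 := congrArg π (congrFun hs (inr j))
        simp only [vecMul, dotProduct, map_sum, map_mul, Sum.elim_inr, Pi.sub_apply, map_sub] at h2
        rw [h2, ← hv]
        change _ = π (v j) - π (e j)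
        rw [(mkₐ_eq_zero_iff (k := k)).2 (he j), sub_zero]
      · rintro ⟨s, hs⟩
        have h1 : ∀ l, ∑ j, π (F l (inr j)) * y j = 0 := by
          intro l
          rw [← hdot, (h.rel _).2 ⟨Pi.single l 1, by rw [single_one_vecMul]; rfl⟩, map_zero]
        simp only [hs, Finset.sum_mul]
        rw [Finset.sum_comm]
        refine Finset.sum_eq_zero fun l _ => ?_
        simp only [mul_assoc, ← Finset.mul_sum, h1, mul_zero])
  have hrel : ∀ r ∈ relSpace (k := k) x, (fun i j => r (inr i) (inr j)) ∈ relSpace (k := k) y := by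
    intro r hr
    rw [mem_relSpace, sum_smul_mul_eq_dotProduct] at hr ⊢
    have h1 := hdot (fun j => ∑ i, r i j • x i)
    rw [hr, map_zero] at h1
    rw [dotProduct, h1]
    refine Finset.sum_congr rfl fun j _ => ?_
    rw [map_sum, Fintype.sum_sum_type]
    simp only [map_smul, hπx, smul_zero, Finset.sum_const_zero, zero_add, y]
  refine ⟨q, fun r hr => hq1 _ (hrel r hr), ?_, hq3⟩
  have hsp : ∃ c : α ⊕ β → α ⊕ β → k, ∀ j, ∑ i, c j i • x i = F l j := by
    have : ∀ a ∈ ℬ 1, ∃ c : α ⊕ β → k, ∑ i, c i • x i = a := by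
      intro a ha
      obtain ⟨u, hu⟩ := h.gen a (IsConnectedGraded.mem_augIdeal_of_mem le_rfl ha)
      refine ⟨fun i => hc.aug (u i), ?_⟩
      rw [← hc.proj_of_mem ha, ← hu, dotProduct, map_sum]
      exact Finset.sum_congr rfl fun i _ => (hc.proj_one_mul (hx i)).symm
    exact ⟨fun j => (this _ (h.F_mem l j)).choose, fun j => (this _ (h.F_mem l j)).choose_spec⟩
  obtain ⟨c, hc'⟩ := hsp
  refine ⟨fun i j => c j i, ?_, ?_⟩
  · rw [mem_relSpace, sum_smul_mul_eq_dotProduct, h.rel]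
    exact ⟨Pi.single l 1, by ext j; rw [single_one_vecMul]; exact (hc' j).symm⟩
  · by_contra! h0
    apply hlj
    change π _ = 0
    rw [← hc', map_sum, Fintype.sum_sum_type]
    simp [hπx, h0]

end DoubleExt
end

/-! ### Quantum planes and their Koszul resolutions. -/

noncomputable section

namespace DoubleExt

open Matrix TensorProduct

variable {k : Type u} {A : Type v} [Field k] [Ring A] [Algebra k A] {𝒜 : ℕ → Submodule k A}

/-- A graded algebra with the Hilbert series `1 / (1 - t) ^ 2`, generated by two elements of degree
one that satisfy a nondegenerate quadratic relation. -/
structure IsQuantumPlane (𝒜 : ℕ → Submodule k A) (x : Fin 2 → A) (c : Matrix (Fin 2) (Fin 2) k) :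
    Prop where
  connected : IsConnectedGraded 𝒜
  mem : ∀ i, x i ∈ 𝒜 1
  gen_left : ∀ a, connected.aug a = 0 → ∃ u : Fin 2 → A, u ⬝ᵥ x = a
  gen_right : ∀ a, connected.aug a = 0 → ∃ u : Fin 2 → A, x ⬝ᵥ u = a
  rel : ∑ i, ∑ j, c i j • (x i * x j) = 0
  det_ne_zero : c.det ≠ 0
  finrank_eq : ∀ n, Module.finrank k (𝒜 n) = n + 1

namespace IsQuantumPlane

variable {x : Fin 2 → A} {c : Matrix (Fin 2) (Fin 2) k} (h : IsQuantumPlane 𝒜 x c)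
include h

theorem finite (n : ℕ) : Module.Finite k (𝒜 n) :=
  Module.finite_of_finrank_pos (by rw [h.finrank_eq]; omega)

theorem linearIndependent : LinearIndependent k x := by
  have := h.finite 1
  have h1 : LinearIndependent k (fun i => (⟨x i, h.mem i⟩ : 𝒜 1)) := by
    apply linearIndependent_of_top_le_span_of_card_eq_finrank
    · rintro ⟨a, ha⟩ -
      obtain ⟨u, hu⟩ := h.gen_left a (h.connected.aug_of_mem le_rfl ha)
      rw [Submodule.mem_span_range_iff_exists_fun]
      refine ⟨fun i => h.connected.aug (u i), Subtype.ext ?_⟩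
      have ha' : ∑ i, h.connected.proj 1 (u i * x i) = a := by
        rw [← map_sum, ← h.connected.proj_of_mem ha, ← hu]; rfl
      refine Eq.trans ?_ ha'
      simp only [Submodule.coe_sum, Submodule.coe_smul]
      exact Finset.sum_congr rfl fun i _ => (h.connected.proj_one_mul (h.mem i)).symm
    · rw [h.finrank_eq]; rfl
  exact h1.map' (𝒜 1).subtype (Submodule.ker_subtype _)

/-- The columns of the relation. -/
theorem sum_smul_mem (d : Fin 2 → k) : ∑ i, d i • x i ∈ 𝒜 1 :=
  Submodule.sum_mem _ fun i _ => Submodule.smul_mem _ _ (h.mem i)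

theorem col_ne_zero (j : Fin 2) : ∑ i, c i j • x i ≠ 0 := by
  intro h0
  have h1 := Fintype.linearIndependent_iff.1 h.linearIndependent _ h0
  exact h.det_ne_zero (det_eq_zero_of_column_eq_zero j h1)

theorem sum_col_mul : ∑ j, (∑ i, c i j • x i) * x j = 0 := by
  rw [← h.rel, Finset.sum_comm]
  simp only [Finset.sum_mul, smul_mul_assoc]

theorem sum_mul_row : ∑ i, x i * ∑ j, c i j • x j = 0 := by
  rw [← h.rel]
  simp only [Finset.mul_sum, mul_smul_comm]

/-- A dimension count: in degree n + 1 the syzygies have dimension 2(n + 2) - (n + 3) = n + 1. The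
multiples of the relation by Aₙ already fill this, since A is a domain. -/
theorem exists_eq_mul_of_mem [IsDomain A] {n : ℕ} {u : Fin 2 → A} (hu : ∀ j, u j ∈ 𝒜 n)
    (hux : u ⬝ᵥ x = 0) : ∃ a, ∀ j, u j = a * ∑ i, c i j • x i := by
  have hfin := h.finite
  have := Module.Finite.equiv (gradedVecEquiv (Fin 2) 𝒜 n).symm
  have key := finrank_ker_inf_add
    (∑ j, LinearMap.mulRight k (x j) ∘ₗ LinearMap.proj j : (Fin 2 → A) →ₗ[k] A)
    (gradedVec (Fin 2) 𝒜 n) (𝒜 (n + 1))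
    (fun v hv => by
      simpa [dotProduct] using h.connected.dotProduct_mem h.mem hv)
    (fun w hw ⟨v, hv⟩ => ⟨fun j => h.connected.proj n (v j),
      mem_gradedVec.2 fun j => h.connected.proj_mem _ _, by
        have := h.connected.proj_dotProduct h.mem n v
        rw [← h.connected.proj_of_mem hw, ← hv]
        simpa [dotProduct] using this.symm⟩)
  have hker : ∀ v : Fin 2 → A, v ∈ LinearMap.ker
      (∑ j, LinearMap.mulRight k (x j) ∘ₗ LinearMap.proj j : (Fin 2 → A) →ₗ[k] A) ↔
      v ⬝ᵥ x = 0 := fun v => by simp [dotProduct]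
  set K := LinearMap.ker
    (∑ j, LinearMap.mulRight k (x j) ∘ₗ LinearMap.proj j : (Fin 2 → A) →ₗ[k] A)
  have hr : LinearMap.range (∑ j, LinearMap.mulRight k (x j) ∘ₗ LinearMap.proj j :
      (Fin 2 → A) →ₗ[k] A) ⊓ 𝒜 (n + 1) = 𝒜 (n + 1) := by
    refine inf_eq_right.2 fun a ha => ?_
    obtain ⟨v, hv⟩ := h.gen_left a (h.connected.aug_of_mem (by omega) ha)
    exact ⟨v, by rw [← hv]; simp [dotProduct]⟩
  rw [hr, h.finrank_eq, finrank_gradedVec, h.finrank_eq, Fintype.card_fin] at key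
  have huK : u ∈ K ⊓ gradedVec (Fin 2) 𝒜 n := ⟨(hker u).2 hux, mem_gradedVec.2 hu⟩
  have finK : Module.Finite k ↥(K ⊓ gradedVec (Fin 2) 𝒜 n) :=
    Submodule.finiteDimensional_of_le inf_le_right
  rcases n with _ | n
  · have h0 : K ⊓ gradedVec (Fin 2) 𝒜 0 = ⊥ := Submodule.finrank_eq_zero.1 (by omega)
    rw [h0, Submodule.mem_bot] at huK
    exact ⟨0, fun j => by rw [huK, zero_mul]; rfl⟩
  · let φ : A →ₗ[k] (Fin 2 → A) := LinearMap.pi fun j => LinearMap.mulRight k (∑ i, c i j • x i)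
    have hφ : Function.Injective φ := by
      rw [injective_iff_map_eq_zero]
      intro a ha
      exact (mul_eq_zero.1 (congrFun ha 0)).resolve_right (h.col_ne_zero 0)
    have hle : (𝒜 n).map φ ≤ K ⊓ gradedVec (Fin 2) 𝒜 (n + 1) := by
      rintro _ ⟨a, ha, rfl⟩
      refine ⟨(hker _).2 ?_, mem_gradedVec.2 fun j => h.connected.mul_mem ha (h.sum_smul_mem _)⟩
      simp only [φ, dotProduct, LinearMap.pi_apply, LinearMap.mulRight_apply, mul_assoc]
      rw [← Finset.mul_sum, h.sum_col_mul, mul_zero]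
    have heq := Submodule.eq_of_le_of_finrank_eq hle (by
      rw [LinearEquiv.finrank_eq (Submodule.equivMapOfInjective φ hφ (𝒜 n)).symm,
        h.finrank_eq]; omega)
    rw [← heq] at huK
    obtain ⟨a, -, ha⟩ := huK
    exact ⟨a, fun j => by rw [← ha]; rfl⟩

/-- Exactness of the Koszul complex of left modules in the middle. -/
theorem exists_eq_mul [IsDomain A] {u : Fin 2 → A} (hux : u ⬝ᵥ x = 0) :
    ∃ a, ∀ j, u j = a * ∑ i, c i j • x i := by
  have h1 : ∀ n, ∃ a, ∀ j, h.connected.proj n (u j) = a * ∑ i, c i j • x i := fun n =>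
    h.exists_eq_mul_of_mem (fun j => h.connected.proj_mem n (u j)) (by
      rw [← h.connected.proj_dotProduct h.mem, hux, map_zero])
  choose a ha using h1
  choose N hN using fun j => h.connected.exists_eq_sum_proj (u j)
  refine ⟨∑ n ∈ Finset.range (∑ j, N j), a n, fun j => ?_⟩
  rw [hN j _ (Finset.single_le_sum (fun _ _ => Nat.zero_le _) (Finset.mem_univ j)),
    Finset.sum_mul]
  exact Finset.sum_congr rfl fun n _ => ha n j

end IsQuantumPlane

section Resolution

variable (M : Type v) [AddCommGroup M] [Module k M]

variable (k) in
/-- Right multiplication on the first factor of `A ⊗ M`. -/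
def tensorRight (a : A) : A ⊗[k] M →ₗ[A] A ⊗[k] M :=
  AlgebraTensorModule.map (LinearMap.toSpanSingleton A A a) LinearMap.id

variable {M}

@[simp] theorem tensorRight_tmul (a b : A) (m : M) :
    tensorRight k M a (b ⊗ₜ m) = (b * a) ⊗ₜ m := by
  simp [tensorRight]

theorem tensorRight_eq_rTensor (a : A) (z : A ⊗[k] M) :
    tensorRight k M a z = (LinearMap.mulRight k a).rTensor M z := by
  induction z using TensorProduct.induction_on with
  | zero => simp
  | tmul b m => simp
  | add y z hy hz => simp [hy, hz]

/-- Homogeneous components with respect to the first factor. -/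
def tensorProj (hc : IsConnectedGraded 𝒜) (M : Type v) [AddCommGroup M] [Module k M] (n : ℕ) :
    A ⊗[k] M →ₗ[k] A ⊗[k] M :=
  (hc.proj n).rTensor M

section

variable (hc : IsConnectedGraded 𝒜)

@[simp] theorem tensorProj_tmul (n : ℕ) (b : A) (m : M) :
    tensorProj hc M n (b ⊗ₜ m) = hc.proj n b ⊗ₜ m := rfl

theorem exists_eq_sum_tensorProj (z : A ⊗[k] M) :
    ∃ N, ∀ n, N ≤ n → z = ∑ i ∈ Finset.range n, tensorProj hc M i z := by
  induction z using TensorProduct.induction_on with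
  | zero => exact ⟨0, fun n _ => by simp⟩
  | tmul b m =>
    obtain ⟨N, hN⟩ := hc.exists_eq_sum_proj b
    refine ⟨N, fun n hn => ?_⟩
    conv_lhs => rw [hN n hn]
    simp [TensorProduct.sum_tmul]
  | add y z hy hz =>
    obtain ⟨N, hN⟩ := hy
    obtain ⟨N', hN'⟩ := hz
    refine ⟨N + N', fun n hn => ?_⟩
    conv_lhs => rw [hN n (by omega), hN' n (by omega)]
    simp [Finset.sum_add_distrib]

theorem tensorProj_eq_zero_of_ge {z : A ⊗[k] M} :
    ∃ N, ∀ n, N ≤ n → tensorProj hc M n z = 0 := by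
  obtain ⟨N, hN⟩ := exists_eq_sum_tensorProj hc z
  refine ⟨N, fun n hn => ?_⟩
  have h1 := hN n hn
  have h2 := hN (n + 1) (by omega)
  rw [Finset.sum_range_succ, ← h1] at h2
  simpa using h2

theorem eq_zero_of_tensorProj {z : A ⊗[k] M} (hz : ∀ n, tensorProj hc M n z = 0) : z = 0 := by
  obtain ⟨N, hN⟩ := exists_eq_sum_tensorProj hc z
  rw [hN N le_rfl]
  exact Finset.sum_eq_zero fun n _ => hz n

theorem tensorProj_tensorProj (n : ℕ) (z : A ⊗[k] M) :
    tensorProj hc M n (tensorProj hc M n z) = tensorProj hc M n z := by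
  induction z using TensorProduct.induction_on with
  | zero => simp
  | tmul b m => simp [hc.proj_of_mem (hc.proj_mem n b)]
  | add y z hy hz => simp [hy, hz]

theorem tensorProj_tensorProj_of_ne {n m : ℕ} (hnm : n ≠ m) (z : A ⊗[k] M) :
    tensorProj hc M m (tensorProj hc M n z) = 0 := by
  induction z using TensorProduct.induction_on with
  | zero => simp
  | tmul b m => simp [hc.proj_of_mem_ne (hc.proj_mem n b) hnm]
  | add y z hy hz => simp [hy, hz]

theorem tensorProj_tensorRight {a : A} (ha : a ∈ 𝒜 1) (n : ℕ) (z : A ⊗[k] M) :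
    tensorProj hc M (n + 1) (tensorRight k M a z) = tensorRight k M a (tensorProj hc M n z) := by
  induction z using TensorProduct.induction_on with
  | zero => simp
  | tmul b m => simp [hc.proj_mul_right n b ha]
  | add y z hy hz => simp [hy, hz]

theorem tensorProj_zero_tensorRight {a : A} (ha : a ∈ 𝒜 1) (z : A ⊗[k] M) :
    tensorProj hc M 0 (tensorRight k M a z) = 0 := by
  induction z using TensorProduct.induction_on with
  | zero => simp
  | tmul b m => simp [hc.proj_mul_right_of_lt (n := 0) (by omega) b ha]
  | add y z hy hz => simp [hy, hz]

end

variable [Module A M] [IsScalarTower k A M]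

variable (k M) in
/-- Multiplication on the second factor of `A ⊗ M`. -/
def tensorLeft (a : A) : A ⊗[k] M →ₗ[A] A ⊗[k] M :=
  AlgebraTensorModule.map LinearMap.id (Algebra.lsmul k k M a)

variable (k M) in
/-- The action `A ⊗ M → M`. -/
def tensorAct : A ⊗[k] M →ₗ[A] M :=
  AlgebraTensorModule.lift (LinearMap.toSpanSingleton A (M →ₗ[k] M) LinearMap.id)

@[simp] theorem tensorLeft_tmul (a b : A) (m : M) :
    tensorLeft k M a (b ⊗ₜ m) = b ⊗ₜ (a • m) := by
  simp [tensorLeft]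

@[simp] theorem tensorAct_tmul (b : A) (m : M) : tensorAct k M (b ⊗ₜ m) = b • m := by
  simp [tensorAct]

theorem tensorProj_tensorLeft (hc : IsConnectedGraded 𝒜) (a : A) (n : ℕ) (z : A ⊗[k] M) :
    tensorProj hc M n (tensorLeft k M a z) = tensorLeft k M a (tensorProj hc M n z) := by
  induction z using TensorProduct.induction_on with
  | zero => simp
  | tmul b m => simp
  | add y z hy hz => simp [hy, hz]

variable (k M) in
/-- The first differential of the Koszul resolution. -/
def koszulOne (x : Fin 2 → A) : (Fin 2 → A ⊗[k] M) →ₗ[A] A ⊗[k] M :=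
  ∑ j, (tensorRight k M (x j) - tensorLeft k M (x j)) ∘ₗ LinearMap.proj j

variable (M) in
/-- The second differential of the Koszul resolution. -/
def koszulTwo (x : Fin 2 → A) (c : Matrix (Fin 2) (Fin 2) k) :
    A ⊗[k] M →ₗ[A] (Fin 2 → A ⊗[k] M) :=
  LinearMap.pi fun j => tensorRight k M (∑ i, c i j • x i) + tensorLeft k M (∑ i, c j i • x i)

theorem koszulOne_apply (x : Fin 2 → A) (u : Fin 2 → A ⊗[k] M) :
    koszulOne k M x u = ∑ j, (tensorRight k M (x j) (u j) - tensorLeft k M (x j) (u j)) := by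
  simp only [koszulOne, LinearMap.sum_apply, LinearMap.comp_apply, LinearMap.sub_apply,
    LinearMap.proj_apply]

theorem tensorAct_koszulOne (x : Fin 2 → A) (u : Fin 2 → A ⊗[k] M) :
    tensorAct k M (koszulOne k M x u) = 0 := by
  rw [koszulOne_apply, map_sum]
  refine Finset.sum_eq_zero fun j _ => ?_
  generalize u j = z
  induction z using TensorProduct.induction_on with
  | zero => simp
  | tmul b m => simp [mul_smul]
  | add y z hy hz =>
    simp only [map_add, map_sub] at *
    rw [add_sub_add_comm, hy, hz, add_zero]

theorem koszulTwo_apply (x : Fin 2 → A) (c : Matrix (Fin 2) (Fin 2) k) (w : A ⊗[k] M) (j : Fin 2) :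
    koszulTwo M x c w j =
      tensorRight k M (∑ i, c i j • x i) w + tensorLeft k M (∑ i, c j i • x i) w := by
  simp [koszulTwo]

namespace IsQuantumPlane

variable {x : Fin 2 → A} {c : Matrix (Fin 2) (Fin 2) k} (h : IsQuantumPlane 𝒜 x c)
include h

/-- The unmixed terms vanish by the relation, grouped by its last factor on the left tensor factor
and by its first factor on the right one. The mixed terms cancel because columns of c are used on
one side and rows on the other. -/
theorem koszulOne_koszulTwo (w : A ⊗[k] M) : koszulOne k M x (koszulTwo M x c w) = 0 := by
  induction w using TensorProduct.induction_on with
  | zero => simp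
  | tmul b m =>
    simp only [koszulOne_apply, koszulTwo_apply, tensorRight_tmul, tensorLeft_tmul, map_add]
    have e1 : ∑ j, (b * (∑ i, c i j • x i) * x j) ⊗ₜ[k] m = 0 := by
      rw [← TensorProduct.sum_tmul]
      simp only [mul_assoc]
      rw [← Finset.mul_sum, h.sum_col_mul, mul_zero, TensorProduct.zero_tmul]
    have e2 : ∑ j, b ⊗ₜ[k] (x j • (∑ i, c j i • x i) • m) = 0 := by
      rw [← TensorProduct.tmul_sum]
      simp only [← mul_smul]
      rw [← Finset.sum_smul, h.sum_mul_row, zero_smul, TensorProduct.tmul_zero]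
    have e3 : ∑ j, (b * x j) ⊗ₜ[k] ((∑ i, c j i • x i) • m) =
        ∑ j, (b * ∑ i, c i j • x i) ⊗ₜ[k] (x j • m) := by
      simp only [Finset.sum_smul, Finset.mul_sum, TensorProduct.tmul_sum, TensorProduct.sum_tmul,
        smul_assoc, mul_smul_comm, TensorProduct.tmul_smul, TensorProduct.smul_tmul']
      exact Finset.sum_comm
    simp only [Finset.sum_sub_distrib, Finset.sum_add_distrib, e1, e2, e3]
    abel
  | add y z hy hz => rw [map_add, map_add, hy, hz, add_zero]

-- Exactness of the Koszul complex survives tensoring with M because k is a field.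
omit [Module A M] [IsScalarTower k A M] in
theorem exists_eq_tensorRight [IsDomain A] {u : Fin 2 → A ⊗[k] M}
    (hu : ∑ j, tensorRight k M (x j) (u j) = 0) :
    ∃ w, ∀ j, u j = tensorRight k M (∑ i, c i j • x i) w := by
  let f : A →ₗ[k] A × A := (LinearMap.mulRight k (∑ i, c i 0 • x i)).prod
    (LinearMap.mulRight k (∑ i, c i 1 • x i))
  let g : A × A →ₗ[k] A := (LinearMap.mulRight k (x 0)).coprod (LinearMap.mulRight k (x 1))
  have hfg : Function.Exact f g := by
    rintro ⟨a, b⟩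
    constructor
    · intro hab
      obtain ⟨w, hw⟩ := h.exists_eq_mul (u := ![a, b]) (by
        simpa [dotProduct, Fin.sum_univ_two, g] using hab)
      exact ⟨w, Prod.ext (hw 0).symm (hw 1).symm⟩
    · rintro ⟨w, hw⟩
      rw [← hw]
      have := h.sum_col_mul
      rw [Fin.sum_univ_two] at this
      have e : w * ((∑ i, c i 0 • x i) * x 0 + (∑ i, c i 1 • x i) * x 1) = 0 := by
        rw [this, mul_zero]
      rw [mul_add, ← mul_assoc, ← mul_assoc] at e
      exact e
  have hT := Module.Flat.rTensor_exact M hfg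
  let v : (A × A) ⊗[k] M :=
    (LinearMap.inl k A A).rTensor M (u 0) + (LinearMap.inr k A A).rTensor M (u 1)
  have hv : g.rTensor M v = 0 := by
    simp only [v, map_add, ← LinearMap.rTensor_comp_apply, g, LinearMap.coprod_inl,
      LinearMap.coprod_inr]
    rw [Fin.sum_univ_two, tensorRight_eq_rTensor, tensorRight_eq_rTensor] at hu
    exact hu
  obtain ⟨w, hw⟩ := (hT v).1 hv
  have h0 := congrArg ((LinearMap.fst k A A).rTensor M) hw
  have h1 := congrArg ((LinearMap.snd k A A).rTensor M) hw
  simp only [v, map_add, ← LinearMap.rTensor_comp_apply, f, LinearMap.fst_prod,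
    LinearMap.snd_prod, LinearMap.fst_comp_inl, LinearMap.fst_comp_inr, LinearMap.snd_comp_inl,
    LinearMap.snd_comp_inr, LinearMap.rTensor_id_apply, LinearMap.rTensor_zero,
    LinearMap.zero_apply, add_zero, zero_add] at h0 h1
  refine ⟨w, Fin.forall_fin_two.2 ⟨?_, ?_⟩⟩
  · rw [tensorRight_eq_rTensor, h0]
  · rw [tensorRight_eq_rTensor, h1]

/-- In the grading by the first tensor factor, the part of the differential given by right
multiplication raises the degree and the other part preserves it. So the top component of a cycle is
a cycle for the Koszul complex tensored with M, and subtracting a boundary lowers the top degree. -/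
theorem exists_koszulTwo_eq [IsDomain A] {u : Fin 2 → A ⊗[k] M} (hu : koszulOne k M x u = 0) :
    ∃ w, koszulTwo M x c w = u := by
  have hc := h.connected
  have key : ∀ (n : ℕ) (u : Fin 2 → A ⊗[k] M), (∀ m, n ≤ m → ∀ j, tensorProj hc M m (u j) = 0) →
      koszulOne k M x u = 0 → ∃ w, koszulTwo M x c w = u := by
    intro n
    induction n with
    | zero =>
      intro u hn _
      refine ⟨0, ?_⟩
      rw [map_zero]
      ext j
      exact (eq_zero_of_tensorProj hc fun m => hn m (Nat.zero_le m) j).symm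
    | succ n ih =>
      intro u hn hu
      obtain ⟨w, hw⟩ := h.exists_eq_tensorRight (M := M)
        (u := fun j => tensorProj hc M n (u j)) (by
          have h1 := congrArg (tensorProj hc M (n + 1)) hu
          rw [koszulOne_apply, map_zero, map_sum] at h1
          rw [← h1]
          refine Finset.sum_congr rfl fun j _ => ?_
          rw [map_sub, tensorProj_tensorRight hc (h.mem j), tensorProj_tensorLeft,
            hn (n + 1) le_rfl, map_zero, sub_zero])
      rcases n with _ | n
      · refine ih u (fun m _ j => ?_) hu
        rcases m with _ | m
        · rw [← tensorProj_tensorProj, hw j, tensorProj_zero_tensorRight hc (h.sum_smul_mem _)]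
        · exact hn (m + 1) (by omega) j
      · obtain ⟨w', hw'⟩ := ih (u - koszulTwo M x c (tensorProj hc M n w)) (fun m hm j => by
          rw [Pi.sub_apply, map_sub, koszulTwo_apply, map_add, tensorProj_tensorLeft,
            tensorProj_tensorProj_of_ne hc (show n ≠ m by omega), map_zero, add_zero]
          obtain ⟨m, rfl⟩ : ∃ m', m = m' + 1 := ⟨m - 1, by omega⟩
          rw [tensorProj_tensorRight hc (h.sum_smul_mem _)]
          by_cases hmn : n = m
          · subst hmn
            rw [tensorProj_tensorProj, ← tensorProj_tensorRight hc (h.sum_smul_mem _), ← hw j,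
              tensorProj_tensorProj, sub_self]
          · rw [tensorProj_tensorProj_of_ne hc hmn, map_zero, sub_zero, hn (m + 1) (by omega)])
          (by rw [map_sub, hu, h.koszulOne_koszulTwo, sub_zero])
        exact ⟨w' + tensorProj hc M n w, by rw [map_add, hw', sub_add_cancel]⟩
  choose N hN using fun j => tensorProj_eq_zero_of_ge hc (z := u j)
  exact key (∑ j, N j) u (fun m hm j => hN j m
    ((Finset.single_le_sum (fun _ _ => Nat.zero_le _) (Finset.mem_univ j)).trans hm)) hu

theorem koszulTwo_injective [IsDomain A] : Function.Injective (koszulTwo M x c) := by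
  have hc := h.connected
  have hinj : ∀ w : A ⊗[k] M, tensorRight k M (∑ i, c i 0 • x i) w = 0 → w = 0 := by
    intro w hw
    rw [tensorRight_eq_rTensor] at hw
    refine Module.Flat.rTensor_preserves_injective_linearMap (M := M)
      (LinearMap.mulRight k (∑ i, c i 0 • x i)) (fun a b hab => ?_) (by rw [hw, map_zero])
    exact mul_right_cancel₀ (h.col_ne_zero 0) hab
  have key : ∀ (n : ℕ) (w : A ⊗[k] M), (∀ m, n ≤ m → tensorProj hc M m w = 0) →
      koszulTwo M x c w = 0 → w = 0 := by
    intro n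
    induction n with
    | zero => exact fun w hn _ => eq_zero_of_tensorProj hc fun m => hn m (Nat.zero_le m)
    | succ n ih =>
      intro w hn hw
      refine ih w (fun m hm => ?_) hw
      rcases hm.eq_or_lt with rfl | hm
      · apply hinj
        have h1 := congrArg (tensorProj hc M (n + 1)) (congrFun hw 0)
        rw [koszulTwo_apply, map_add, tensorProj_tensorRight hc (h.sum_smul_mem _),
          tensorProj_tensorLeft, hn (n + 1) le_rfl, map_zero, add_zero] at h1
        rw [h1]; exact map_zero _
      · exact hn m hm
  rw [injective_iff_map_eq_zero]
  intro w hw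
  obtain ⟨N, hN⟩ := tensorProj_eq_zero_of_ge hc (z := w)
  exact key N w hN hw

/-- Modulo the image, a generator may be moved across the tensor sign; by induction on degree so may
every element. -/
theorem tmul_sub_mem_range (a : A) (m : M) :
    a ⊗ₜ[k] m - 1 ⊗ₜ[k] (a • m) ∈ LinearMap.range (koszulOne k M x) := by
  have hc := h.connected
  have key : ∀ (n : ℕ) (a : A), a ∈ 𝒜 n → ∀ m : M,
      a ⊗ₜ[k] m - 1 ⊗ₜ[k] (a • m) ∈ LinearMap.range (koszulOne k M x) := by
    intro n
    induction n with
    | zero =>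
      intro a ha m
      obtain ⟨t, rfl⟩ := hc.mem_zero_iff.1 ha
      rw [algebraMap_smul, Algebra.algebraMap_eq_smul_one, TensorProduct.smul_tmul, sub_self]
      exact Submodule.zero_mem _
    | succ n ih =>
      intro a ha m
      obtain ⟨u, hu⟩ := h.gen_left a (hc.aug_of_mem (by omega) ha)
      have ha' : a = ∑ j, hc.proj n (u j) * x j := by
        rw [← hc.proj_of_mem ha, ← hu]; exact hc.proj_dotProduct h.mem n u
      rw [ha', TensorProduct.sum_tmul, Finset.sum_smul, TensorProduct.tmul_sum,
        ← Finset.sum_sub_distrib]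
      refine Submodule.sum_mem _ fun j _ => ?_
      have h1 := ih _ (hc.proj_mem n (u j)) (x j • m)
      rw [← mul_smul] at h1
      have h2 : (hc.proj n (u j) * x j) ⊗ₜ[k] m - hc.proj n (u j) ⊗ₜ[k] (x j • m) ∈
          LinearMap.range (koszulOne k M x) := by
        refine ⟨Pi.single j (hc.proj n (u j) ⊗ₜ m), ?_⟩
        rw [koszulOne_apply, Finset.sum_eq_single j]
        · simp
        · intro i _ hij; simp [Pi.single_eq_of_ne hij]
        · simp
      have h3 := Submodule.add_mem _ h2 h1
      rwa [sub_add_sub_cancel] at h3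
  obtain ⟨N, hN⟩ := hc.exists_eq_sum_proj a
  rw [hN N le_rfl, TensorProduct.sum_tmul, Finset.sum_smul, TensorProduct.tmul_sum,
    ← Finset.sum_sub_distrib]
  exact Submodule.sum_mem _ fun n _ => key n _ (hc.proj_mem n a) m

theorem exists_koszulOne_eq {z : A ⊗[k] M} (hz : tensorAct k M z = 0) :
    ∃ u, koszulOne k M x u = z := by
  have : ∀ z : A ⊗[k] M, z - 1 ⊗ₜ[k] tensorAct k M z ∈ LinearMap.range (koszulOne k M x) := by
    intro z
    induction z using TensorProduct.induction_on with
    | zero => simp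
    | tmul b m => simpa using h.tmul_sub_mem_range b m
    | add y z hy hz =>
      have := Submodule.add_mem _ hy hz
      rwa [← add_sub_add_comm, ← TensorProduct.tmul_add, ← map_add] at this
  simpa [hz] using this z

-- The resolution is the Koszul bimodule resolution of A tensored with M; its terms are sums of
-- copies of A ⊗ M, free over A because M is free over k.
omit [Module k M] [IsScalarTower k A M] in
theorem hasProjectiveDimensionLE [IsDomain A] : HasProjectiveDimensionLE (ModuleCat.of A M) 2 := by
  let _ : Module k M := Module.compHom M (algebraMap k A)
  have : IsScalarTower k A M := ⟨fun t a m => by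
    rw [Algebra.smul_def, mul_smul]; rfl⟩
  let ε : A ⊗[k] M →ₗ[A] M := tensorAct k M
  let d : (Fin 2 → A ⊗[k] M) →ₗ[A] LinearMap.ker ε :=
    LinearMap.codRestrict _ (koszulOne k M x) fun u => tensorAct_koszulOne x u
  have hε : Function.Surjective ε := fun m => ⟨1 ⊗ₜ m, by rw [tensorAct_tmul, one_smul]⟩
  have h1 := shortExact_of_exact (A := A) (K := LinearMap.ker ε) (F := A ⊗[k] M) (M := M)
    (i := (LinearMap.ker ε).subtype) (p := ε)
    (LinearMap.ker ε).injective_subtype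
    (LinearMap.exact_subtype_ker_map ε) hε
  have h2 := shortExact_of_exact (A := A) (K := A ⊗[k] M) (F := Fin 2 → A ⊗[k] M)
    (M := LinearMap.ker ε) (i := koszulTwo M x c) (p := d) h.koszulTwo_injective
    (fun u => ⟨fun hu => h.exists_koszulTwo_eq (congrArg Subtype.val hu), by
      rintro ⟨w, rfl⟩
      exact Subtype.ext (h.koszulOne_koszulTwo w)⟩)
    (fun ⟨z, hz⟩ => by
      obtain ⟨u, hu⟩ := h.exists_koszulOne_eq hz
      exact ⟨u, Subtype.ext hu⟩)
  have p1 : Projective (ModuleCat.of A (A ⊗[k] M)) :=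
    (IsProjective.iff_projective _).1 inferInstance
  have p2 : Projective (ModuleCat.of A (Fin 2 → A ⊗[k] M)) :=
    (IsProjective.iff_projective _).1 inferInstance
  have q1 := h2.hasProjectiveDimensionLT_X₃ 1
    (hasProjectiveDimensionLT_of_ge (ModuleCat.of A (A ⊗[k] M)) 1 1 le_rfl)
    (hasProjectiveDimensionLT_of_ge (ModuleCat.of A (Fin 2 → A ⊗[k] M)) 1 2 (by norm_num))
  exact h1.hasProjectiveDimensionLT_X₃ 2 q1
    (hasProjectiveDimensionLT_of_ge (ModuleCat.of A (A ⊗[k] M)) 1 3 (by norm_num))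

end IsQuantumPlane

end Resolution

end DoubleExt
end

/-! ### Regularity of quantum planes. -/

noncomputable section

namespace DoubleExt

open Matrix MulOpposite Abelian

variable {k : Type u} {A : Type v} [Field k] [Ring A] [Algebra k A] {𝒜 : ℕ → Submodule k A}

theorem mem_opGrading {n : ℕ} {a : Aᵐᵒᵖ} : a ∈ opGrading 𝒜 n ↔ unop a ∈ 𝒜 n := by
  constructor
  · rintro ⟨b, hb, rfl⟩; exact hb
  · intro h; exact ⟨_, h, rfl⟩

theorem IsConnectedGraded.op (h : IsConnectedGraded 𝒜) : IsConnectedGraded (opGrading 𝒜) where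
  nontrivial := have := h.nontrivial; inferInstance
  gradedMonoid :=
    { one_mem := mem_opGrading.2 h.one_mem
      mul_mem := fun i j a b ha hb => by
        rw [mem_opGrading] at *
        rw [unop_mul, add_comm]
        exact h.mul_mem hb ha }
  isInternal := by
    have h1 := (DirectSum.isInternal_submodule_iff_iSupIndep_and_iSup_eq_top 𝒜).1 h.isInternal
    refine (DirectSum.isInternal_submodule_iff_iSupIndep_and_iSup_eq_top _).2 ⟨?_, ?_⟩
    · exact h1.1.map_orderIso (Submodule.orderIsoMapComap (opLinearEquiv k : A ≃ₗ[k] Aᵐᵒᵖ))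
    · change ⨆ n, (𝒜 n).map (opLinearEquiv k : A ≃ₗ[k] Aᵐᵒᵖ).toLinearMap = ⊤
      rw [← Submodule.map_iSup, h1.2, Submodule.map_top]
      exact LinearEquiv.range _
  zero_eq := by
    ext a
    rw [mem_opGrading, h.zero_eq, Submodule.mem_one, Submodule.mem_one]
    exact exists_congr fun t => ⟨fun ht => unop_injective (by rw [← ht]; rfl),
      fun ht => by rw [← ht]; rfl⟩

theorem IsConnectedGraded.aug_op (h : IsConnectedGraded 𝒜) (a : A) :
    h.op.aug (MulOpposite.op a) = h.aug a := by
  apply h.op.algebraMap_injective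
  rw [h.op.algebraMap_aug]
  refine (h.proj_map h.op (opLinearEquiv k : A ≃ₗ[k] Aᵐᵒᵖ).toLinearMap
    (fun n b hb => mem_opGrading.2 hb) 0 a).trans ?_
  rw [← h.algebraMap_aug]
  rfl

theorem finrank_opGrading (n : ℕ) :
    Module.finrank k (opGrading 𝒜 n) = Module.finrank k (𝒜 n) :=
  LinearEquiv.finrank_map_eq (opLinearEquiv k : A ≃ₗ[k] Aᵐᵒᵖ) (𝒜 n)

/-- The `k`-linear combinations of module elements with a nonsingular matrix of coefficients. -/
theorem exists_sum_smul_eq {M : Type*} [AddCommGroup M] [Module k M] {ι : Type*} [Fintype ι]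
    [DecidableEq ι] {c : Matrix ι ι k} (hc : c.det ≠ 0) (u : ι → M) :
    ∃ v : ι → M, ∀ i, ∑ j, c i j • v j = u i := by
  refine ⟨fun j => ∑ l, c⁻¹ j l • u l, fun i => ?_⟩
  simp only [Finset.smul_sum, smul_smul]
  rw [Finset.sum_comm]
  simp only [← Finset.sum_smul, ← mul_apply, mul_nonsing_inv c (IsUnit.mk0 _ hc), one_apply,
    ite_smul, one_smul, zero_smul, Finset.sum_ite_eq, Finset.mem_univ, if_true]

theorem eq_zero_of_sum_smul_eq_zero {M : Type*} [AddCommGroup M] [Module k M] {ι : Type*}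
    [Fintype ι] [DecidableEq ι] {c : Matrix ι ι k} (hc : c.det ≠ 0) {v : ι → M}
    (hv : ∀ i, ∑ j, c i j • v j = 0) : v = 0 := by
  ext l
  have h1 : ∑ i, c⁻¹ l i • ∑ j, c i j • v j = v l := by
    simp only [Finset.smul_sum, smul_smul]
    rw [Finset.sum_comm]
    simp only [← Finset.sum_smul, ← mul_apply, nonsing_inv_mul c (IsUnit.mk0 _ hc), one_apply,
      ite_smul, one_smul, zero_smul, Finset.sum_ite_eq, Finset.mem_univ, if_true]
  rw [← h1]
  simp [hv]

namespace IsQuantumPlane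

variable {x : Fin 2 → A} {c : Matrix (Fin 2) (Fin 2) k} (h : IsQuantumPlane 𝒜 x c)
include h

theorem op : IsQuantumPlane (opGrading 𝒜) (fun i => MulOpposite.op (x i)) cᵀ where
  connected := h.connected.op
  mem i := mem_opGrading.2 (h.mem i)
  gen_left a ha := by
    obtain ⟨b, rfl⟩ := op_surjective a
    obtain ⟨u, hu⟩ := h.gen_right b (by rwa [h.connected.aug_op] at ha)
    exact ⟨fun i => MulOpposite.op (u i), by rw [← hu]; simp [dotProduct]⟩
  gen_right a ha := by
    obtain ⟨b, rfl⟩ := op_surjective a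
    obtain ⟨u, hu⟩ := h.gen_left b (by rwa [h.connected.aug_op] at ha)
    exact ⟨fun i => MulOpposite.op (u i), by rw [← hu]; simp [dotProduct]⟩
  rel := by
    rw [Finset.sum_comm]
    have := congrArg MulOpposite.op h.rel
    simpa using this
  det_ne_zero := by rw [det_transpose]; exact h.det_ne_zero
  finrank_eq n := by rw [finrank_opGrading, h.finrank_eq]

theorem range_eq_augIdeal :
    Set.range (fun v : Fin 2 → A => ∑ i, v i * x i) = (augIdeal 𝒜 : Set A) := by
  ext a
  constructor
  · rintro ⟨v, rfl⟩
    exact Submodule.sum_mem _ fun j _ => Submodule.smul_mem _ (v j)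
      (IsConnectedGraded.mem_augIdeal_of_mem le_rfl (h.mem j))
  · intro ha
    exact h.gen_left a (h.connected.mem_augIdeal_iff.1 ha)

theorem exists_sum_col_mul {b : A} (hb : h.connected.aug b = 0) :
    ∃ v : Fin 2 → A, ∑ j, (∑ i, c i j • x i) * v j = b := by
  obtain ⟨u, hu⟩ := h.gen_right b hb
  obtain ⟨v, hv⟩ := exists_sum_smul_eq h.det_ne_zero u
  refine ⟨v, ?_⟩
  simp only [← hu, dotProduct, ← hv, Finset.sum_mul, Finset.mul_sum, smul_mul_assoc,
    mul_smul_comm]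
  exact Finset.sum_comm

/-- Exactness of the Koszul complex of right modules in the middle. -/
theorem exists_eq_mul' [IsDomain A] {v : Fin 2 → A}
    (hv : ∑ j, (∑ i, c i j • x i) * v j = 0) : ∃ a, ∀ j, v j = x j * a := by
  obtain ⟨a, ha⟩ := h.op.exists_eq_mul (u := fun i => MulOpposite.op (∑ j, c i j • v j)) (by
    apply unop_injective
    rw [unop_zero, ← hv, dotProduct, Finset.unop_sum]
    simp only [unop_mul, unop_op, Finset.sum_mul, Finset.mul_sum, smul_mul_assoc,
      mul_smul_comm]
    exact Finset.sum_comm)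
  refine ⟨unop a, fun j => ?_⟩
  rw [← sub_eq_zero]
  refine congrFun (eq_zero_of_sum_smul_eq_zero h.det_ne_zero
    (v := fun j => v j - x j * unop a) fun i => ?_) j
  have h1 := congrArg unop (ha i)
  simp only [unop_op, transpose_apply, unop_mul] at h1
  simp only [smul_sub, Finset.sum_sub_distrib, h1]
  rw [Finset.unop_sum, Finset.sum_mul]
  simp only [unop_smul, unop_op, smul_mul_assoc, sub_self]

/-- The second syzygy of k is A itself, embedded by the columns of c. So Ext² is A modulo the right
ideal generated by these columns, which is the augmentation ideal as c is invertible. Ext¹ vanishes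
by exactness of the Koszul complex of right modules, Ext⁰ because A is a domain. -/
theorem isLeftGorenstein [IsDomain A] : IsLeftGorenstein 𝒜 2 := by
  have hc := h.connected
  let i : A →ₗ[A] (Fin 2 → A) := LinearMap.pi fun j => LinearMap.toSpanSingleton A A
    (∑ i, c i j • x i)
  have hi : Function.Injective i := by
    rw [injective_iff_map_eq_zero]
    intro a ha
    exact (mul_eq_zero.1 (congrFun ha 0)).resolve_right (h.col_ne_zero 0)
  have hex : Function.Exact i (toAugIdeal h.range_eq_augIdeal) := by
    intro u
    rw [toAugIdeal_eq_zero_iff]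
    constructor
    · intro hu
      obtain ⟨a, ha⟩ := h.exists_eq_mul hu
      exact ⟨a, funext fun j => (ha j).symm⟩
    · rintro ⟨a, rfl⟩
      have : a * ∑ j, (∑ i, c i j • x i) * x j = 0 := by rw [h.sum_col_mul, mul_zero]
      rw [Finset.mul_sum] at this
      simp only [← mul_assoc] at this
      exact this
  obtain ⟨α₁, hα₁⟩ := exists_isSyzygyClass_one hi hex (toAugIdeal_surjective h.range_eq_augIdeal)
  obtain ⟨α, hα⟩ := hα₁.shift le_rfl (augIdeal 𝒜).injective_subtype (exact_augIdeal 𝒜)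
    (augIdeal 𝒜).mkQ_surjective
  obtain ⟨β, hβ⟩ := exists_isSyzygyClass_one (augIdeal 𝒜).injective_subtype (exact_augIdeal 𝒜)
    (augIdeal 𝒜).mkQ_surjective
  let cls (g : A →ₗ[A] A) : Ext.{v} (trivialModule 𝒜) (ModuleCat.of A A) 2 :=
    α.comp (Ext.mk₀ (ModuleCat.ofHom g)) (add_zero 2)
  have cls_zero : ∀ g, cls g = 0 ↔ hc.aug (g 1) = 0 := by
    intro g
    refine ((hα A).1 g).trans ⟨?_, fun hg => ?_⟩
    · rintro ⟨f, rfl⟩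
      rw [LinearMap.comp_apply, exists_eq_rowSum f, map_sum]
      refine Finset.sum_eq_zero fun j _ => ?_
      rw [map_mul]
      have : i 1 j = ∑ i, c i j • x i := one_mul _
      rw [this, hc.aug_of_mem le_rfl (h.sum_smul_mem _), zero_mul]
    · obtain ⟨v, hv⟩ := h.exists_sum_col_mul hg
      refine ⟨rowSum v, LinearMap.ext_ring ?_⟩
      rw [← hv, LinearMap.comp_apply, rowSum_apply]
      refine Finset.sum_congr rfl fun j _ => ?_
      have : i 1 j = ∑ i, c i j • x i := one_mul _
      rw [this]
  have cls_surj : ∀ e, ∃ g, cls g = e := (hα A).2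
  have cls_lin : ∀ (s t : k) (g h : A →ₗ[A] A), cls (s • g + t • h) = s • cls g + t • cls h :=
    fun s t g h => IsSyzygyClass.comp_smul_add (F := Fin 2 → A) α s t g h
  refine ⟨fun n hn => ?_, ?_, ?_⟩
  · rcases n with _ | _ | _ | n
    · suffices ∀ f : A ⧸ augIdeal 𝒜 →ₗ[A] A, f = 0 by
        refine Ext.homEquiv₀.subsingleton_congr.2 ⟨fun f g => ?_⟩
        ext1
        exact (this f.hom).trans (this g.hom).symm
      intro f
      have h1 : x 0 * f ((augIdeal 𝒜).mkQ 1) = 0 := by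
        rw [← smul_eq_mul, ← map_smul, ← map_smul]
        have : (augIdeal 𝒜).mkQ (x 0 • (1 : A)) = 0 := by
          rw [Submodule.mkQ_apply, Submodule.Quotient.mk_eq_zero, smul_eq_mul, mul_one]
          exact IsConnectedGraded.mem_augIdeal_of_mem le_rfl (h.mem 0)
        rw [this, map_zero]
      have h2 := (mul_eq_zero.1 h1).resolve_left (h.linearIndependent.ne_zero 0)
      refine LinearMap.ext fun z => ?_
      obtain ⟨a, rfl⟩ := (augIdeal 𝒜).mkQ_surjective z
      rw [show a = a • (1 : A) by simp, map_smul, map_smul, h2, smul_zero]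
      rfl
    · refine subsingleton_of_forall_eq 0 fun e => ?_
      obtain ⟨g, rfl⟩ := (hβ A).2 e
      refine ((hβ A).1 g).2 ?_
      let X : Fin 2 → augIdeal 𝒜 := fun j =>
        ⟨x j, IsConnectedGraded.mem_augIdeal_of_mem le_rfl (h.mem j)⟩
      have hX : ∀ u : Fin 2 → A, ((∑ j, u j • X j : augIdeal 𝒜) : A) = ∑ j, u j * x j := by
        intro u; simp [X]
      obtain ⟨b, hb⟩ := h.exists_eq_mul' (v := fun j => g (X j)) (by
        have : ∑ j, (∑ i, c i j • x i) • X j = 0 := by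
          ext; rw [hX, h.sum_col_mul]; rfl
        simpa using congrArg g this)
      refine ⟨LinearMap.toSpanSingleton A A b, LinearMap.ext fun a => ?_⟩
      obtain ⟨u, hu⟩ := h.gen_left a (hc.mem_augIdeal_iff.1 a.2)
      have hau : a = ∑ j, u j • X j := Subtype.ext (by rw [hX, ← hu]; rfl)
      rw [hau, map_sum, map_sum]
      refine Finset.sum_congr rfl fun j _ => ?_
      rw [map_smul, map_smul, hb]
      rfl
    · exact absurd rfl hn
    · have : HasProjectiveDimensionLT (trivialModule 𝒜) 3 :=
        h.hasProjectiveDimensionLE (M := A ⧸ augIdeal 𝒜)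
      exact HasProjectiveDimensionLT.subsingleton (trivialModule 𝒜) 3 (n + 1 + 1 + 1) (by omega) _
  · refine finrank_eq_one_iff'.2 ⟨cls LinearMap.id, ?_, fun e => ?_⟩
    · rw [Ne, cls_zero, LinearMap.id_apply, map_one]
      exact one_ne_zero
    · obtain ⟨g, rfl⟩ := cls_surj e
      refine ⟨hc.aug (g 1), ?_⟩
      have h1 : cls ((1 : k) • g + (-hc.aug (g 1)) • LinearMap.id) = 0 := by
        rw [cls_zero]; simp
      rw [cls_lin, one_smul, neg_smul, add_neg_eq_zero] at h1
      exact h1.symm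
  · intro n hn a ha e
    obtain ⟨g, rfl⟩ := cls_surj e
    refine (extClass_comp_comp α g (LinearMap.toSpanSingleton A A a)).trans ?_
    refine (cls_zero _).2 ?_
    rw [LinearMap.comp_apply, LinearMap.toSpanSingleton_apply, smul_eq_mul, map_mul,
      hc.aug_of_mem hn ha, mul_zero]

/-- The bound two is attained because Ext²(k, A) is nonzero. -/
theorem hasLeftGlobalDimension [IsDomain A] : HasLeftGlobalDimension A 2 := by
  refine ⟨fun M => h.hasProjectiveDimensionLE (M := M), fun n hn => ?_⟩
  by_contra! hlt
  have h1 := hn (trivialModule 𝒜)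
  have h1 : HasProjectiveDimensionLT (trivialModule 𝒜) (n + 1) := h1
  have h2 : Subsingleton (Ext.{v} (trivialModule 𝒜) (ModuleCat.of A A) 2) :=
    HasProjectiveDimensionLT.subsingleton (trivialModule 𝒜) (n + 1) 2 (by omega) _
  have h3 := h.isLeftGorenstein.finrank_ext
  rw [Module.finrank_zero_of_subsingleton] at h3
  exact zero_ne_one h3

theorem isASRegular [IsDomain A] : IsASRegular 𝒜 2 where
  connected := h.connected
  gldim_left := h.hasLeftGlobalDimension
  gldim_right := h.op.hasLeftGlobalDimension
  gorenstein_left := h.isLeftGorenstein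
  gorenstein_right := h.op.isLeftGorenstein
  growth := ⟨3, fun n hn => ⟨h.finite n, by
    rw [h.finrank_eq]
    nlinarith [Nat.one_le_pow 3 n hn, Nat.le_self_pow (show 3 ≠ 0 by norm_num) n]⟩⟩

end IsQuantumPlane

end DoubleExt
end

/-! ### Frames and the basis of ordered monomials. -/

noncomputable section

namespace DoubleExt

open MulOpposite

variable {k : Type u} {B : Type v} [Field k] [Ring B] [Algebra k B] {ℬ : ℕ → Submodule k B}

/-- The ordered monomials in two elements. -/
def orderedMonomial (x : Fin 2 → B) (a : ℕ × ℕ) : B := x 0 ^ a.1 * x 1 ^ a.2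

/-- The ordered monomials in four elements. -/
def orderedMonomial₂ (x y : Fin 2 → B) (i : (ℕ × ℕ) × (ℕ × ℕ)) : B :=
  orderedMonomial x i.1 * orderedMonomial y i.2

/-- The degree of an ordered monomial in four elements. -/
def monomialDegree (i : (ℕ × ℕ) × (ℕ × ℕ)) : ℕ := i.1.1 + i.1.2 + (i.2.1 + i.2.2)

/-- Presentations of a graded algebra by four generators of degree one that lead to an iterated
double extension. -/
structure IsFrame (ℬ : ℕ → Submodule k B) (x y : Fin 2 → B) (p q p₁₂ p₁₁ : k) : Prop where
  connected : IsConnectedGraded ℬ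
  span_eq : Submodule.span k (Set.range x) ⊔ Submodule.span k (Set.range y) = ℬ 1
  pow_eq : ∀ n, ℬ n = ℬ 1 ^ n
  mul_comm : Submodule.span k (Set.range x) * ℬ 1 = ℬ 1 * Submodule.span k (Set.range x)
  rel_x : x 1 * x 0 = p • (x 0 * x 1) + q • (x 0 * x 0)
  p_ne_zero : p ≠ 0
  rel_y : y 1 * y 0 - p₁₂ • (y 0 * y 1) - p₁₁ • (y 0 * y 0) ∈
    Submodule.span k (Set.range x) * ℬ 1
  p₁₂_ne_zero : p₁₂ ≠ 0
  finrank_eq : ∀ n, 6 * Module.finrank k (ℬ n) = (n + 1) * (n + 2) * (n + 3)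

/-- The span of the ordered monomials of a given degree. -/
def monomialSpan (k : Type u) {B : Type v} [Field k] [Ring B] [Algebra k B] (x y : Fin 2 → B)
    (n : ℕ) : Submodule k B :=
  Submodule.span k (orderedMonomial₂ x y '' {i | monomialDegree i = n})

theorem orderedMonomial₂_mem_monomialSpan {x y : Fin 2 → B} {n : ℕ} {i : (ℕ × ℕ) × (ℕ × ℕ)}
    (hi : monomialDegree i = n) : orderedMonomial₂ x y i ∈ monomialSpan k x y n :=
  Submodule.subset_span ⟨i, hi, rfl⟩

theorem mul_mem_of_forall_orderedMonomial₂ {x y : Fin 2 → B} {n : ℕ} {S : Submodule k B} {b : B}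
    (h : ∀ i, monomialDegree i = n → b * orderedMonomial₂ x y i ∈ S) {t : B}
    (ht : t ∈ monomialSpan k x y n) : b * t ∈ S := by
  suffices monomialSpan k x y n ≤ S.comap (LinearMap.mulLeft k b) from this ht
  refine Submodule.span_le.2 ?_
  rintro _ ⟨i, hi, rfl⟩
  exact h i hi

theorem mul_pow_of_rel {x : Fin 2 → B} {p q : k}
    (h : x 1 * x 0 = p • (x 0 * x 1) + q • (x 0 * x 0)) (a : ℕ) :
    ∃ s t : k, x 1 * x 0 ^ a = s • (x 0 ^ a * x 1) + t • x 0 ^ (a + 1) := by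
  induction a with
  | zero => exact ⟨1, 0, by simp⟩
  | succ a ih =>
    obtain ⟨s, t, hst⟩ := ih
    refine ⟨s * p, s * q + t, ?_⟩
    rw [pow_succ, ← mul_assoc, hst, add_mul, smul_mul_assoc, mul_assoc, h, smul_mul_assoc,
      ← pow_succ]
    simp only [mul_add, mul_smul_comm, smul_add, smul_smul, pow_succ, mul_assoc, add_smul]
    abel

/-- The monomials of a given degree. -/
def monomialFinset (n : ℕ) : Finset ((ℕ × ℕ) × (ℕ × ℕ)) :=
  (Finset.HasAntidiagonal.antidiagonal n).biUnion fun a =>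
    Finset.HasAntidiagonal.antidiagonal a.1 ×ˢ Finset.HasAntidiagonal.antidiagonal a.2

theorem mem_monomialFinset {n : ℕ} {i : (ℕ × ℕ) × (ℕ × ℕ)} :
    i ∈ monomialFinset n ↔ monomialDegree i = n := by
  simp only [monomialFinset, Finset.mem_biUnion, Finset.HasAntidiagonal.mem_antidiagonal,
    Finset.mem_product, monomialDegree, Prod.exists]
  constructor
  · rintro ⟨a, b, h1, h2, h3⟩; omega
  · intro h; exact ⟨_, _, h, rfl, rfl⟩

theorem six_mul_card_monomialFinset (n : ℕ) :
    6 * (monomialFinset n).card = (n + 1) * (n + 2) * (n + 3) := by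
  rw [monomialFinset, Finset.card_biUnion, Finset.Nat.sum_antidiagonal_eq_sum_range_succ_mk]
  · simp only [Finset.card_product, Finset.Nat.card_antidiagonal]
    have key : ∀ m, m ≤ n + 1 → ((6 * ∑ i ∈ Finset.range m, (i + 1) * (n - i + 1) : ℕ) : ℤ) =
        m * (m + 1) * (3 * (n + 1) - 2 * (m - 1)) := by
      intro m
      induction m with
      | zero => simp
      | succ m ih =>
        intro hm
        have := ih (by omega)
        rw [Finset.sum_range_succ, mul_add]
        push_cast [Nat.cast_sub (show m ≤ n by omega)] at this ⊢
        rw [this]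
        ring
    have := key (n + 1) le_rfl
    zify
    push_cast at this
    rw [this]
    ring
  · rintro ⟨a, b⟩ - ⟨c, d⟩ - hne
    refine Finset.disjoint_left.2 ?_
    rintro ⟨⟨i, j⟩, ⟨l, m⟩⟩ h1 h2
    simp only [Finset.mem_product, Finset.HasAntidiagonal.mem_antidiagonal] at h1 h2
    exact hne (by rw [← h1.1, ← h1.2, h2.1, h2.2])

namespace IsFrame

variable {x y : Fin 2 → B} {p q p₁₂ p₁₁ : k} (h : IsFrame ℬ x y p q p₁₂ p₁₁)
include h

theorem x_mem (i : Fin 2) : x i ∈ ℬ 1 :=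
  h.span_eq ▸ Submodule.mem_sup_left (Submodule.subset_span ⟨i, rfl⟩)

theorem y_mem (i : Fin 2) : y i ∈ ℬ 1 :=
  h.span_eq ▸ Submodule.mem_sup_right (Submodule.subset_span ⟨i, rfl⟩)

theorem orderedMonomial_mem {n : ℕ} {a : ℕ × ℕ} (ha : a.1 + a.2 = n) :
    orderedMonomial x a ∈ ℬ n := by
  have h1 := h.connected.mul_mem (h.connected.pow_mem (h.x_mem 0) a.1)
    (h.connected.pow_mem (h.x_mem 1) a.2)
  rwa [mul_one, mul_one, ha] at h1

theorem orderedMonomial_mem' {n : ℕ} {a : ℕ × ℕ} (ha : a.1 + a.2 = n) :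
    orderedMonomial y a ∈ ℬ n := by
  have h1 := h.connected.mul_mem (h.connected.pow_mem (h.y_mem 0) a.1)
    (h.connected.pow_mem (h.y_mem 1) a.2)
  rwa [mul_one, mul_one, ha] at h1

theorem orderedMonomial₂_mem {n : ℕ} {i : (ℕ × ℕ) × (ℕ × ℕ)} (hi : monomialDegree i = n) :
    orderedMonomial₂ x y i ∈ ℬ n := by
  rw [← hi]
  exact h.connected.mul_mem (h.orderedMonomial_mem rfl) (h.orderedMonomial_mem' rfl)

theorem x_mul_mem {n : ℕ} {a t : B} (ha : a ∈ Submodule.span k (Set.range x))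
    (ht : t ∈ monomialSpan k x y n) : a * t ∈ monomialSpan k x y (n + 1) := by
  suffices Submodule.span k (Set.range x) ≤
      (monomialSpan k x y (n + 1)).comap (LinearMap.mulRight k t) from this ha
  refine Submodule.span_le.2 ?_
  rintro _ ⟨j, rfl⟩
  change x j * t ∈ monomialSpan k x y (n + 1)
  refine mul_mem_of_forall_orderedMonomial₂ (fun i hi => ?_) ht
  obtain ⟨⟨a, b⟩, c⟩ := i
  simp only [monomialDegree] at hi
  match j with
  | 0 =>
    have : x 0 * orderedMonomial₂ x y ((a, b), c) = orderedMonomial₂ x y ((a + 1, b), c) := by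
      simp only [orderedMonomial₂, orderedMonomial, pow_succ', mul_assoc]
    rw [this]
    exact orderedMonomial₂_mem_monomialSpan (by simp only [monomialDegree]; omega)
  | 1 =>
    obtain ⟨s, t, hst⟩ := mul_pow_of_rel h.rel_x a
    have : x 1 * orderedMonomial₂ x y ((a, b), c) = s • orderedMonomial₂ x y ((a, b + 1), c) +
        t • orderedMonomial₂ x y ((a + 1, b), c) := by
      simp only [orderedMonomial₂, orderedMonomial]
      rw [mul_assoc (x 0 ^ a), ← mul_assoc (x 1), hst]
      simp only [add_mul, smul_mul_assoc, pow_succ' _ b, mul_assoc]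
    rw [this]
    exact Submodule.add_mem _
      (Submodule.smul_mem _ _ (orderedMonomial₂_mem_monomialSpan
        (by simp only [monomialDegree]; omega)))
      (Submodule.smul_mem _ _ (orderedMonomial₂_mem_monomialSpan
        (by simp only [monomialDegree]; omega)))

/-- Rewriting by induction on the degree. A product y x lies in VX = XV, and y₁y₀ is a combination
of y₀y₁ and y₀² plus an element of XV. In either case an element of XV acts on a shorter monomial: V
by the induction hypothesis, X by direct reordering. -/
theorem mul_mem_monomialSpan (n : ℕ) {b t : B} (hb : b ∈ ℬ 1) (ht : t ∈ monomialSpan k x y n) :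
    b * t ∈ monomialSpan k x y (n + 1) := by
  -- The equation n = m + 1 inside the hypothesis makes it void for n = 0, so one statement serves
  -- both as base and as induction step.
  have step : ∀ (n : ℕ), (∀ m, n = m + 1 → ∀ b ∈ ℬ 1, ∀ t ∈ monomialSpan k x y m,
      b * t ∈ monomialSpan k x y n) → ∀ b ∈ ℬ 1, ∀ t ∈ monomialSpan k x y n,
      b * t ∈ monomialSpan k x y (n + 1) := by
    intro n ih
    have hxv : ∀ m, n = m + 1 → ∀ z ∈ Submodule.span k (Set.range x) * ℬ 1,
        ∀ t ∈ monomialSpan k x y m, z * t ∈ monomialSpan k x y (n + 1) := by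
      intro m hm z hz t ht
      induction hz using Submodule.mul_induction_on' with
      | mem_mul_mem a ha b hb =>
        rw [mul_assoc]
        exact h.x_mul_mem ha (ih m hm b hb t ht)
      | add a _ b _ ha hb => rw [add_mul]; exact Submodule.add_mem _ ha hb
    have hbx : ∀ m, n = m + 1 → ∀ b ∈ ℬ 1, ∀ j, ∀ t ∈ monomialSpan k x y m,
        b * (x j * t) ∈ monomialSpan k x y (n + 1) := by
      intro m hm b hb j t ht
      rw [← mul_assoc]
      refine hxv m hm _ ?_ t ht
      rw [h.mul_comm]
      exact Submodule.mul_mem_mul hb (Submodule.subset_span ⟨j, rfl⟩)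
    have red : ∀ b ∈ ℬ 1, (∀ c d, c + d = n →
        b * orderedMonomial₂ x y ((0, 0), (c, d)) ∈ monomialSpan k x y (n + 1)) →
        ∀ t ∈ monomialSpan k x y n, b * t ∈ monomialSpan k x y (n + 1) := by
      intro b hb hcd t ht
      refine mul_mem_of_forall_orderedMonomial₂ (fun i hi => ?_) ht
      obtain ⟨⟨a, e⟩, ⟨c, d⟩⟩ := i
      simp only [monomialDegree] at hi
      rcases a with _ | a
      · rcases e with _ | e
        · exact hcd c d (by omega)
        · have : orderedMonomial₂ x y ((0, e + 1), (c, d)) =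
              x 1 * orderedMonomial₂ x y ((0, e), (c, d)) := by
            simp only [orderedMonomial₂, orderedMonomial, pow_succ', mul_assoc, pow_zero, one_mul]
          rw [this]
          exact hbx (e + (c + d)) (by omega) b hb 1 _
            (orderedMonomial₂_mem_monomialSpan (by simp only [monomialDegree]; omega))
      · have : orderedMonomial₂ x y ((a + 1, e), (c, d)) =
            x 0 * orderedMonomial₂ x y ((a, e), (c, d)) := by
          simp only [orderedMonomial₂, orderedMonomial, pow_succ', mul_assoc]
        rw [this]
        exact hbx (a + e + (c + d)) (by omega) b hb 0 _
          (orderedMonomial₂_mem_monomialSpan (by simp only [monomialDegree]))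
    have hy0 : ∀ t ∈ monomialSpan k x y n, y 0 * t ∈ monomialSpan k x y (n + 1) := by
      refine red _ (h.y_mem 0) fun c d hcd => ?_
      have : y 0 * orderedMonomial₂ x y ((0, 0), (c, d)) =
          orderedMonomial₂ x y ((0, 0), (c + 1, d)) := by
        simp only [orderedMonomial₂, orderedMonomial, pow_succ', mul_assoc, pow_zero, one_mul]
      rw [this]
      exact orderedMonomial₂_mem_monomialSpan (by simp only [monomialDegree]; omega)
    have hy1 : ∀ t ∈ monomialSpan k x y n, y 1 * t ∈ monomialSpan k x y (n + 1) := by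
      refine red _ (h.y_mem 1) fun c d hcd => ?_
      rcases c with _ | c
      · have : y 1 * orderedMonomial₂ x y ((0, 0), (0, d)) =
            orderedMonomial₂ x y ((0, 0), (0, d + 1)) := by
          simp only [orderedMonomial₂, orderedMonomial, pow_succ', pow_zero, one_mul]
        rw [this]
        exact orderedMonomial₂_mem_monomialSpan (by simp only [monomialDegree]; omega)
      · set m := orderedMonomial₂ x y ((0, 0), (c, d)) with hm
        have hmem : m ∈ monomialSpan k x y (c + d) :=
          orderedMonomial₂_mem_monomialSpan (by simp only [monomialDegree]; omega)
        have : y 1 * orderedMonomial₂ x y ((0, 0), (c + 1, d)) =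
            (y 1 * y 0 - p₁₂ • (y 0 * y 1) - p₁₁ • (y 0 * y 0)) * m +
              p₁₂ • (y 0 * (y 1 * m)) + p₁₁ • (y 0 * (y 0 * m)) := by
          simp only [hm, orderedMonomial₂, orderedMonomial, pow_succ', mul_assoc, pow_zero,
            one_mul, sub_mul, smul_mul_assoc]
          abel
        rw [this]
        exact Submodule.add_mem _ (Submodule.add_mem _ (hxv (c + d) (by omega) _ h.rel_y _ hmem)
          (Submodule.smul_mem _ _ (hy0 _ (ih _ (by omega) _ (h.y_mem 1) _ hmem))))
          (Submodule.smul_mem _ _ (hy0 _ (ih _ (by omega) _ (h.y_mem 0) _ hmem)))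
    intro b hb t ht
    suffices ℬ 1 ≤ (monomialSpan k x y (n + 1)).comap (LinearMap.mulRight k t) from this hb
    rw [← h.span_eq, sup_le_iff, Submodule.span_le, Submodule.span_le]
    constructor
    · rintro _ ⟨j, rfl⟩
      exact h.x_mul_mem (Submodule.subset_span ⟨j, rfl⟩) ht
    · rintro _ ⟨j, rfl⟩
      match j with
      | 0 => exact hy0 t ht
      | 1 => exact hy1 t ht
  suffices key : ∀ b ∈ ℬ 1, ∀ t ∈ monomialSpan k x y n, b * t ∈ monomialSpan k x y (n + 1) from
    key b hb t ht
  clear hb ht b t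
  induction n with
  | zero => exact step 0 fun m hm => by omega
  | succ n ih =>
    refine step (n + 1) fun m hm => ?_
    obtain rfl : n = m := by omega
    exact ih

theorem monomialSpan_eq (n : ℕ) : monomialSpan k x y n = ℬ n := by
  apply le_antisymm
  · refine Submodule.span_le.2 ?_
    rintro _ ⟨i, hi, rfl⟩
    exact h.orderedMonomial₂_mem hi
  · induction n with
    | zero =>
      rw [h.connected.zero_eq, Submodule.one_le]
      have : orderedMonomial₂ x y ((0, 0), (0, 0)) = 1 := by
        simp [orderedMonomial₂, orderedMonomial]
      rw [← this]
      exact orderedMonomial₂_mem_monomialSpan rfl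
    | succ n ih =>
      rw [h.pow_eq, pow_succ', ← h.pow_eq, Submodule.mul_le]
      exact fun b hb t ht => h.mul_mem_monomialSpan n hb (ih ht)

/-- In each degree the monomials span and their number is the dimension; monomials of different
degrees are separated by the projections. -/
theorem linearIndependent_orderedMonomial₂ : LinearIndependent k (orderedMonomial₂ x y) := by
  have hc := h.connected
  have key : ∀ n, LinearIndepOn k (orderedMonomial₂ x y) (monomialFinset n : Set _) := by
    intro n
    have : Module.Finite k (ℬ n) := Module.finite_of_finrank_pos (by
      have := h.finrank_eq n
      by_contra h0
      obtain h0 : Module.finrank k (ℬ n) = 0 := by omega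
      rw [h0] at this
      simp at this)
    have h1 : LinearIndependent k (fun i : monomialFinset n =>
        (⟨orderedMonomial₂ x y i, h.orderedMonomial₂_mem (mem_monomialFinset.1 i.2)⟩ : ℬ n)) := by
      apply linearIndependent_of_top_le_span_of_card_eq_finrank
      · rintro ⟨b, hb⟩ -
        have hb' := hb
        rw [← h.monomialSpan_eq] at hb'
        have h2 : Submodule.map (ℬ n).subtype (Submodule.span k
          (Set.range fun i : monomialFinset n =>
            (⟨orderedMonomial₂ x y i, h.orderedMonomial₂_mem (mem_monomialFinset.1 i.2)⟩ : ℬ n))) =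
            monomialSpan k x y n := by
          rw [Submodule.map_span, ← Set.range_comp, monomialSpan]
          congr 1
          ext b
          constructor
          · rintro ⟨i, rfl⟩; exact ⟨i, mem_monomialFinset.1 i.2, rfl⟩
          · rintro ⟨i, hi, rfl⟩; exact ⟨⟨i, mem_monomialFinset.2 hi⟩, rfl⟩
        rw [← h2] at hb'
        obtain ⟨z, hz, hzb⟩ := hb'
        rwa [show (⟨b, hb⟩ : ℬ n) = z from Subtype.ext hzb.symm]
      · have h1 := six_mul_card_monomialFinset n
        have h2 := h.finrank_eq n
        rw [Fintype.card_coe]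
        omega
    exact h1.map' (ℬ n).subtype (Submodule.ker_subtype _)
  rw [linearIndependent_iff']
  intro s g hg i hi
  have h1 := congrArg (hc.proj (monomialDegree i)) hg
  rw [map_sum, map_zero] at h1
  classical
  refine (linearIndepOn_finset_iff.1 (key (monomialDegree i)) (fun j => if j ∈ s then g j else 0)
    ?_ i (mem_monomialFinset.2 rfl)).symm.trans (if_pos hi) |>.symm
  rw [← h1]
  have h2 : ∀ j ∈ s, hc.proj (monomialDegree i) (g j • orderedMonomial₂ x y j) =
      if j ∈ monomialFinset (monomialDegree i) then g j • orderedMonomial₂ x y j else 0 := by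
    intro j _
    rw [map_smul]
    split_ifs with hj <;> rw [mem_monomialFinset] at hj
    · rw [hc.proj_of_mem (h.orderedMonomial₂_mem hj)]
    · rw [hc.proj_of_mem_ne (h.orderedMonomial₂_mem rfl) hj, smul_zero]
  rw [Finset.sum_congr rfl h2, ← Finset.sum_filter]
  simp only [ite_smul, zero_smul]
  rw [← Finset.sum_filter]
  congr 1
  ext j
  simp only [Finset.mem_filter]
  tauto

theorem span_orderedMonomial₂ : Submodule.span k (Set.range (orderedMonomial₂ x y)) = ⊤ := by
  rw [eq_top_iff]
  intro b _
  obtain ⟨N, hN⟩ := h.connected.exists_eq_sum_proj b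
  rw [hN N le_rfl]
  refine Submodule.sum_mem _ fun n _ => ?_
  have h1 := h.connected.proj_mem n b
  rw [← h.monomialSpan_eq] at h1
  exact Submodule.span_mono (Set.image_subset_range _ _) h1

end IsFrame

end DoubleExt
end

/-! ### From a frame to a right double extension. -/

noncomputable section

namespace DoubleExt

open MulOpposite

variable {k : Type u} {B : Type v} [Field k] [Ring B] [Algebra k B] {ℬ : ℕ → Submodule k B}

/-- A subalgebra that is closed under taking homogeneous components is a graded subalgebra. -/
theorem IsConnectedGraded.subalgebra (hc : IsConnectedGraded ℬ) {A : Subalgebra k B}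
    (hA : ∀ a ∈ A, ∀ n, hc.proj n a ∈ A) : IsConnectedGraded (subGrading ℬ A) where
  nontrivial := have := hc.nontrivial; inferInstance
  gradedMonoid :=
    { one_mem := hc.one_mem
      mul_mem := fun _ _ _ _ ha hb => hc.mul_mem ha hb }
  isInternal := by
    refine (DirectSum.isInternal_submodule_iff_iSupIndep_and_iSup_eq_top _).2 ⟨?_, ?_⟩
    · rw [iSupIndep_iff_finsetSum_eq_zero_imp_eq_zero]
      have h1 := ((DirectSum.isInternal_submodule_iff_iSupIndep_and_iSup_eq_top ℬ).1
        hc.isInternal).1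
      rw [iSupIndep_iff_finsetSum_eq_zero_imp_eq_zero] at h1
      intro s v hv hsum
      exact fun i hi => Subtype.ext (h1 s (fun i => (v i : B)) hv (by
        rw [← AddSubmonoidClass.coe_finsetSum, hsum]; rfl) i hi)
    · rw [eq_top_iff]
      rintro a -
      obtain ⟨N, hN⟩ := hc.exists_eq_sum_proj (a : B)
      have : a = ∑ n ∈ Finset.range N, (⟨hc.proj n a, hA _ a.2 n⟩ : A) :=
        Subtype.ext (by rw [AddSubmonoidClass.coe_finsetSum]; exact hN N le_rfl)
      rw [this]
      exact Submodule.sum_mem _ fun n _ =>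
        Submodule.mem_iSup_of_mem n (hc.proj_mem n (a : B))
  zero_eq := by
    ext a
    rw [Submodule.mem_one]
    change (a : B) ∈ ℬ 0 ↔ _
    rw [hc.mem_zero_iff]
    exact exists_congr fun t => ⟨fun ht => Subtype.ext ht, fun ht => by rw [← ht]; rfl⟩

theorem coe_aug_eq {hc : IsConnectedGraded ℬ} {A : Subalgebra k B}
    (hA : IsConnectedGraded (subGrading ℬ A)) (a : A) : hA.aug a = hc.aug (a : B) := by
  apply hc.algebraMap_injective
  rw [hc.algebraMap_aug]
  have h1 := congrArg A.val (hA.algebraMap_aug a)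
  rw [AlgHom.commutes] at h1
  rw [h1]
  exact (hA.proj_map hc A.val.toLinearMap (fun _ _ h => h) 0 a).symm

/-- Elements of an algebra generated by `x` are scalars modulo the left ideal generated by `x`. -/
theorem exists_eq_add_sum_mul {x : Fin 2 → B} {a : B} (ha : a ∈ Algebra.adjoin k (Set.range x)) :
    ∃ (t : k) (u : Fin 2 → B), (∀ j, u j ∈ Algebra.adjoin k (Set.range x)) ∧
      a = algebraMap k B t + ∑ j, u j * x j := by
  have hsub := Algebra.subset_adjoin (R := k) (s := Set.range x)
  induction ha using Algebra.adjoin_induction with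
  | mem a ha =>
    obtain ⟨j, rfl⟩ := ha
    refine ⟨0, Pi.single j 1, fun i => ?_, by simp [Pi.single_apply]⟩
    rw [Pi.single_apply]
    split_ifs
    · exact one_mem _
    · exact zero_mem _
  | algebraMap r => exact ⟨r, 0, fun _ => zero_mem _, by simp⟩
  | add a b _ _ ha hb =>
    obtain ⟨t, u, hu, rfl⟩ := ha
    obtain ⟨t', u', hu', rfl⟩ := hb
    refine ⟨t + t', u + u', fun j => add_mem (hu j) (hu' j), ?_⟩
    simp only [map_add, Pi.add_apply, add_mul, Finset.sum_add_distrib]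
    abel
  | mul a b ha' _ ha hb =>
    obtain ⟨t, u, hu, ha⟩ := ha
    obtain ⟨t', u', hu', rfl⟩ := hb
    refine ⟨t' * t, fun j => t' • u j + a * u' j,
      fun j => add_mem (Subalgebra.smul_mem _ (hu j) _) (mul_mem ha' (hu' j)), ?_⟩
    rw [mul_add, ← Algebra.commutes, ← Algebra.smul_def]
    conv_lhs => enter [1]; rw [ha]
    simp only [Finset.mul_sum, mul_add, add_mul, Finset.sum_add_distrib, mul_assoc, map_mul,
      Algebra.smul_def]
    abel

theorem range_op_comp {B : Type*} (x : Fin 2 → B) :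
    Set.range (fun i => op (x i)) = unop ⁻¹' Set.range x := by
  ext b
  constructor
  · rintro ⟨i, rfl⟩; exact ⟨i, rfl⟩
  · rintro ⟨i, hi⟩; exact ⟨i, unop_injective hi⟩

theorem op_adjoin_range (x : Fin 2 → B) :
    (Algebra.adjoin k (Set.range x)).op = Algebra.adjoin k (Set.range fun i => op (x i)) := by
  rw [Subalgebra.op_adjoin, range_op_comp]

namespace IsFrame

variable {x y : Fin 2 → B} {p q p₁₂ p₁₁ : k} (h : IsFrame ℬ x y p q p₁₂ p₁₁)
include h

/-- As p and p₁₂ are nonzero, both relations can be solved for the product in the other order, and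
XV = VX is symmetric. This is the source of all left-hand statements. -/
theorem op : IsFrame (opGrading ℬ) (fun i => MulOpposite.op (x i)) (fun i => MulOpposite.op (y i))
    p⁻¹ (-(p⁻¹ * q)) p₁₂⁻¹ (-(p₁₂⁻¹ * p₁₁)) := by
  have hX : ∀ x : Fin 2 → B, Submodule.span k (Set.range fun i => MulOpposite.op (x i)) =
      (Submodule.span k (Set.range x)).map (opLinearEquiv k : B ≃ₗ[k] Bᵐᵒᵖ).toLinearMap := by
    intro x
    rw [Submodule.map_span, ← Set.range_comp]
    rfl
  have hmul : ∀ S T : Submodule k B,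
      (S * T).map (opLinearEquiv k : B ≃ₗ[k] Bᵐᵒᵖ).toLinearMap =
      T.map (opLinearEquiv k : B ≃ₗ[k] Bᵐᵒᵖ).toLinearMap *
        S.map (opLinearEquiv k : B ≃ₗ[k] Bᵐᵒᵖ).toLinearMap := fun S T => Submodule.map_op_mul S T
  have hcomm : Submodule.span k (Set.range fun i => MulOpposite.op (x i)) * opGrading ℬ 1 =
      opGrading ℬ 1 * Submodule.span k (Set.range fun i => MulOpposite.op (x i)) := by
    rw [hX, opGrading, ← hmul, ← hmul, h.mul_comm]
  refine ⟨h.connected.op, ?_, fun n => ?_, hcomm, ?_, inv_ne_zero h.p_ne_zero, ?_,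
    inv_ne_zero h.p₁₂_ne_zero, fun n => ?_⟩
  · rw [hX, hX, ← Submodule.map_sup, h.span_eq]; rfl
  · rw [opGrading, h.pow_eq]
    exact Submodule.map_op_pow (ℬ 1) n
  · apply unop_injective
    change x 0 * x 1 = p⁻¹ • (x 1 * x 0) + -(p⁻¹ * q) • (x 0 * x 0)
    rw [h.rel_x, smul_add, smul_smul, smul_smul, inv_mul_cancel₀ h.p_ne_zero, one_smul, neg_smul,
      add_neg_cancel_right]
  · rw [hcomm, hX, opGrading, ← hmul]
    refine ⟨-p₁₂⁻¹ • (y 1 * y 0 - p₁₂ • (y 0 * y 1) - p₁₁ • (y 0 * y 0)),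
      Submodule.smul_mem _ _ h.rel_y, ?_⟩
    apply unop_injective
    change -p₁₂⁻¹ • (y 1 * y 0 - p₁₂ • (y 0 * y 1) - p₁₁ • (y 0 * y 0)) =
      y 0 * y 1 - p₁₂⁻¹ • (y 1 * y 0) - -(p₁₂⁻¹ * p₁₁) • (y 0 * y 0)
    simp only [smul_sub, smul_smul, neg_mul, inv_mul_cancel₀ h.p₁₂_ne_zero, neg_smul, one_smul]
    abel
  · rw [finrank_opGrading, h.finrank_eq]

/-- The subalgebra generated by `x` is spanned by the ordered monomials. -/
theorem adjoin_eq_span : Subalgebra.toSubmodule (Algebra.adjoin k (Set.range x)) =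
    Submodule.span k (Set.range (orderedMonomial x)) := by
  have hmul : ∀ j, ∀ t ∈ Submodule.span k (Set.range (orderedMonomial x)),
      x j * t ∈ Submodule.span k (Set.range (orderedMonomial x)) := by
    intro j t ht
    suffices Submodule.span k (Set.range (orderedMonomial x)) ≤
      (Submodule.span k (Set.range (orderedMonomial x))).comap (LinearMap.mulLeft k (x j)) from
        this ht
    refine Submodule.span_le.2 ?_
    rintro _ ⟨⟨a, b⟩, rfl⟩
    change x j * orderedMonomial x (a, b) ∈ Submodule.span k (Set.range (orderedMonomial x))
    match j with
    | 0 =>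
      exact Submodule.subset_span ⟨(a + 1, b), by simp only [orderedMonomial, pow_succ', mul_assoc]⟩
    | 1 =>
      obtain ⟨s, t, hst⟩ := mul_pow_of_rel h.rel_x a
      have : x 1 * orderedMonomial x (a, b) = s • orderedMonomial x (a, b + 1) +
          t • orderedMonomial x (a + 1, b) := by
        simp only [orderedMonomial]
        rw [← mul_assoc, hst]
        simp only [add_mul, smul_mul_assoc, pow_succ' _ b, mul_assoc]
      rw [this]
      exact Submodule.add_mem _ (Submodule.smul_mem _ _ (Submodule.subset_span ⟨_, rfl⟩))
        (Submodule.smul_mem _ _ (Submodule.subset_span ⟨_, rfl⟩))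
  apply le_antisymm
  · rw [Algebra.adjoin_eq_span, Submodule.span_le]
    intro b hb
    induction hb using Submonoid.closure_induction_left with
    | one => exact Submodule.subset_span ⟨(0, 0), by simp [orderedMonomial]⟩
    | mul_left a ha b _ hb =>
      obtain ⟨j, rfl⟩ := ha
      exact hmul j b hb
  · refine Submodule.span_le.2 ?_
    rintro _ ⟨a, rfl⟩
    rw [SetLike.mem_coe, Subalgebra.mem_toSubmodule]
    have hx : ∀ j, x j ∈ Algebra.adjoin k (Set.range x) := fun j =>
      Algebra.subset_adjoin ⟨j, rfl⟩
    exact mul_mem (pow_mem (hx 0) _) (pow_mem (hx 1) _)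

theorem linearIndependent_orderedMonomial : LinearIndependent k (orderedMonomial x) := by
  have h1 := h.linearIndependent_orderedMonomial₂.comp
    (fun a : ℕ × ℕ => (a, ((0, 0) : ℕ × ℕ))) fun a b hab => (Prod.mk.inj hab).1
  convert h1 using 1
  ext a
  simp [orderedMonomial₂, orderedMonomial]

theorem proj_mem_adjoin (a : B) (ha : a ∈ Algebra.adjoin k (Set.range x)) (n : ℕ) :
    h.connected.proj n a ∈ Algebra.adjoin k (Set.range x) := by
  rw [← Subalgebra.mem_toSubmodule, h.adjoin_eq_span] at *
  suffices Submodule.span k (Set.range (orderedMonomial x)) ≤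
    (Submodule.span k (Set.range (orderedMonomial x))).comap (h.connected.proj n) from this ha
  refine Submodule.span_le.2 ?_
  rintro _ ⟨b, rfl⟩
  change h.connected.proj n (orderedMonomial x b) ∈ Submodule.span k _
  by_cases hb : b.1 + b.2 = n
  · rw [h.connected.proj_of_mem (h.orderedMonomial_mem hb)]
    exact Submodule.subset_span ⟨b, rfl⟩
  · rw [h.connected.proj_of_mem_ne (h.orderedMonomial_mem rfl) hb]
    exact Submodule.zero_mem _

theorem isConnectedGraded_subGrading :
    IsConnectedGraded (subGrading ℬ (Algebra.adjoin k (Set.range x))) :=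
  h.connected.subalgebra h.proj_mem_adjoin

theorem finrank_subGrading (n : ℕ) :
    Module.finrank k (subGrading ℬ (Algebra.adjoin k (Set.range x)) n) = n + 1 := by
  have h1 : (subGrading ℬ (Algebra.adjoin k (Set.range x)) n).map
      (Algebra.adjoin k (Set.range x)).val.toLinearMap = Submodule.span k
        (Set.range fun a : Finset.HasAntidiagonal.antidiagonal n => orderedMonomial x a) := by
    apply le_antisymm
    · rintro _ ⟨a, ha, rfl⟩
      change (a : B) ∈ _
      have ha : (a : B) ∈ ℬ n := ha
      rw [← h.connected.proj_of_mem ha]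
      have h2 : (a : B) ∈ Subalgebra.toSubmodule (Algebra.adjoin k (Set.range x)) := a.2
      rw [h.adjoin_eq_span] at h2
      suffices Submodule.span k (Set.range (orderedMonomial x)) ≤ (Submodule.span k
          (Set.range fun a : Finset.HasAntidiagonal.antidiagonal n =>
            orderedMonomial x a)).comap (h.connected.proj n) from this h2
      refine Submodule.span_le.2 ?_
      rintro _ ⟨b, rfl⟩
      change h.connected.proj n (orderedMonomial x b) ∈ Submodule.span k _
      by_cases hb : b.1 + b.2 = n
      · rw [h.connected.proj_of_mem (h.orderedMonomial_mem hb)]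
        exact Submodule.subset_span ⟨⟨b, Finset.HasAntidiagonal.mem_antidiagonal.2 hb⟩, rfl⟩
      · rw [h.connected.proj_of_mem_ne (h.orderedMonomial_mem rfl) hb]
        exact Submodule.zero_mem _
    · refine Submodule.span_le.2 ?_
      rintro _ ⟨⟨b, hb⟩, rfl⟩
      rw [Finset.HasAntidiagonal.mem_antidiagonal] at hb
      have h2 : orderedMonomial x b ∈ Subalgebra.toSubmodule (Algebra.adjoin k (Set.range x)) := by
        rw [h.adjoin_eq_span]; exact Submodule.subset_span ⟨b, rfl⟩
      exact ⟨⟨_, h2⟩, h.orderedMonomial_mem hb, rfl⟩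
  rw [LinearEquiv.finrank_eq (Submodule.equivMapOfInjective
    (Algebra.adjoin k (Set.range x)).val.toLinearMap Subtype.val_injective
    (subGrading ℬ (Algebra.adjoin k (Set.range x)) n)), h1]
  refine (finrank_span_eq_card
    (h.linearIndependent_orderedMonomial.comp _ Subtype.val_injective)).trans ?_
  rw [Fintype.card_coe, Finset.Nat.card_antidiagonal]

theorem y_mul_x (i j : Fin 2) : y i * x j ∈ Submodule.span k (Set.range x) * ℬ 1 := by
  rw [h.mul_comm]
  exact Submodule.mul_mem_mul (h.y_mem i) (Submodule.subset_span ⟨j, rfl⟩)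

theorem exists_eq_of_mem_mul {z : B} (hz : z ∈ Submodule.span k (Set.range x) * ℬ 1) :
    ∃ τ₁ τ₂ τ₀ : Algebra.adjoin k (Set.range x), (τ₁ : B) ∈ ℬ 1 ∧ (τ₂ : B) ∈ ℬ 1 ∧
      (τ₀ : B) ∈ ℬ 2 ∧ z = τ₁ * y 0 + τ₂ * y 1 + τ₀ := by
  have hX : Submodule.span k (Set.range x) ≤
      Subalgebra.toSubmodule (Algebra.adjoin k (Set.range x)) := Algebra.span_le_adjoin k _
  have hX1 : Submodule.span k (Set.range x) ≤ ℬ 1 := h.span_eq ▸ le_sup_left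
  induction hz using Submodule.mul_induction_on' with
  | mem_mul_mem a ha b hb =>
    rw [← h.span_eq] at hb
    obtain ⟨c, hc, d, hd, rfl⟩ := Submodule.mem_sup.1 hb
    obtain ⟨t, rfl⟩ := (Submodule.mem_span_range_iff_exists_fun k).1 hd
    refine ⟨t 0 • ⟨a, hX ha⟩, t 1 • ⟨a, hX ha⟩, ⟨a, hX ha⟩ * ⟨c, hX hc⟩,
      Submodule.smul_mem _ _ (hX1 ha), Submodule.smul_mem _ _ (hX1 ha),
      h.connected.mul_mem (hX1 ha) (hX1 hc), ?_⟩
    simp only [Fin.sum_univ_two, Subalgebra.coe_smul, Subalgebra.coe_mul, mul_add, mul_smul_comm,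
      smul_mul_assoc]
    abel
  | add a _ b _ ha hb =>
    obtain ⟨t1, t2, t0, h1, h2, h0, rfl⟩ := ha
    obtain ⟨s1, s2, s0, g1, g2, g0, rfl⟩ := hb
    refine ⟨t1 + s1, t2 + s2, t0 + s0, Submodule.add_mem _ h1 g1, Submodule.add_mem _ h2 g2,
      Submodule.add_mem _ h0 g0, ?_⟩
    simp only [Subalgebra.coe_add, add_mul]
    abel

theorem exists_y_mul (r : Algebra.adjoin k (Set.range x)) (i : Fin 2) :
    ∃ a b c : Algebra.adjoin k (Set.range x), y i * r = a * y 0 + b * y 1 + c := by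
  obtain ⟨r, hr⟩ := r
  change ∃ a b c : Algebra.adjoin k (Set.range x), y i * r = a * y 0 + b * y 1 + c
  induction hr using Algebra.adjoin_induction generalizing i with
  | mem a ha =>
    obtain ⟨j, rfl⟩ := ha
    obtain ⟨a, b, c, -, -, -, habc⟩ := h.exists_eq_of_mem_mul (h.y_mul_x i j)
    exact ⟨a, b, c, habc⟩
  | algebraMap t =>
    match i with
    | 0 => exact ⟨algebraMap _ _ t, 0, 0, by simpa using (Algebra.commutes t (y 0)).symm⟩
    | 1 => exact ⟨0, algebraMap _ _ t, 0, by simpa using (Algebra.commutes t (y 1)).symm⟩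
  | add r s _ _ hr hs =>
    obtain ⟨a, b, c, h1⟩ := hr i
    obtain ⟨a', b', c', h2⟩ := hs i
    refine ⟨a + a', b + b', c + c', ?_⟩
    rw [mul_add, h1, h2]
    simp only [Subalgebra.coe_add, add_mul]
    abel
  | mul r s _ hs' hr hs =>
    obtain ⟨a, b, c, h1⟩ := hr i
    obtain ⟨a', b', c', h2⟩ := hs 0
    obtain ⟨a'', b'', c'', h3⟩ := hs 1
    refine ⟨a * a' + b * a'', a * b' + b * b'', a * c' + b * c'' + c * ⟨s, hs'⟩, ?_⟩
    rw [← mul_assoc, h1]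
    simp only [add_mul, mul_assoc, h2, h3, Subalgebra.coe_add, Subalgebra.coe_mul, mul_add]
    abel

/-- The map carries the basis formed from monomials in x over the exponents of y to the basis of
ordered monomials in four elements. -/
theorem bijective_sum : Function.Bijective
    (fun f : ℕ × ℕ →₀ Algebra.adjoin k (Set.range x) =>
      f.sum fun n a => (a : B) * (y 0 ^ n.1 * y 1 ^ n.2)) := by
  have hmem : ∀ a, orderedMonomial x a ∈ Algebra.adjoin k (Set.range x) := fun a => by
    rw [← Subalgebra.mem_toSubmodule, h.adjoin_eq_span]
    exact Submodule.subset_span ⟨a, rfl⟩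
  have hli : LinearIndependent k fun a => (⟨orderedMonomial x a, hmem a⟩ :
      Algebra.adjoin k (Set.range x)) :=
    LinearIndependent.of_comp (Algebra.adjoin k (Set.range x)).val.toLinearMap
      h.linearIndependent_orderedMonomial
  have hspan : ⊤ ≤ Submodule.span k (Set.range fun a => (⟨orderedMonomial x a, hmem a⟩ :
      Algebra.adjoin k (Set.range x))) := by
    rintro ⟨a, ha⟩ -
    have h1 := ha
    rw [← Subalgebra.mem_toSubmodule, h.adjoin_eq_span,
      show Set.range (orderedMonomial x) = (Algebra.adjoin k (Set.range x)).val.toLinearMap ''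
        Set.range fun a => (⟨orderedMonomial x a, hmem a⟩ : Algebra.adjoin k (Set.range x)) by
        rw [← Set.range_comp]; rfl, ← Submodule.map_span] at h1
    obtain ⟨b, hb, hba⟩ := h1
    rwa [show (⟨a, ha⟩ : Algebra.adjoin k (Set.range x)) = b from Subtype.ext hba.symm]
  let bA := Module.Basis.mk hli hspan
  let bB := Module.Basis.mk h.linearIndependent_orderedMonomial₂ h.span_orderedMonomial₂.ge
  let Φ : (ℕ × ℕ →₀ Algebra.adjoin k (Set.range x)) →ₗ[k] B :=
    Finsupp.lsum k fun n => LinearMap.mulRight k (orderedMonomial y n) ∘ₗ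
      (Algebra.adjoin k (Set.range x)).val.toLinearMap
  let E := (Finsupp.basis fun _ : ℕ × ℕ => bA).equiv bB
    ((Equiv.sigmaEquivProd _ _).trans (Equiv.prodComm _ _))
  have hE : Φ = E.toLinearMap := by
    refine (Finsupp.basis fun _ : ℕ × ℕ => bA).ext fun i => ?_
    rw [LinearEquiv.coe_coe, Module.Basis.equiv_apply]
    simp only [Finsupp.coe_basis, Φ, Finsupp.lsum_single, bA, bB, Module.Basis.mk_apply]
    rfl
  have h1 : Function.Bijective Φ := by rw [hE]; exact E.bijective
  exact h1

theorem adjoin_union_eq_top :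
    Algebra.adjoin k ((Algebra.adjoin k (Set.range x) : Set B) ∪ {y 0, y 1}) = ⊤ := by
  suffices Submodule.span k (Set.range (orderedMonomial₂ x y)) ≤ Subalgebra.toSubmodule
      (Algebra.adjoin k ((Algebra.adjoin k (Set.range x) : Set B) ∪ {y 0, y 1})) by
    rw [h.span_orderedMonomial₂] at this
    exact eq_top_iff.2 fun b _ => this trivial
  rw [Submodule.span_le]
  rintro _ ⟨i, rfl⟩
  rw [SetLike.mem_coe, Subalgebra.mem_toSubmodule]
  have hx : ∀ j, x j ∈ Algebra.adjoin k ((Algebra.adjoin k (Set.range x) : Set B) ∪ {y 0, y 1}) :=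
    fun j => Algebra.subset_adjoin (Or.inl (Algebra.subset_adjoin ⟨j, rfl⟩))
  have hy₀ : y 0 ∈ Algebra.adjoin k ((Algebra.adjoin k (Set.range x) : Set B) ∪ {y 0, y 1}) :=
    Algebra.subset_adjoin (Or.inr (Or.inl rfl))
  have hy₁ : y 1 ∈ Algebra.adjoin k ((Algebra.adjoin k (Set.range x) : Set B) ∪ {y 0, y 1}) :=
    Algebra.subset_adjoin (Or.inr (Or.inr rfl))
  exact mul_mem (mul_mem (pow_mem (hx 0) _) (pow_mem (hx 1) _))
    (mul_mem (pow_mem hy₀ _) (pow_mem hy₁ _))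

theorem isRightDoubleExtension :
    IsRightDoubleExtension ℬ (Algebra.adjoin k (Set.range x)) (y 0) (y 1) := by
  refine ⟨h.isConnectedGraded_subGrading, h.adjoin_union_eq_top, ?_, h.bijective_sum,
    fun r => h.exists_y_mul r 0, fun r => h.exists_y_mul r 1⟩
  obtain ⟨τ₁, τ₂, τ₀, h1, h2, h0, hτ⟩ := h.exists_eq_of_mem_mul h.rel_y
  refine ⟨1, 1, le_rfl, le_rfl, h.y_mem 0, h.y_mem 1, p₁₂, p₁₁, τ₁, τ₂, τ₀,
    Submodule.smul_mem _ _ ?_, h1, h2, h0, ?_⟩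
  · rw [pow_two]; exact h.connected.mul_mem (h.y_mem 0) (h.y_mem 0)
  · rw [sub_sub, sub_eq_iff_eq_add] at hτ
    rw [hτ, pow_two]
    abel

end IsFrame

end DoubleExt
end

/-! ### Left double extensions, regularity of the subalgebra, DE-data and invertibility. -/

noncomputable section

namespace DoubleExt

open MulOpposite

variable {k : Type u} {B : Type v} [Field k] [Ring B] [Algebra k B] {ℬ : ℕ → Submodule k B}

/-- The opposite of a right double extension is a left double extension. -/
theorem IsRightDoubleExtension.of_op {A : Subalgebra k B} {y₁ y₂ : B}
    (hA : IsConnectedGraded (subGrading ℬ A))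
    (h : IsRightDoubleExtension (opGrading ℬ) A.op (op y₁) (op y₂)) :
    IsLeftDoubleExtension ℬ A y₁ y₂ := by
  obtain ⟨-, hgen, ⟨d₁, d₂, hd₁, hd₂, hy₁, hy₂, p₁₂, p₁₁, τ₁, τ₂, τ₀, h1, h2, h3, h4, hrel⟩, hbij,
    hm1, hm2⟩ := h
  have hcomm : ∀ (y : B), (∀ r : A.op, ∃ a b c : A.op,
      op y * (r : Bᵐᵒᵖ) = a * op y₁ + b * op y₂ + c) → ∀ r : A, ∃ a b c : A,
      (r : B) * y = y₁ * a + y₂ * b + c := by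
    intro y hy r
    obtain ⟨a, b, c, habc⟩ := hy ⟨op (r : B), r.2⟩
    exact ⟨⟨unop a, a.2⟩, ⟨unop b, b.2⟩, ⟨unop c, c.2⟩, congrArg unop habc⟩
  refine ⟨hA, ?_, ⟨d₁, d₂, hd₁, hd₂, mem_opGrading.1 hy₁, mem_opGrading.1 hy₂, p₁₂, p₁₁,
    ⟨unop τ₁, τ₁.2⟩, ⟨unop τ₂, τ₂.2⟩, ⟨unop τ₀, τ₀.2⟩, mem_opGrading.1 h1, mem_opGrading.1 h2,
    mem_opGrading.1 h3, mem_opGrading.1 h4, congrArg unop hrel⟩, ?_, hcomm y₁ hm1, hcomm y₂ hm2⟩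
  · have h5 : ((A.op : Set Bᵐᵒᵖ) ∪ {op y₁, op y₂}) = unop ⁻¹' ((A : Set B) ∪ {y₁, y₂}) := by
      ext b
      simp only [Set.mem_union, Set.mem_insert_iff, Set.mem_singleton_iff, Set.mem_preimage,
        ← unop_inj, unop_op]
      rfl
    rw [h5, ← Subalgebra.op_adjoin] at hgen
    rw [← Subalgebra.unop_op (Algebra.adjoin k _), hgen, Subalgebra.unop_top]
  · let e₁ : A ≃+ A.op := (Subalgebra.linearEquivOp A).toAddEquiv
    -- Passing to the opposite algebra reverses the monomial in the generators, so the two exponents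
    -- are exchanged.
    let E : (ℕ × ℕ →₀ A) ≃+ (ℕ × ℕ →₀ A.op) :=
      (Finsupp.domCongr (Equiv.prodComm ℕ ℕ)).trans (Finsupp.mapRange.addEquiv e₁)
    have h6 : (fun f : ℕ × ℕ →₀ A => f.sum fun n a => (y₂ ^ n.1 * y₁ ^ n.2) * (a : B)) =
        unop ∘ (fun f : ℕ × ℕ →₀ A.op =>
          f.sum fun n a => (a : Bᵐᵒᵖ) * (op y₁ ^ n.1 * op y₂ ^ n.2)) ∘ E := by
      ext f
      induction f using Finsupp.induction_linear with
      | zero => simp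
      | add f g hf hg =>
        have hE : E (f + g) = E f + E g := map_add E f g
        simp only [Function.comp_apply] at hf hg ⊢
        rw [hE, Finsupp.sum_add_index' (by simp) (by simp [mul_add]),
          Finsupp.sum_add_index' (by simp) (by simp [add_mul]), hf, hg]
        rfl
      | single n a =>
        have hE : E (Finsupp.single n a) = Finsupp.single (n.2, n.1) (e₁ a) := by
          change Finsupp.mapRange.addEquiv e₁
            (Finsupp.equivMapDomain (Equiv.prodComm ℕ ℕ) (Finsupp.single n a)) = _
          rw [Finsupp.equivMapDomain_single]
          exact Finsupp.mapRange_single (hf := map_zero e₁)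
        simp only [Function.comp_apply]
        rw [hE, Finsupp.sum_single_index (by simp), Finsupp.sum_single_index (by simp)]
        rfl
    rw [h6]
    exact unop_bijective.comp (hbij.comp E.bijective)

namespace IsFrame

variable {x y : Fin 2 → B} {p q p₁₂ p₁₁ : k} (h : IsFrame ℬ x y p q p₁₂ p₁₁)
include h

theorem isDoubleExtension : IsDoubleExtension ℬ (Algebra.adjoin k (Set.range x)) (y 0) (y 1) := by
  refine ⟨h.isRightDoubleExtension,
    IsRightDoubleExtension.of_op h.isConnectedGraded_subGrading ?_⟩
  rw [op_adjoin_range]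
  exact h.op.isRightDoubleExtension

theorem exists_eq_sum_mul_of_aug {a : Algebra.adjoin k (Set.range x)}
    (ha : h.isConnectedGraded_subGrading.aug a = 0) :
    ∃ u : Fin 2 → Algebra.adjoin k (Set.range x), a = ∑ j, u j * (x j : B) := by
  obtain ⟨t, u, hu, hau⟩ := exists_eq_add_sum_mul a.2
  rw [coe_aug_eq (hc := h.connected), hau, map_add, map_sum] at ha
  have h1 : ∀ j, h.connected.aug (u j * x j) = 0 := fun j => by
    rw [map_mul, h.connected.aug_of_mem le_rfl (h.x_mem j), mul_zero]
  simp only [h1, Finset.sum_const_zero, add_zero, AlgHom.commutes, Algebra.algebraMap_self,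
    RingHom.id_apply] at ha
  refine ⟨fun j => ⟨u j, hu j⟩, ?_⟩
  rw [hau, ha, map_zero, zero_add]

/-- The matrix lists the coefficients of x₁x₀ - p x₀x₁ - q x₀², and its determinant is p. Generation
from the right is generation from the left for the opposite frame. -/
theorem isQuantumPlane : IsQuantumPlane (subGrading ℬ (Algebra.adjoin k (Set.range x)))
    (fun i => ⟨x i, Algebra.subset_adjoin ⟨i, rfl⟩⟩) !![-q, -p; 1, 0] where
  connected := h.isConnectedGraded_subGrading
  mem i := h.x_mem i
  gen_left a ha := by
    obtain ⟨u, hu⟩ := h.exists_eq_sum_mul_of_aug ha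
    exact ⟨u, Subtype.ext (by rw [hu]; simp [dotProduct])⟩
  gen_right a ha := by
    have ha' : h.op.isConnectedGraded_subGrading.aug
        ⟨MulOpposite.op (a : B), by rw [← op_adjoin_range]; exact a.2⟩ = 0 := by
      rw [coe_aug_eq (hc := h.connected.op), h.connected.aug_op, ← coe_aug_eq]
      exact ha
    obtain ⟨u, hu⟩ := h.op.exists_eq_sum_mul_of_aug ha'
    refine ⟨fun j => ⟨unop (u j : Bᵐᵒᵖ), ?_⟩, Subtype.ext ?_⟩
    · exact (SetLike.ext_iff.1 (op_adjoin_range (k := k) x) _).2 (u j).2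
    · have := congrArg unop hu
      rw [Fin.sum_univ_two] at this
      simp only [dotProduct, Fin.sum_univ_two]
      exact this.symm
  rel := by
    ext
    have := h.rel_x
    simp only [Fin.sum_univ_two, Matrix.of_apply, Matrix.cons_val', Matrix.cons_val_zero,
      Matrix.cons_val_one, Matrix.cons_val_fin_one]
    simp [this]
  det_ne_zero := by simp [h.p_ne_zero]
  finrank_eq := h.finrank_subGrading

theorem isASRegular [IsDomain B] :
    IsASRegular (subGrading ℬ (Algebra.adjoin k (Set.range x))) 2 :=
  h.isQuantumPlane.isASRegular

theorem adjoin_inter_eq : Algebra.adjoin k ((Algebra.adjoin k (Set.range x) : Set B) ∩ ℬ 1) =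
    Algebra.adjoin k (Set.range x) := by
  apply le_antisymm
  · exact Algebra.adjoin_le Set.inter_subset_left
  · refine Algebra.adjoin_mono ?_
    rintro _ ⟨i, rfl⟩
    exact ⟨Algebra.subset_adjoin ⟨i, rfl⟩, h.x_mem i⟩

end IsFrame

section Data

variable {A : Subalgebra k B} {y₁ y₂ : B}

/-- Coefficients in a right double extension are unique. -/
theorem IsRightDoubleExtension.coeff_unique (h : IsRightDoubleExtension ℬ A y₁ y₂)
    {a b c a' b' c' : A}
    (habc : (a : B) * y₁ + b * y₂ + c = a' * y₁ + b' * y₂ + c') : a = a' ∧ b = b' ∧ c = c' := by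
  have key : ∀ a b c : A, (Finsupp.single (1, 0) a + Finsupp.single (0, 1) b +
      Finsupp.single (0, 0) c : ℕ × ℕ →₀ A).sum (fun n a => (a : B) * (y₁ ^ n.1 * y₂ ^ n.2)) =
      a * y₁ + b * y₂ + c := by
    intro a b c
    rw [Finsupp.sum_add_index' (by simp) (by simp [add_mul]),
      Finsupp.sum_add_index' (by simp) (by simp [add_mul]), Finsupp.sum_single_index (by simp),
      Finsupp.sum_single_index (by simp), Finsupp.sum_single_index (by simp)]
    simp
  have h1 := h.2.2.2.1.1 (a₁ := Finsupp.single (1, 0) a + Finsupp.single (0, 1) b +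
    Finsupp.single (0, 0) c) (a₂ := Finsupp.single (1, 0) a' + Finsupp.single (0, 1) b' +
    Finsupp.single (0, 0) c') (by simp only [key, habc])
  refine ⟨?_, ?_, ?_⟩
  · simpa using DFunLike.congr_fun h1 (1, 0)
  · simpa using DFunLike.congr_fun h1 (0, 1)
  · simpa using DFunLike.congr_fun h1 (0, 0)

theorem IsLeftDoubleExtension.coeff_unique (h : IsLeftDoubleExtension ℬ A y₁ y₂)
    {a b c a' b' c' : A}
    (habc : y₁ * (a : B) + y₂ * b + c = y₁ * a' + y₂ * b' + c') : a = a' ∧ b = b' ∧ c = c' := by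
  have key : ∀ a b c : A, (Finsupp.single (0, 1) a + Finsupp.single (1, 0) b +
      Finsupp.single (0, 0) c : ℕ × ℕ →₀ A).sum (fun n a => (y₂ ^ n.1 * y₁ ^ n.2) * (a : B)) =
      y₁ * a + y₂ * b + c := by
    intro a b c
    rw [Finsupp.sum_add_index' (by simp) (by simp [mul_add]),
      Finsupp.sum_add_index' (by simp) (by simp [mul_add]), Finsupp.sum_single_index (by simp),
      Finsupp.sum_single_index (by simp), Finsupp.sum_single_index (by simp)]
    simp
  have h1 := h.2.2.2.1.1 (a₁ := Finsupp.single (0, 1) a + Finsupp.single (1, 0) b +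
    Finsupp.single (0, 0) c) (a₂ := Finsupp.single (0, 1) a' + Finsupp.single (1, 0) b' +
    Finsupp.single (0, 0) c') (by simp only [key, habc])
  refine ⟨?_, ?_, ?_⟩
  · simpa using DFunLike.congr_fun h1 (0, 1)
  · simpa using DFunLike.congr_fun h1 (1, 0)
  · simpa using DFunLike.congr_fun h1 (0, 0)

/-- A right double extension is presented by DE-data. -/
theorem IsRightDoubleExtension.exists_presents (h : IsRightDoubleExtension ℬ A y₁ y₂) :
    ∃ D : DEData k A, D.Presents y₁ y₂ := by
  obtain ⟨d₁, d₂, -, -, -, -, p₁₂, p₁₁, τ₁, τ₂, τ₀, -, -, -, -, hrel⟩ := h.2.2.1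
  let y : Fin 2 → B := ![y₁, y₂]
  have hy : ∀ i (r : A), ∃ a b c : A, y i * (r : B) = a * y₁ + b * y₂ + c := by
    intro i
    match i with
    | 0 => exact h.2.2.2.2.1
    | 1 => exact h.2.2.2.2.2
  choose a b c habc using hy
  let s (r : A) : Matrix (Fin 2) (Fin 2) A := Matrix.of fun i => ![a i r, b i r]
  have hs : ∀ (r : A) (i : Fin 2), y i * (r : B) = s r i 0 * y₁ + s r i 1 * y₂ + c i r :=
    fun r i => habc i r
  -- Linearity, multiplicativity and the derivation rule are all obtained by expanding a product in
  -- two ways and comparing coefficients.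
  have uniq : ∀ (r : A) (i) {α β γ : A}, y i * (r : B) = α * y₁ + β * y₂ + γ →
      s r i 0 = α ∧ s r i 1 = β ∧ c i r = γ := by
    intro r i α β γ hr
    rw [hs] at hr
    exact h.coeff_unique hr
  have ext2 : ∀ {M N : Matrix (Fin 2) (Fin 2) A}, (∀ i, M i 0 = N i 0 ∧ M i 1 = N i 1) → M = N := by
    intro M N hMN
    ext i j
    match j with
    | 0 => rw [(hMN i).1]
    | 1 => rw [(hMN i).2]
  have hadd : ∀ (r r' : A) (i : Fin 2), s (r + r') i 0 = s r i 0 + s r' i 0 ∧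
      s (r + r') i 1 = s r i 1 + s r' i 1 ∧
      c i (r + r') = c i r + c i r' := by
    intro r r' i
    refine uniq _ i ?_
    simp only [Subalgebra.coe_add, mul_add, hs, add_mul]
    abel
  have hmul : ∀ (r r' : A) (i : Fin 2), s (r * r') i 0 = s r i 0 * s r' 0 0 + s r i 1 * s r' 1 0 ∧
      s (r * r') i 1 = s r i 0 * s r' 0 1 + s r i 1 * s r' 1 1 ∧
      c i (r * r') = s r i 0 * c 0 r' + s r i 1 * c 1 r' + c i r * r' := by
    intro r r' i
    refine uniq _ i ?_
    have h0 : y₁ * (r' : B) = _ := hs r' 0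
    have h1 : y₂ * (r' : B) = _ := hs r' 1
    simp only [Subalgebra.coe_mul, ← mul_assoc, hs r i]
    simp only [add_mul, mul_assoc, h0, h1, Subalgebra.coe_add, Subalgebra.coe_mul, mul_add]
    abel
  have halg : ∀ t : k, s (algebraMap k A t) = algebraMap k _ t ∧
      ∀ i, c i (algebraMap k A t) = 0 := by
    intro t
    have h0 := uniq (algebraMap k A t) 0 (α := algebraMap k A t) (β := 0) (γ := 0) (by
      simpa [y] using (Algebra.commutes t y₁).symm)
    have h1 := uniq (algebraMap k A t) 1 (α := 0) (β := algebraMap k A t) (γ := 0) (by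
      simpa [y] using (Algebra.commutes t y₂).symm)
    refine ⟨?_, Fin.forall_fin_two.2 ⟨h0.2.2, h1.2.2⟩⟩
    ext i j
    rw [Matrix.algebraMap_matrix_apply]
    fin_cases i <;> fin_cases j <;> simp [h0, h1]
  have hsmul : ∀ (t : k) r i, c i (t • r) = t • c i r := by
    intro t r i
    refine (uniq _ i (α := t • s r i 0) (β := t • s r i 1) ?_).2.2
    simp only [Subalgebra.coe_smul, mul_smul_comm, hs, smul_add, smul_mul_assoc]
  let σ : A →ₐ[k] Matrix (Fin 2) (Fin 2) A :=
    { toFun := s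
      map_one' := by rw [← map_one (algebraMap k A), (halg 1).1, map_one]
      map_mul' := fun r r' => ext2 fun i => by
        simp only [Matrix.mul_apply, Fin.sum_univ_two]
        exact ⟨(hmul r r' i).1, (hmul r r' i).2.1⟩
      map_zero' := by rw [← map_zero (algebraMap k A), (halg 0).1, map_zero]
      map_add' := fun r r' => ext2 fun i => ⟨(hadd r r' i).1, (hadd r r' i).2.1⟩
      commutes' := fun t => (halg t).1 }
  let δ : A →ₗ[k] (Fin 2 → A) :=
    { toFun := fun r i => c i r
      map_add' := fun r r' => funext fun i => (hadd r r' i).2.2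
      map_smul' := fun t r => funext fun i => hsmul t r i }
  refine ⟨⟨p₁₂, p₁₁, τ₁, τ₂, τ₀, σ, δ, fun r r' i => ?_⟩, hrel, fun r => ⟨hs r 0, hs r 1⟩⟩
  rw [Fin.sum_univ_two]
  exact (hmul r r' i).2.2

/-- In a double extension the homomorphism `σ` is invertible. -/
theorem IsDoubleExtension.isInvertibleHom (h : IsDoubleExtension ℬ A y₁ y₂) {D : DEData k A}
    (hD : D.Presents y₁ y₂) : IsInvertibleHom D.σ := by
  obtain ⟨hR, hL⟩ := h
  let y : Fin 2 → B := ![y₁, y₂]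
  have hy : ∀ i (r : A), ∃ a b c : A, (r : B) * y i = y₁ * a + y₂ * b + c := by
    intro i
    match i with
    | 0 => exact hL.2.2.2.2.1
    | 1 => exact hL.2.2.2.2.2
  choose a b c habc using hy
  -- The inverse collects the coefficients of r yᵢ on the right of y₁, y₂; row l holds the
  -- coefficients of the l-th generator.
  let s (r : A) : Matrix (Fin 2) (Fin 2) A := Matrix.of ![fun i => a i r, fun i => b i r]
  have hs : ∀ (r : A) (i : Fin 2), (r : B) * y i = y₁ * s r 0 i + y₂ * s r 1 i + c i r :=
    fun r i => habc i r
  have hσ : ∀ (r : A) (i : Fin 2), y i * (r : B) = D.σ r i 0 * y₁ + D.σ r i 1 * y₂ + D.δ r i := by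
    intro r i
    match i with
    | 0 => exact (hD.2 r).1
    | 1 => exact (hD.2 r).2
  have uniq : ∀ (r : A) (i) {α β γ : A}, (r : B) * y i = y₁ * α + y₂ * β + γ →
      s r 0 i = α ∧ s r 1 i = β ∧ c i r = γ := by
    intro r i α β γ hr
    rw [hs] at hr
    exact hL.coeff_unique hr
  have ext2 : ∀ {M N : Matrix (Fin 2) (Fin 2) A}, (∀ i, M 0 i = N 0 i ∧ M 1 i = N 1 i) → M = N := by
    intro M N hMN
    ext j i
    match j with
    | 0 => rw [(hMN i).1]
    | 1 => rw [(hMN i).2]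
  have hadd : ∀ (r r' : A) (i : Fin 2), s (r + r') 0 i = s r 0 i + s r' 0 i ∧
      s (r + r') 1 i = s r 1 i + s r' 1 i ∧
      c i (r + r') = c i r + c i r' := by
    intro r r' i
    refine uniq _ i ?_
    simp only [Subalgebra.coe_add, mul_add, hs, add_mul]
    abel
  have hmul : ∀ (r r' : A) (i : Fin 2), s (r * r') 0 i = s r 0 0 * s r' 0 i + s r 0 1 * s r' 1 i ∧
      s (r * r') 1 i = s r 1 0 * s r' 0 i + s r 1 1 * s r' 1 i ∧
      c i (r * r') = c 0 r * s r' 0 i + c 1 r * s r' 1 i + r * c i r' := by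
    intro r r' i
    refine uniq _ i ?_
    have h0 : (r : B) * y₁ = _ := hs r 0
    have h1 : (r : B) * y₂ = _ := hs r 1
    simp only [Subalgebra.coe_mul, mul_assoc, hs r' i]
    simp only [mul_add, ← mul_assoc, h0, h1, Subalgebra.coe_add, Subalgebra.coe_mul, add_mul]
    abel
  have halg : ∀ t : k, s (algebraMap k A t) = algebraMap k _ t := by
    intro t
    have h0 := uniq (algebraMap k A t) 0 (α := algebraMap k A t) (β := 0) (γ := 0) (by
      simpa [y] using Algebra.commutes t y₁)
    have h1 := uniq (algebraMap k A t) 1 (α := 0) (β := algebraMap k A t) (γ := 0) (by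
      simpa [y] using Algebra.commutes t y₂)
    ext i j
    rw [Matrix.algebraMap_matrix_apply]
    fin_cases i <;> fin_cases j <;> simp [h0, h1]
  let φ : A →ₐ[k] Matrix (Fin 2) (Fin 2) A :=
    { toFun := s
      map_one' := by rw [← map_one (algebraMap k A), halg 1, map_one]
      map_mul' := fun r r' => ext2 fun i => by
        simp only [Matrix.mul_apply, Fin.sum_univ_two]
        exact ⟨(hmul r r' i).1, (hmul r r' i).2.1⟩
      map_zero' := by rw [← map_zero (algebraMap k A), halg 0, map_zero]
      map_add' := fun r r' => ext2 fun i => ⟨(hadd r r' i).1, (hadd r r' i).2.1⟩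
      commutes' := fun t => halg t }
  -- Moving r to the left of the generator and then back to the right returns yᵢ r; comparing
  -- coefficients gives the first half of the inverse relations, and the mirror computation gives
  -- the second.
  have h1 : ∀ (r : A) (i : Fin 2), (∑ l, φ (D.σ r i l) 0 l = if i = 0 then r else 0) ∧
      (∑ l, φ (D.σ r i l) 1 l = if i = 1 then r else 0) := by
    intro r i
    have h2 := hσ r i
    have e0 : ∀ r : A, (r : B) * y₁ = _ := fun r => hs r 0
    have e1 : ∀ r : A, (r : B) * y₂ = _ := fun r => hs r 1
    rw [e0, e1] at h2
    have h3 : y₁ * ((if i = 0 then r else 0 : A) : B) + y₂ * ((if i = 1 then r else 0 : A) : B) +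
        ((0 : A) : B) = y i * r := by
      fin_cases i <;> simp [y]
    have h4 := h3.trans (h2.trans (show _ = y₁ * ((∑ l, φ (D.σ r i l) 0 l : A) : B) +
      y₂ * ((∑ l, φ (D.σ r i l) 1 l : A) : B) +
      ((c 0 (D.σ r i 0) + c 1 (D.σ r i 1) + D.δ r i : A) : B) by
        simp only [Fin.sum_univ_two, Subalgebra.coe_add, mul_add]
        change _ = y₁ * (s (D.σ r i 0) 0 0 : B) + y₁ * (s (D.σ r i 1) 0 1 : B) +
          (y₂ * (s (D.σ r i 0) 1 0 : B) + y₂ * (s (D.σ r i 1) 1 1 : B)) + _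
        abel))
    have h5 := hL.coeff_unique h4
    exact ⟨h5.1.symm, h5.2.1.symm⟩
  have h2 : ∀ (r : A) (i : Fin 2), (∑ l, D.σ (φ r l i) l 0 = if i = 0 then r else 0) ∧
      (∑ l, D.σ (φ r l i) l 1 = if i = 1 then r else 0) := by
    intro r i
    have h2 := hs r i
    have e0 : ∀ r : A, y₁ * (r : B) = _ := fun r => hσ r 0
    have e1 : ∀ r : A, y₂ * (r : B) = _ := fun r => hσ r 1
    rw [e0, e1] at h2
    have h3 : ((if i = 0 then r else 0 : A) : B) * y₁ + ((if i = 1 then r else 0 : A) : B) * y₂ +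
        ((0 : A) : B) = r * y i := by
      fin_cases i <;> simp [y]
    have h4 := h3.trans (h2.trans (show _ = ((∑ l, D.σ (φ r l i) l 0 : A) : B) * y₁ +
      ((∑ l, D.σ (φ r l i) l 1 : A) : B) * y₂ +
      ((D.δ (s r 0 i) 0 + D.δ (s r 1 i) 1 + c i r : A) : B) by
        simp only [Fin.sum_univ_two, Subalgebra.coe_add, add_mul]
        change _ = (D.σ (s r 0 i) 0 0 : B) * y₁ + (D.σ (s r 1 i) 1 0 : B) * y₁ +
          ((D.σ (s r 0 i) 0 1 : B) * y₂ + (D.σ (s r 1 i) 1 1 : B) * y₂) + _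
        abel))
    have h5 := hR.coeff_unique h4
    exact ⟨h5.1.symm, h5.2.1.symm⟩
  refine ⟨φ, fun i j r => ⟨?_, ?_⟩⟩
  · match j with
    | 0 => exact (h1 r i).1
    | 1 => exact (h1 r i).2
  · match j with
    | 0 => exact (h2 r i).1
    | 1 => exact (h2 r i).2

end Data

end DoubleExt
end

/-! ### Normal forms of quadratic relations and normal planes of generators. -/

noncomputable section

namespace DoubleExt

open Sum

variable {k : Type u} {B : Type v} [Field k] [Ring B] [Algebra k B] {ℬ : ℕ → Submodule k B}

theorem two_form_rank_one {c : Fin 2 → Fin 2 → k} (h : c 0 0 * c 1 1 = c 0 1 * c 1 0)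
    (i i' j j' : Fin 2) : c i j * c i' j' = c i j' * c i' j := by
  have h2 : ∀ i : Fin 2, i = 0 ∨ i = 1 := by decide
  rcases h2 i with rfl | rfl <;> rcases h2 i' with rfl | rfl <;> rcases h2 j with rfl | rfl <;>
    rcases h2 j' with rfl | rfl <;> first | ring1 | linear_combination h | linear_combination -h

/-- A nonzero quadratic relation between two linearly independent elements of a domain is
nondegenerate. -/
theorem two_form_det_ne_zero [IsDomain B] {u : Fin 2 → B} (hu : LinearIndependent k u)
    {c : Fin 2 → Fin 2 → k} (hc : c ≠ 0) (h : ∑ i, ∑ j, c i j • (u i * u j) = 0) :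
    c 0 0 * c 1 1 - c 0 1 * c 1 0 ≠ 0 := by
  intro hdet
  apply hc
  have key := two_form_rank_one (sub_eq_zero.1 hdet)
  ext i j
  by_contra hij
  -- With vanishing determinant, the product of column j and row i of c is c i j times c, so a
  -- relation of rank one appears.
  have h1 := rank_one_of_isDomain hu (fun i => c i j) (c i) (by
    rw [mem_relSpace]
    have h2 : ∀ a b, c a j * c i b = c i j * c a b := fun a b => by rw [key, mul_comm]
    simp only [h2, mul_smul, ← Finset.smul_sum, h, smul_zero]) i j
  exact hij (mul_self_eq_zero.1 h1)

/-- A nondegenerate quadratic expression in two elements over an algebraically closed field, in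
normal form. -/
theorem exists_normal_form [IsAlgClosed k] (u : Fin 2 → B) (c : Fin 2 → Fin 2 → k)
    (hc : c 0 0 * c 1 1 - c 0 1 * c 1 0 ≠ 0) :
    ∃ (x : Fin 2 → B) (s a b : k), Submodule.span k (Set.range x) = Submodule.span k (Set.range u) ∧
      s ≠ 0 ∧ a ≠ 0 ∧ x 1 * x 0 - a • (x 0 * x 1) - b • (x 0 * x 0) =
        s • ∑ i, ∑ j, c i j • (u i * u j) := by
  obtain ⟨P, hP⟩ : ∃ x : Fin 2 → B, ∃ d : Fin 2 → Fin 2 → k,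
      Submodule.span k (Set.range x) = Submodule.span k (Set.range u) ∧ d 1 1 = 0 ∧
      d 0 1 * d 1 0 ≠ 0 ∧ ∑ i, ∑ j, d i j • (x i * x j) = ∑ i, ∑ j, c i j • (u i * u j) := by
    by_cases h11 : c 1 1 = 0
    · exact ⟨u, c, rfl, h11, by simpa [h11] using hc, rfl⟩
    · obtain ⟨l, hl⟩ := IsAlgClosed.exists_root
        (Polynomial.C (c 1 1) * Polynomial.X ^ 2 + Polynomial.C (c 0 1 + c 1 0) * Polynomial.X +
          Polynomial.C (c 0 0)) (by rw [Polynomial.degree_quadratic h11]; decide)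
      have hl' : c 1 1 * l ^ 2 + (c 0 1 + c 1 0) * l + c 0 0 = 0 := by
        simpa [Polynomial.IsRoot] using hl
      -- In the basis x₀ = u₁ - l u₀, x₁ = u₀ the coefficient of x₁² is the quadratic polynomial
      -- evaluated at its root l.
      refine ⟨![u 1 - l • u 0, u 0], ![![c 1 1, c 1 0 + l * c 1 1], ![c 0 1 + l * c 1 1, 0]],
        ?_, rfl, ?_, ?_⟩
      · have hu : ∀ i, u i ∈ Submodule.span k (Set.range u) := fun i =>
          Submodule.subset_span ⟨i, rfl⟩
        set x : Fin 2 → B := ![u 1 - l • u 0, u 0] with hx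
        have hx' : ∀ i, x i ∈ Submodule.span k (Set.range x) := fun i =>
          Submodule.subset_span ⟨i, rfl⟩
        apply le_antisymm <;> refine Submodule.span_le.2 (Set.range_subset_iff.2 ?_) <;>
          refine Fin.forall_fin_two.2 ⟨?_, ?_⟩
        · exact sub_mem (hu 1) (Submodule.smul_mem _ _ (hu 0))
        · exact hu 0
        · exact hx' 1
        · have : u 1 = x 0 + l • x 1 := by simp [hx]
          rw [this]
          exact add_mem (hx' 0) (Submodule.smul_mem _ _ (hx' 1))
      · intro h
        apply hc
        simp only [Matrix.cons_val_zero, Matrix.cons_val_one] at h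
        linear_combination c 1 1 * hl' - h
      · simp only [Fin.sum_univ_two, Matrix.cons_val_zero, Matrix.cons_val_one, sub_mul, mul_sub,
          smul_mul_assoc, mul_smul_comm, smul_sub, smul_smul, add_smul]
        rw [show c 0 0 = -(c 1 1 * l ^ 2 + (c 0 1 + c 1 0) * l) by linear_combination hl']
        module
  obtain ⟨d, hspan, h11, hd, hsum⟩ := hP
  have h10 := right_ne_zero_of_mul hd
  refine ⟨P, (d 1 0)⁻¹, -((d 1 0)⁻¹ * d 0 1), -((d 1 0)⁻¹ * d 0 0), hspan, inv_ne_zero h10,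
    neg_ne_zero.2 (mul_ne_zero (inv_ne_zero h10) (left_ne_zero_of_mul hd)), ?_⟩
  rw [← hsum]
  simp only [Fin.sum_univ_two, h11, zero_smul, add_zero, smul_add, smul_smul, inv_mul_cancel₀ h10,
    one_smul, neg_smul]
  abel

/-- Two-dimensional spaces `X`, `Y` of generators with `X B₁ = B₁ X` and quadratic relations in `X`
and in `Y` modulo `X B₁` lead to a frame. -/
theorem exists_isFrame [IsAlgClosed k] (hc : IsConnectedGraded ℬ) {u v : Fin 2 → B}
    (hspan : Submodule.span k (Set.range u) ⊔ Submodule.span k (Set.range v) = ℬ 1)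
    (hpow : ∀ n, ℬ n = ℬ 1 ^ n)
    (hcomm : Submodule.span k (Set.range u) * ℬ 1 = ℬ 1 * Submodule.span k (Set.range u))
    {c q : Fin 2 → Fin 2 → k} (hc0 : c 0 0 * c 1 1 - c 0 1 * c 1 0 ≠ 0)
    (hcu : ∑ i, ∑ j, c i j • (u i * u j) = 0) (hq0 : q 0 0 * q 1 1 - q 0 1 * q 1 0 ≠ 0)
    (hqv : ∑ i, ∑ j, q i j • (v i * v j) ∈ Submodule.span k (Set.range u) * ℬ 1)
    (hfin : ∀ n, 6 * Module.finrank k (ℬ n) = (n + 1) * (n + 2) * (n + 3)) :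
    ∃ (x y : Fin 2 → B) (p p' p₁₂ p₁₁ : k), IsFrame ℬ x y p p' p₁₂ p₁₁ := by
  obtain ⟨x, s, a, b, hx, -, ha, hxa⟩ := exists_normal_form u c hc0
  obtain ⟨y, s', a', b', hy, -, ha', hya⟩ := exists_normal_form v q hq0
  rw [hcu, smul_zero, sub_sub, sub_eq_zero] at hxa
  refine ⟨x, y, a, b, a', b', ⟨hc, ?_, hpow, ?_, hxa, ha, ?_, ha', hfin⟩⟩
  · rw [hx, hy, hspan]
  · rw [hx, hcomm]
  · rw [hx, hya]
    exact Submodule.smul_mem _ _ hqv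

section

variable {x : Fin 2 ⊕ Fin 2 → B}

theorem sum_relation_eq {r : Fin 2 ⊕ Fin 2 → Fin 2 ⊕ Fin 2 → k} (hr : r ∈ relSpace x) :
    ∑ i, ∑ j, r (inr i) (inr j) • (x (inr i) * x (inr j)) =
      -(∑ i, ∑ j, r (inl i) j • (x (inl i) * x j)) -
        ∑ i, ∑ j, r (inr i) (inl j) • (x (inr i) * x (inl j)) := by
  rw [mem_relSpace, Fintype.sum_sum_type] at hr
  have h1 : ∀ i : Fin 2, ∑ j, r (inr i) j • (x (inr i) * x j) =
      ∑ j, r (inr i) (inl j) • (x (inr i) * x (inl j)) +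
        ∑ j, r (inr i) (inr j) • (x (inr i) * x (inr j)) := fun i => Fintype.sum_sum_type _
  simp only [h1, Finset.sum_add_distrib] at hr
  rw [eq_sub_iff_add_eq, eq_neg_iff_add_eq_zero]
  rw [← hr]; abel

theorem sum_inl_mem (r : Fin 2 → Fin 2 ⊕ Fin 2 → k) :
    ∑ i, ∑ j, r i j • (x (inl i) * x j) ∈
      Submodule.span k (Set.range (x ∘ inl)) * Submodule.span k (Set.range x) :=
  Submodule.sum_mem _ fun i _ => Submodule.sum_mem _ fun j _ => Submodule.smul_mem _ _
    (Submodule.mul_mem_mul (Submodule.subset_span ⟨i, rfl⟩) (Submodule.subset_span ⟨j, rfl⟩))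

variable {w : Fin 2 ⊕ Fin 2 → Fin 2 ⊕ Fin 2 → Fin 2 ⊕ Fin 2 → Fin 2 ⊕ Fin 2 → k}
  (h : IsSuperpotential (relSpace (k := k) x) w)
  (q : Fin 2 → Fin 2 → k) (hq1 : ∀ f : Fin 2 → k, (∀ j, ∑ i, f i * q i j = 0) → f = 0)
  (hq2 : ∀ f : Fin 2 → k, (∀ i, ∑ j, q i j * f j = 0) → f = 0)
  (hR : ∀ r ∈ relSpace (k := k) x, ∃ t : k, ∀ i j, r (inr i) (inr j) = t * q i j)
  {r₀ : Fin 2 ⊕ Fin 2 → Fin 2 ⊕ Fin 2 → k} (hr₀ : r₀ ∈ relSpace x) {i₀ j₀ : Fin 2}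
  (h₀ : r₀ (inr i₀) (inr j₀) ≠ 0)
include h hq1 hq2 hR hr₀ h₀

theorem IsSuperpotential.inr_mul_inl_mem (i j : Fin 2) : x (inr i) * x (inl j) ∈
    Submodule.span k (Set.range (x ∘ inl)) * Submodule.span k (Set.range x) := by
  obtain ⟨r, hr, h22, h21⟩ := h.exists_rel_right q hq1 hq2 hR hr₀ h₀
    (fun a b => if a = i ∧ b = j then 1 else 0)
  have h1 := sum_relation_eq hr
  have h2 : ∑ a, ∑ b, r (inr a) (inl b) • (x (inr a) * x (inl b)) = x (inr i) * x (inl j) := by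
    simp [h21, ite_and]
  simp only [h22, zero_smul, Finset.sum_const_zero] at h1
  rw [h2, eq_comm, sub_eq_zero] at h1
  rw [← h1]
  exact neg_mem (sum_inl_mem fun i => r (inl i))

/-- The mirror image of the previous lemma, through the superpotential read backwards; this
exchanges the two nondegeneracy conditions on q. -/
theorem IsSuperpotential.inl_mul_inr_mem (i j : Fin 2) : x (inl i) * x (inr j) ∈
    Submodule.span k (Set.range x) * Submodule.span k (Set.range (x ∘ inl)) := by
  obtain ⟨r, hr, h22, h21⟩ := h.flip.exists_rel_right (fun i j => q j i)
    (fun f hf => hq2 f fun i => by simpa only [mul_comm] using hf i)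
    (fun f hf => hq1 f fun j => by simpa only [mul_comm] using hf j)
    (fun r hr => by
      obtain ⟨t, ht⟩ := hR _ (mem_map_flip.1 hr)
      exact ⟨t, fun i j => ht j i⟩)
    (r₀ := fun i j => r₀ j i) (mem_map_flip.2 hr₀) (i₀ := j₀) (j₀ := i₀) h₀
    (fun b a => if a = i ∧ b = j then 1 else 0)
  have h1 := mem_relSpace.1 (mem_map_flip.1 hr)
  have h3 : ∀ a, ∑ b, r b a • (x a * x b) = ∑ b, r (inl b) a • (x a * x (inl b)) +
      ∑ b, r (inr b) a • (x a * x (inr b)) := fun a => Fintype.sum_sum_type _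
  simp only [h3, Finset.sum_add_distrib] at h1
  rw [Fintype.sum_sum_type (fun a => ∑ b, r (inr b) a • (x a * x (inr b)))] at h1
  have h2 : ∑ a, ∑ b, r (inr b) (inl a) • (x (inl a) * x (inr b)) = x (inl i) * x (inr j) := by
    simp [h21, ite_and]
  simp only [h22, zero_smul, Finset.sum_const_zero, h2, add_zero] at h1
  rw [eq_neg_of_add_eq_zero_right h1]
  exact neg_mem <| Submodule.sum_mem _ fun i _ => Submodule.sum_mem _ fun j _ =>
    Submodule.smul_mem _ _
    (Submodule.mul_mem_mul (Submodule.subset_span ⟨i, rfl⟩) (Submodule.subset_span ⟨j, rfl⟩))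

theorem IsSuperpotential.span_inl_mul_comm :
    Submodule.span k (Set.range (x ∘ inl)) * Submodule.span k (Set.range x) =
      Submodule.span k (Set.range x) * Submodule.span k (Set.range (x ∘ inl)) := by
  apply le_antisymm
  · rw [Submodule.span_mul_span, Submodule.span_le]
    rintro _ ⟨_, ⟨i, rfl⟩, _, ⟨j | j, rfl⟩, rfl⟩
    · exact Submodule.mul_mem_mul (Submodule.subset_span ⟨_, rfl⟩) (Submodule.subset_span ⟨_, rfl⟩)
    · exact h.inl_mul_inr_mem q hq1 hq2 hR hr₀ h₀ i j
  · rw [Submodule.span_mul_span, Submodule.span_le]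
    rintro _ ⟨_, ⟨i | i, rfl⟩, _, ⟨j, rfl⟩, rfl⟩
    · exact Submodule.mul_mem_mul (Submodule.subset_span ⟨_, rfl⟩) (Submodule.subset_span ⟨_, rfl⟩)
    · exact h.inr_mul_inl_mem q hq1 hq2 hR hr₀ h₀ i j

theorem IsSuperpotential.sum_inr_mem : ∑ i, ∑ j, q i j • (x (inr i) * x (inr j)) ∈
    Submodule.span k (Set.range (x ∘ inl)) * Submodule.span k (Set.range x) := by
  obtain ⟨t, ht⟩ := hR _ hr₀
  have ht0 : t ≠ 0 := by
    rintro rfl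
    exact h₀ (by rw [ht, zero_mul])
  have h1 := sum_relation_eq hr₀
  simp only [ht, mul_smul, ← Finset.smul_sum] at h1
  rw [← inv_smul_smul₀ ht0 (∑ i, ∑ j, q i j • (x (inr i) * x (inr j))), h1]
  refine Submodule.smul_mem _ _ (sub_mem (neg_mem (sum_inl_mem fun i => r₀ (inl i))) ?_)
  exact Submodule.sum_mem _ fun i _ => Submodule.sum_mem _ fun j _ => Submodule.smul_mem _ _
    (h.inr_mul_inl_mem q hq1 hq2 hR hr₀ h₀ i j)

end

theorem span_inl_sup_span_inr {x : Fin 2 ⊕ Fin 2 → B} :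
    Submodule.span k (Set.range (x ∘ inl)) ⊔ Submodule.span k (Set.range (x ∘ inr)) =
      Submodule.span k (Set.range x) := by
  rw [← Submodule.span_union, ← Sum.range_eq]

theorem exists_linearIndependent_fin {X : Submodule k B} [Module.Finite k X] {m : ℕ}
    (hm : Module.finrank k X = m) :
    ∃ x : Fin m → B, LinearIndependent k x ∧ Submodule.span k (Set.range x) = X := by
  let b := Module.finBasisOfFinrankEq k X hm
  refine ⟨fun i => (b i : B), b.linearIndependent.map' X.subtype (Submodule.ker_subtype _), ?_⟩
  have h1 : Set.range (fun i => (b i : B)) = X.subtype '' Set.range b := by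
    rw [← Set.range_comp]; rfl
  rw [h1, ← Submodule.map_span, b.span_eq, Submodule.map_top, Submodule.range_subtype]

namespace IsRegularOfType14641

variable (hB : IsRegularOfType14641 ℬ)
include hB

theorem finrank_one : Module.finrank k (ℬ 1) = 4 :=
  (exists_isAdaptedResolution hB.regular.connected hB.regular.gorenstein_left hB.resolution).1

theorem finite (n : ℕ) : Module.Finite k (ℬ n) := by
  rcases n with _ | n
  · rw [hB.regular.connected.zero_eq, Submodule.one_eq_span]
    infer_instance
  · obtain ⟨c, hc⟩ := hB.regular.growth
    exact (hc _ n.succ_pos).1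

theorem exists_isAdaptedResolution {ι : Type} [Fintype ι] [DecidableEq ι] {x : ι → B}
    (hli : LinearIndependent k x) (hsp : Submodule.span k (Set.range x) = ℬ 1) :
    ∃ F G, IsAdaptedResolution ℬ x F G := by
  have hx : ∀ i, x i ∈ ℬ 1 := fun i => hsp ▸ Submodule.subset_span ⟨i, rfl⟩
  let b : Module.Basis ι k (ℬ 1) := Module.Basis.mk (v := fun i => ⟨x i, hx i⟩)
    (LinearIndependent.of_comp (ℬ 1).subtype hli) (by
      rintro ⟨a, ha⟩ -
      rw [← hsp] at ha
      obtain ⟨c, hc⟩ := (Submodule.mem_span_range_iff_exists_fun k).1 ha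
      refine (Submodule.mem_span_range_iff_exists_fun k).2 ⟨c, Subtype.ext ?_⟩
      simp [← hc])
  obtain ⟨F, G, h⟩ := (DoubleExt.exists_isAdaptedResolution hB.regular.connected
    hB.regular.gorenstein_left hB.resolution).2 b
  have : (fun i => (b i : B)) = x := by
    ext i
    simp [b]
  exact ⟨F, G, this ▸ h⟩

theorem card_eq {ι : Type} [Fintype ι] {x : ι → B}
    (hli : LinearIndependent k x) (hsp : Submodule.span k (Set.range x) = ℬ 1) :
    Fintype.card ι = 4 := by
  rw [← hB.finrank_one, ← hsp, finrank_span_eq_card hli]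

theorem exists_isSuperpotential [IsDomain B] {ι : Type} [Fintype ι] [DecidableEq ι] {x : ι → B}
    (hli : LinearIndependent k x) (hsp : Submodule.span k (Set.range x) = ℬ 1) :
    ∃ w, IsSuperpotential (relSpace (k := k) x) w ∧
      ∀ t : ι → ι → ι → k, (∀ i, t i ∈ relSpace x) → (∀ l, (fun i j => t i j l) ∈ relSpace x) →
        ∃ f : ι → k, ∀ i j l, t i j l = ∑ a, f a * w a i j l := by
  obtain ⟨F, G, h⟩ := hB.exists_isAdaptedResolution hli hsp
  exact h.exists_isSuperpotential hB.regular.connected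
    (fun i => hsp ▸ Submodule.subset_span ⟨i, rfl⟩) hli
    fun a ha => (Submodule.mem_span_range_iff_exists_fun k).1 (hsp ▸ ha)

theorem exists_basis : ∃ x : Fin 4 → B, LinearIndependent k x ∧
    Submodule.span k (Set.range x) = ℬ 1 := by
  have := hB.finite 1
  exact exists_linearIndependent_fin hB.finrank_one

theorem six_mul_finrank [IsDomain B] (n : ℕ) :
    6 * Module.finrank k (ℬ n) = (n + 1) * (n + 2) * (n + 3) := by
  obtain ⟨x, hli, hsp⟩ := hB.exists_basis
  obtain ⟨F, G, h⟩ := hB.exists_isAdaptedResolution hli hsp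
  exact h.six_mul_finrank hB.regular.connected hB.finite (by simp)
    (fun i => hsp ▸ Submodule.subset_span ⟨i, rfl⟩) n

theorem pow_eq (n : ℕ) : ℬ n = ℬ 1 ^ n := by
  have hc := hB.regular.connected
  induction n with
  | zero => rw [pow_zero, hc.zero_eq]
  | succ n ih =>
    apply le_antisymm
    · intro b hb
      obtain ⟨x, hli, hsp⟩ := hB.exists_basis
      have hx : ∀ i, x i ∈ ℬ 1 := fun i => hsp ▸ Submodule.subset_span ⟨i, rfl⟩
      obtain ⟨F, G, h⟩ := hB.exists_isAdaptedResolution hli hsp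
      obtain ⟨u, hu⟩ := h.gen b (IsConnectedGraded.mem_augIdeal_of_mem n.succ_pos hb)
      rw [← hc.proj_of_mem hb, ← hu, dotProduct, map_sum, pow_succ, ← ih]
      refine Submodule.sum_mem _ fun i _ => ?_
      rw [hc.proj_mul_right n _ (hx i)]
      exact Submodule.mul_mem_mul (hc.proj_mem _ _) (hx i)
    · rw [pow_succ, ← ih, Submodule.mul_le]
      exact fun a ha b hb => hc.mul_mem ha hb

/-- If the relations modulo two generators form a line spanned by a nondegenerate form, then the
span of these generators is normal. -/
theorem span_inl_mul_comm_and_sum_inr_mem [IsDomain B] {x : Fin 2 ⊕ Fin 2 → B}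
    (hli : LinearIndependent k x) (hsp : Submodule.span k (Set.range x) = ℬ 1)
    {q : Fin 2 → Fin 2 → k} (hq : q 0 0 * q 1 1 - q 0 1 * q 1 0 ≠ 0)
    (hR : ∀ r ∈ relSpace (k := k) x, ∃ t : k, ∀ i j, r (inr i) (inr j) = t * q i j)
    (hex : ∃ r ∈ relSpace (k := k) x, ∃ i j, r (inr i) (inr j) ≠ 0) :
    Submodule.span k (Set.range (x ∘ inl)) * ℬ 1 = ℬ 1 * Submodule.span k (Set.range (x ∘ inl)) ∧
      ∑ i, ∑ j, q i j • (x (inr i) * x (inr j)) ∈ Submodule.span k (Set.range (x ∘ inl)) * ℬ 1 := by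
  obtain ⟨w, hw, -⟩ := hB.exists_isSuperpotential hli hsp
  obtain ⟨r, hr, i, j, hij⟩ := hex
  have hq1 : ∀ f : Fin 2 → k, (∀ j, ∑ i, f i * q i j = 0) → f = 0 := by
    intro f hf
    have h0 := hf 0
    have h1 := hf 1
    rw [Fin.sum_univ_two] at h0 h1
    ext i
    refine (mul_eq_zero.1 ?_).resolve_left hq
    revert i
    refine Fin.forall_fin_two.2 ⟨?_, ?_⟩
    · linear_combination q 1 1 * h0 - q 1 0 * h1
    · linear_combination q 0 0 * h1 - q 0 1 * h0
  have hq2 : ∀ f : Fin 2 → k, (∀ i, ∑ j, q i j * f j = 0) → f = 0 := by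
    intro f hf
    have h0 := hf 0
    have h1 := hf 1
    rw [Fin.sum_univ_two] at h0 h1
    ext i
    refine (mul_eq_zero.1 ?_).resolve_left hq
    revert i
    refine Fin.forall_fin_two.2 ⟨?_, ?_⟩
    · linear_combination q 1 1 * h0 - q 0 1 * h1
    · linear_combination q 0 0 * h1 - q 1 0 * h0
  rw [← hsp]
  exact ⟨hw.span_inl_mul_comm q hq1 hq2 hR hr hij, hw.sum_inr_mem q hq1 hq2 hR hr hij⟩

end IsRegularOfType14641

end DoubleExt
end

/-! ### The case of a regular quotient of dimension two. -/

noncomputable section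

namespace DoubleExt

open Sum

variable {k : Type u} {B : Type v} [Field k] [Ring B] [Algebra k B] {ℬ : ℕ → Submodule k B}

/-- A subspace of a finite-dimensional subspace is spanned by a part of a basis. -/
theorem exists_linearIndependent_sum {V X : Submodule k B} [Module.Finite k V] (hX : X ≤ V) {m : ℕ}
    (hm : Module.finrank k X = m) :
    ∃ (n : ℕ) (x : Fin m ⊕ Fin n → B), LinearIndependent k x ∧
      Submodule.span k (Set.range x) = V ∧ Submodule.span k (Set.range (x ∘ inl)) = X := by
  obtain ⟨Z, hZ⟩ := X.exists_isCompl
  have hsup : X ⊔ Z ⊓ V = V := by rw [← sup_inf_assoc_of_le Z hX, hZ.sup_eq_top, top_inf_eq]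
  have := Submodule.finiteDimensional_of_le hX
  have := Submodule.finiteDimensional_of_le (inf_le_right : Z ⊓ V ≤ V)
  obtain ⟨u, hu, hus⟩ := exists_linearIndependent_fin hm
  obtain ⟨v, hv, hvs⟩ := exists_linearIndependent_fin (X := Z ⊓ V) rfl
  refine ⟨_, Sum.elim u v, hu.sum_type hv ?_, ?_, ?_⟩
  · rw [hus, hvs]
    exact hZ.disjoint.mono_right inf_le_left
  · rw [Set.Sum.elim_range, Submodule.span_union, hus, hvs, hsup]
  · rw [Sum.elim_comp_inl, hus]

/-- The matrices whose rows in the second part of the index set vanish. -/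
def rowsZero (k α β : Type*) [Field k] : Submodule k (α ⊕ β → α ⊕ β → k) where
  carrier := {r | ∀ i j, r (inr i) j = 0}
  add_mem' hr hs i j := by simp [hr i j, hs i j]
  zero_mem' _ _ := rfl
  smul_mem' c r hr i j := by simp [hr i j]

/-- Modulo relations with an α-generator on the left, a relation is determined by its mixed block
and by one further scalar, since its β-block is a multiple of q. -/
theorem finrank_le_rowsZero {α β : Type*} [Fintype α] [Fintype β]
    (R : Submodule k (α ⊕ β → α ⊕ β → k)) {q : β → β → k}
    (hR : ∀ r ∈ R, ∃ t : k, ∀ i j, r (inr i) (inr j) = t * q i j) :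
    Module.finrank k R ≤ Module.finrank k ↥(R ⊓ rowsZero k α β) +
      (Fintype.card β * Fintype.card α + 1) := by
  obtain ⟨e, he⟩ : ∃ e : (β → β → k) →ₗ[k] k, ∀ t : k, e (t • q) = 0 → t • q = 0 := by
    by_cases hq : q = 0
    · exact ⟨0, by simp [hq]⟩
    · obtain ⟨i, j, hij⟩ : ∃ i j, q i j ≠ 0 := by
        by_contra! h
        exact hq (by ext i j; exact h i j)
      refine ⟨LinearMap.proj j ∘ₗ LinearMap.proj i, fun t ht => ?_⟩
      have : t * q i j = 0 := ht
      rw [(mul_eq_zero.1 this).resolve_right hij, zero_smul]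
  let Φ : (α ⊕ β → α ⊕ β → k) →ₗ[k] (β → α → k) × k :=
    LinearMap.prod
      { toFun := fun r i j => r (inr i) (inl j), map_add' := fun _ _ => rfl,
        map_smul' := fun _ _ => rfl }
      (e ∘ₗ { toFun := fun r i j => r (inr i) (inr j), map_add' := fun _ _ => rfl,
              map_smul' := fun _ _ => rfl })
  have h1 : (LinearMap.ker (Φ.domRestrict R)).map R.subtype ≤ R ⊓ rowsZero k α β := by
    rintro _ ⟨⟨r, hr⟩, hr0, rfl⟩
    refine ⟨hr, ?_⟩
    have hr1 := congrArg Prod.fst (LinearMap.mem_ker.1 hr0)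
    have hr2 : e (fun i j => r (inr i) (inr j)) = 0 := congrArg Prod.snd (LinearMap.mem_ker.1 hr0)
    obtain ⟨t, ht⟩ := hR r hr
    have ht' : (fun i j => r (inr i) (inr j)) = t • q := by ext i j; exact ht i j
    rw [ht'] at hr2
    rintro i (j | j)
    · exact congrFun (congrFun hr1 i) j
    · rw [he t hr2] at ht'
      exact congrFun (congrFun ht' i) j
  have h2 := LinearMap.finrank_range_add_finrank_ker (Φ.domRestrict R)
  have h3 := Submodule.finrank_le (LinearMap.range (Φ.domRestrict R))
  have h4 : Module.finrank k ((β → α → k) × k) = Fintype.card β * Fintype.card α + 1 := by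
    simp [Module.finrank_pi_fintype]
  have h5 := Submodule.finrank_mono h1
  rw [← LinearEquiv.finrank_eq (Submodule.equivMapOfInjective _ R.injective_subtype _)] at h5
  omega

/-- Two quadratic relations between two linearly independent elements of a domain are
proportional. -/
theorem exists_smul_eq_of_relations [IsAlgClosed k] [IsDomain B] {u : Fin 2 → B}
    (hu : LinearIndependent k u) {c d : Fin 2 → Fin 2 → k} (hd0 : d ≠ 0)
    (hc : ∑ i, ∑ j, c i j • (u i * u j) = 0) (hd : ∑ i, ∑ j, d i j • (u i * u j) = 0) :
    ∃ t : k, c = t • d := by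
  have hdet := two_form_det_ne_zero hu hd0 hd
  -- The pencil spanned by c and d contains a singular member c + l d, and a singular relation in a
  -- domain is zero.
  obtain ⟨l, hl⟩ := IsAlgClosed.exists_root
    (Polynomial.C (d 0 0 * d 1 1 - d 0 1 * d 1 0) * Polynomial.X ^ 2 +
      Polynomial.C (c 0 0 * d 1 1 + c 1 1 * d 0 0 - c 0 1 * d 1 0 - c 1 0 * d 0 1) * Polynomial.X +
      Polynomial.C (c 0 0 * c 1 1 - c 0 1 * c 1 0))
    (by rw [Polynomial.degree_quadratic hdet]; decide)
  simp only [Polynomial.IsRoot, Polynomial.eval_add, Polynomial.eval_mul, Polynomial.eval_C,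
    Polynomial.eval_pow, Polynomial.eval_X] at hl
  refine ⟨-l, ?_⟩
  by_contra hne
  refine two_form_det_ne_zero hu (c := c + l • d) (fun h => hne ?_)
    (mem_relSpace.1 (add_mem (mem_relSpace.2 hc) (Submodule.smul_mem _ l (mem_relSpace.2 hd)))) ?_
  · rw [neg_smul, eq_neg_iff_add_eq_zero, h]
  · simp only [Pi.add_apply, Pi.smul_apply, smul_eq_mul]
    linear_combination hl

namespace IsRegularOfType14641

variable (hB : IsRegularOfType14641 ℬ)
include hB

/-- Relations modulo a subspace of dimension at most one do not form a line. -/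
theorem two_le_of_relations [IsDomain B] {m n : ℕ} {x : Fin m ⊕ Fin n → B}
    (hli : LinearIndependent k x) (hsp : Submodule.span k (Set.range x) = ℬ 1)
    {q : Fin n → Fin n → k}
    (hR : ∀ r ∈ relSpace (k := k) x, ∃ t : k, ∀ i j, r (inr i) (inr j) = t * q i j) : 2 ≤ m := by
  by_contra! hm
  obtain ⟨w, hw, -⟩ := hB.exists_isSuperpotential hli hsp
  have h1 := finrank_le_rowsZero _ hR
  have h2 : relSpace (k := k) x ⊓ rowsZero k (Fin m) (Fin n) = ⊥ := by
    rw [eq_bot_iff]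
    rintro r ⟨hr, hr0⟩
    have : Subsingleton (Fin m) := Fin.subsingleton_iff_le_one.2 (by omega)
    refine hw.eq_zero_of_rank_le_one hr (Sum.elim 1 0) (fun j => ∑ i, r (inl i) j) ?_
    rintro (i | i) j
    · rw [Fintype.sum_subsingleton _ i]
      simp
    · simp [hr0 i j]
  have h3 := hB.card_eq hli hsp
  rw [h2, finrank_bot, hw.finrank_eq] at h1
  simp only [Fintype.card_sum, Fintype.card_fin] at h1 h3
  -- With m + n = 4 the estimate reads 6 ≤ n m + 1, which fails for m ≤ 1.
  interval_cases m <;> omega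

/-- The dimension of the span of x₁, x₂ is not assumed; that it is two follows because the relations
modulo this span are multiples of one form. -/
theorem exists_isFrame_of_quotient [IsAlgClosed k] [IsDomain B] {x₁ x₂ : B} (h₁ : x₁ ∈ ℬ 1)
    (h₂ : x₂ ∈ ℬ 1) {c : Matrix (Fin 2) (Fin 2) k} (hc0 : c ≠ 0)
    (hc : ∑ i, ∑ j, c i j • (![x₁, x₂] i * ![x₁, x₂] j) = 0)
    (hreg : IsASRegular (quotGrading ℬ (TwoSidedIdeal.span {x₁, x₂})) 2) :
    ∃ (x y : Fin 2 → B) (p p' p₁₂ p₁₁ : k), IsFrame ℬ x y p p' p₁₂ p₁₁ := by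
  have := hB.finite 1
  have hS : Set.range ![x₁, x₂] = {x₁, x₂} := by simp [Set.pair_comm]
  have hX : Submodule.span k {x₁, x₂} ≤ ℬ 1 := Submodule.span_le.2 (Set.pair_subset h₁ h₂)
  obtain ⟨m, hm⟩ : ∃ m, Module.finrank k (Submodule.span k {x₁, x₂}) = m := ⟨_, rfl⟩
  obtain ⟨n, x, hli, hsp, hxl⟩ := exists_linearIndependent_sum hX hm
  have hx : ∀ i, x i ∈ ℬ 1 := fun i => hsp ▸ Submodule.subset_span ⟨i, rfl⟩
  obtain ⟨F, G, hFG⟩ := hB.exists_isAdaptedResolution hli hsp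
  obtain ⟨q, hR, hex, hq⟩ :=
    hFG.exists_form_of_quotient hB.regular.connected hx hli hxl.symm hreg
  have h2m := hB.two_le_of_relations hli hsp hR
  have hu : LinearIndependent k ![x₁, x₂] := by
    rw [linearIndependent_iff_card_le_finrank_span, hS, Set.finrank, hm, Fintype.card_fin]
    exact h2m
  obtain rfl : m = 2 := by
    rw [← hm, ← hS, finrank_span_eq_card hu, Fintype.card_fin]
  obtain rfl : n = 2 := by
    have := hB.card_eq hli hsp
    simp only [Fintype.card_sum, Fintype.card_fin] at this
    omega
  have hq0 : q 0 0 * q 1 1 - q 0 1 * q 1 0 ≠ 0 := by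
    intro h0
    obtain ⟨a, ha⟩ := hq ![1, 0]
    obtain ⟨b, hb⟩ := hq ![0, 1]
    have ha0 := ha 0
    have ha1 := ha 1
    have hb0 := hb 0
    have hb1 := hb 1
    simp only [Fin.sum_univ_two, Matrix.cons_val_zero, Matrix.cons_val_one] at ha0 ha1 hb0 hb1
    refine one_ne_zero (α := k) ?_
    linear_combination (a 0 * b 1 - a 1 * b 0) * h0 - (q 1 0 * b 0 + q 1 1 * b 1) * ha0 - hb1 +
      (q 1 0 * a 0 + q 1 1 * a 1) * hb0
  obtain ⟨hcomm, hsum⟩ := hB.span_inl_mul_comm_and_sum_inr_mem hli hsp hq0 hR hex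
  have hXu : Submodule.span k (Set.range (x ∘ inl)) = Submodule.span k (Set.range ![x₁, x₂]) := by
    rw [hxl, hS]
  have hsup := hsp ▸ span_inl_sup_span_inr (k := k) (x := x)
  rw [hXu] at hcomm hsum hsup
  exact exists_isFrame hB.regular.connected hsup hB.pow_eq hcomm
    (two_form_det_ne_zero hu hc0 hc) hc hq0 hsum hB.six_mul_finrank

end IsRegularOfType14641

end DoubleExt
end

/-! ### Degrees of the generators of a right double extension. -/

noncomputable section

namespace DoubleExt

open Sum

variable {k : Type u} {B : Type v} [Field k] [Ring B] [Algebra k B] {ℬ : ℕ → Submodule k B}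

namespace IsRightDoubleExtension

variable {A : Subalgebra k B} {y₁ y₂ : B} (h : IsRightDoubleExtension ℬ A y₁ y₂)
include h

theorem linearIndependent : LinearIndependent A fun n : ℕ × ℕ => y₁ ^ n.1 * y₂ ^ n.2 :=
  h.2.2.2.1.1

/-- Freeness for the six monomials of order at most two; from here the coefficients of every
quadratic relation are read off. -/
theorem eq_zero_of_quadratic {a b c d e f : A}
    (h0 : (a : B) + b * y₁ + c * y₂ + d * y₁ ^ 2 + e * (y₁ * y₂) + f * y₂ ^ 2 = 0) :
    a = 0 ∧ b = 0 ∧ c = 0 ∧ d = 0 ∧ e = 0 ∧ f = 0 := by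
  have h1 := Fintype.linearIndependent_iff.1 (h.linearIndependent.comp
    ![(0, 0), (1, 0), (0, 1), (2, 0), (1, 1), (0, 2)] (by decide)) ![a, b, c, d, e, f] (by
      simpa [Fin.sum_univ_succ, Subalgebra.smul_def, ← add_assoc] using h0)
  exact ⟨h1 0, h1 1, h1 2, h1 3, h1 4, h1 5⟩

/-- In the expansion over A, only the constant term and the terms linear in a generator of degree
one contribute to degree one, the latter with scalar coefficients. -/
theorem mem_of_mem_one (hc : IsConnectedGraded ℬ) {d₁ d₂ : ℕ} (hd₁ : 1 ≤ d₁) (hd₂ : 1 ≤ d₂)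
    (hy₁ : y₁ ∈ ℬ d₁) (hy₂ : y₂ ∈ ℬ d₂) :
    ℬ 1 ≤ Subalgebra.toSubmodule A ⊓ ℬ 1 ⊔
      Submodule.span k {y | (y = y₁ ∧ d₁ = 1) ∨ (y = y₂ ∧ d₂ = 1)} := by
  intro b hb
  obtain ⟨f, hf⟩ := h.2.2.2.1.2 b
  rw [← hc.proj_of_mem hb, ← hf]
  simp only [Finsupp.sum, map_sum]
  refine Submodule.sum_mem _ ?_
  rintro ⟨m, n⟩ -
  have hmem : y₁ ^ m * y₂ ^ n ∈ ℬ (m * d₁ + n * d₂) :=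
    hc.mul_mem (hc.pow_mem hy₁ m) (hc.pow_mem hy₂ n)
  have hA (a : A) (i : ℕ) : hc.proj i (a : B) ∈ A := by
    have := h.1.proj_map hc A.val.toLinearMap (fun _ _ => id) i a
    exact this ▸ Subtype.property _
  have scalar (t : B) (ht : t ∈ ℬ 0) (y : B)
      (hy : y ∈ {y | (y = y₁ ∧ d₁ = 1) ∨ (y = y₂ ∧ d₂ = 1)}) :
      t * y ∈ Subalgebra.toSubmodule A ⊓ ℬ 1 ⊔
        Submodule.span k {y | (y = y₁ ∧ d₁ = 1) ∨ (y = y₂ ∧ d₂ = 1)} := by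
    obtain ⟨s, rfl⟩ := hc.mem_zero_iff.1 ht
    rw [← Algebra.smul_def]
    exact Submodule.mem_sup_right (Submodule.smul_mem _ _ (Submodule.subset_span hy))
  have big (hlt : 1 < m * d₁ + n * d₂) : hc.proj 1 ((f (m, n) : B) * (y₁ ^ m * y₂ ^ n)) ∈
      Subalgebra.toSubmodule A ⊓ ℬ 1 ⊔
        Submodule.span k {y | (y = y₁ ∧ d₁ = 1) ∨ (y = y₂ ∧ d₂ = 1)} := by
    rw [hc.proj_mul_right_of_lt hlt _ hmem]
    exact zero_mem _
  match m, n with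
  | 0, 0 =>
    rw [pow_zero, pow_zero, mul_one, mul_one]
    exact Submodule.mem_sup_left ⟨hA _ _, hc.proj_mem _ _⟩
  | 1, 0 =>
    by_cases hd : d₁ = 1
    · rw [pow_zero, pow_one, mul_one, hc.proj_mul_right 0 _ (m := 1) (hd ▸ hy₁)]
      exact scalar _ (hc.proj_mem _ _) _ (Or.inl ⟨rfl, hd⟩)
    · exact big (by omega)
  | 0, 1 =>
    by_cases hd : d₂ = 1
    · rw [pow_zero, pow_one, one_mul, hc.proj_mul_right 0 _ (m := 1) (hd ▸ hy₂)]
      exact scalar _ (hc.proj_mem _ _) _ (Or.inr ⟨rfl, hd⟩)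
    · exact big (by omega)
  | m + 2, n => exact big (by nlinarith)
  | 1, n + 1 => exact big (by nlinarith)
  | 0, n + 2 => exact big (by nlinarith)

end IsRightDoubleExtension

namespace IsRegularOfType14641

variable (hB : IsRegularOfType14641 ℬ)
include hB

theorem eq_top_of_mul_mem {W : Submodule k B} (h1 : 1 ∈ W) (hW : ∀ x ∈ ℬ 1, ∀ a ∈ W, x * a ∈ W) :
    W = ⊤ := by
  have hpow : ∀ n, ℬ n ≤ W := by
    intro n
    rw [hB.pow_eq n]
    induction n with
    | zero => rw [pow_zero, Submodule.one_le]; exact h1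
    | succ n ih =>
      rw [pow_succ', Submodule.mul_le]
      exact fun x hx a ha => hW x hx a (ih ha)
  rw [eq_top_iff]
  intro b _
  obtain ⟨n, hn⟩ := hB.regular.connected.exists_eq_sum_proj b
  rw [hn n le_rfl]
  exact Submodule.sum_mem _ fun i _ => hpow i (hB.regular.connected.proj_mem _ _)

theorem subalgebra_eq_top {A : Subalgebra k B} (hA : ℬ 1 ≤ Subalgebra.toSubmodule A) : A = ⊤ := by
  rw [← Algebra.toSubmodule_eq_top]
  exact hB.eq_top_of_mul_mem A.one_mem fun x hx a ha => A.mul_mem (hA hx) ha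

/-- The algebra is not an extension of a graded subalgebra by one generator of degree one and a
further generator that is not needed to generate. -/
theorem false_of_three [IsAlgClosed k] [IsDomain B] {A : Subalgebra k B} {y z : B} (hy : y ∈ ℬ 1)
    (hV : ℬ 1 ≤ Subalgebra.toSubmodule A ⊓ ℬ 1 ⊔ Submodule.span k {y})
    (key : ∀ a b c d : A, (a : B) + b * y + c * z + d * y ^ 2 = 0 → b = 0 ∧ d = 0)
    (hz : z ∉ Submodule.span A (Set.range fun j : ℕ => y ^ j))
    (hyA : ∀ r : A, ∃ a b c : A, y * (r : B) = a * y + b * z + c) : False := by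
  have := hB.finite 1
  have := Submodule.finiteDimensional_of_le (inf_le_right : Subalgebra.toSubmodule A ⊓ ℬ 1 ≤ ℬ 1)
  obtain ⟨m, hm⟩ : ∃ m, Module.finrank k ↥(Subalgebra.toSubmodule A ⊓ ℬ 1) = m := ⟨_, rfl⟩
  obtain ⟨u, hu, hus⟩ := exists_linearIndependent_fin hm
  have huA : ∀ i, u i ∈ Subalgebra.toSubmodule A ⊓ ℬ 1 := fun i =>
    hus ▸ Submodule.subset_span ⟨i, rfl⟩
  have hyA' (t : k) (ht : t • y ∈ A) : t = 0 := by
    have := (key ⟨t • y, ht⟩ (algebraMap k A (-t)) 0 0 (by simp [Algebra.smul_def])).1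
    simpa using this
  have hy0 : y ≠ 0 := by
    rintro rfl
    exact one_ne_zero (hyA' 1 (by simp))
  let x : Fin m ⊕ Unit → B := Sum.elim u fun _ => y
  have hli : LinearIndependent k x := by
    refine hu.sum_type (LinearIndependent.of_subsingleton () hy0) ?_
    rw [hus, Set.range_const, Submodule.disjoint_def]
    rintro b hb hby
    obtain ⟨t, rfl⟩ := Submodule.mem_span_singleton.1 hby
    rw [hyA' t hb.1, zero_smul]
  have hsp : Submodule.span k (Set.range x) = ℬ 1 := by
    rw [Set.Sum.elim_range, Submodule.span_union, hus, Set.range_const]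
    exact le_antisymm (sup_le inf_le_right
      ((Submodule.span_singleton_le_iff_mem _ _).2 hy)) hV
  obtain rfl : m = 3 := by
    have := hB.card_eq hli hsp
    simpa using this
  obtain ⟨w, hw, ht⟩ := hB.exists_isSuperpotential hli hsp
  choose a b c habc using fun j => hyA ⟨u j, (huA j).1⟩
  have hrel (r : Fin 3 ⊕ Unit → Fin 3 ⊕ Unit → k) : ∑ i, ∑ j, r i j • (x i * x j) =
      ∑ i, ∑ j, r (inl i) (inl j) • (u i * u j) + (∑ i, r (inl i) (inr ()) • u i) * y +
        ∑ j, r (inr ()) (inl j) • (y * u j) + r (inr ()) (inr ()) • (y * y) := by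
    simp only [Fintype.sum_sum_type, Finset.univ_unique, Finset.sum_singleton, x, Sum.elim_inl,
      Sum.elim_inr, PUnit.default_eq_unit, Finset.sum_add_distrib, Finset.sum_mul, smul_mul_assoc]
    abel
  -- Expand a relation over A in 1, y, z, y², moving y past A₁ by the commutation rule; `key` says
  -- that the coefficients of y and y² vanish.
  have hcoeff (r) (hr : r ∈ relSpace (k := k) x) :
      (∑ i, r (inl i) (inr ()) • u i + ∑ j, r (inr ()) (inl j) • (a j : B) = 0) ∧
        r (inr ()) (inr ()) = 0 := by
    let u' (i) : A := ⟨u i, (huA i).1⟩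
    have h1 := key
      (∑ i, ∑ j, r (inl i) (inl j) • (u' i * u' j) + ∑ j, r (inr ()) (inl j) • c j)
      (∑ i, r (inl i) (inr ()) • u' i + ∑ j, r (inr ()) (inl j) • a j)
      (∑ j, r (inr ()) (inl j) • b j) (algebraMap k A (r (inr ()) (inr ()))) (by
        rw [← mem_relSpace.1 hr, hrel]
        simp only [habc, smul_add, Finset.sum_add_distrib, Subalgebra.coe_add,
          AddSubmonoidClass.coe_finsetSum, Subalgebra.coe_smul, Subalgebra.coe_mul, u', add_mul,
          Finset.sum_mul, smul_mul_assoc, Subalgebra.coe_algebraMap, ← Algebra.smul_def, pow_two]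
        abel)
    refine ⟨?_, ?_⟩
    · simpa [u'] using congrArg (Subtype.val (p := (· ∈ A))) h1.1
    · simpa using h1.2
  -- The relations supplied by `exists_rel_of_three` move y past A₁ without using z. Hence the
  -- powers of y span B already over the algebra generated by A₁, and z is redundant.
  let A' := Algebra.adjoin k (Set.range u)
  have hA' : A' ≤ A := Algebra.adjoin_le (Set.range_subset_iff.2 fun i => (huA i).1)
  have huA' : ∀ i, u i ∈ A' := fun i => Algebra.subset_adjoin ⟨i, rfl⟩
  have hyu (j) : ∃ f ∈ A', ∃ g ∈ A', y * u j = f * y + g := by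
    obtain ⟨r, hr, hrj⟩ := hw.exists_rel_of_three hli ht (fun r hr => (hcoeff r hr).2)
      (fun r hr hr0 i => by
        have h1 := (hcoeff r hr).1
        simp only [hr0, zero_smul, Finset.sum_const_zero, add_zero] at h1
        rcases i with i | _
        · exact Fintype.linearIndependent_iff.1 hu _ h1 i
        · exact hr0 _) (Pi.single j 1)
    have h1 := mem_relSpace.1 hr
    rw [hrel, (hcoeff r hr).2, zero_smul, add_zero] at h1
    have h2 : ∑ i, r (inr ()) (inl i) • (y * u i) = y * u j := by simp [hrj, Pi.single_apply]
    rw [h2] at h1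
    refine ⟨-∑ i, r (inl i) (inr ()) • u i, neg_mem (sum_mem fun i _ => A'.smul_mem (huA' i) _),
      -∑ i, ∑ j, r (inl i) (inl j) • (u i * u j),
      neg_mem (sum_mem fun i _ => sum_mem fun j _ => A'.smul_mem (mul_mem (huA' i) (huA' j)) _), ?_⟩
    rw [eq_neg_of_add_eq_zero_right h1]
    simp only [neg_mul]
    abel
  have hyA'' (s) (hs : s ∈ A') : ∃ f ∈ A', ∃ g ∈ A', y * s = f * y + g := by
    induction hs using Algebra.adjoin_induction with
    | mem s hs => obtain ⟨j, rfl⟩ := hs; exact hyu j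
    | algebraMap t =>
      exact ⟨_, A'.algebraMap_mem t, 0, zero_mem _, by rw [Algebra.commutes, add_zero]⟩
    | add s s' _ _ h h' =>
      obtain ⟨f, hf, g, hg, h⟩ := h
      obtain ⟨f', hf', g', hg', h'⟩ := h'
      exact ⟨_, add_mem hf hf', _, add_mem hg hg', by rw [mul_add, h, h', add_mul]; abel⟩
    | mul s s' _ hs' h h' =>
      obtain ⟨f, hf, g, hg, h⟩ := h
      obtain ⟨f', hf', g', hg', h'⟩ := h'
      refine ⟨_, mul_mem hf hf', _, add_mem (mul_mem hf hg') (mul_mem hg hs'), ?_⟩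
      rw [← mul_assoc, h, add_mul, mul_assoc, h', mul_add, mul_assoc, add_assoc]
  let W : Submodule A' B := Submodule.span A' (Set.range fun j : ℕ => y ^ j)
  have hW : W.restrictScalars k = ⊤ := by
    refine hB.eq_top_of_mul_mem (Submodule.subset_span ⟨0, pow_zero y⟩) fun v hv s hs => ?_
    have hus' (i) : u i * s ∈ W := W.smul_mem ⟨u i, huA' i⟩ hs
    have hys : y * s ∈ W := by
      change s ∈ Submodule.span A' _ at hs
      clear hus'
      induction hs using Submodule.span_induction with
      | mem s hs =>
        obtain ⟨j, rfl⟩ := hs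
        exact Submodule.subset_span ⟨j + 1, pow_succ' y j⟩
      | zero => rw [mul_zero]; exact zero_mem _
      | add s s' _ _ h h' => rw [mul_add]; exact add_mem h h'
      | smul e s hs h =>
        obtain ⟨f, hf, g, hg, hfg⟩ := hyA'' e e.2
        rw [Subalgebra.smul_def, smul_eq_mul, ← mul_assoc, hfg, add_mul, mul_assoc]
        exact add_mem (W.smul_mem ⟨f, hf⟩ h) (W.smul_mem ⟨g, hg⟩ hs)
    rw [← hsp] at hv
    change v * s ∈ W
    induction hv using Submodule.span_induction with
    | mem v hv =>
      obtain ⟨i | i, rfl⟩ := hv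
      · exact hus' i
      · exact hys
    | zero => rw [zero_mul]; exact zero_mem _
    | add v v' _ _ h h' => rw [add_mul]; exact add_mem h h'
    | smul t v _ h =>
      rw [smul_mul_assoc]
      exact (W.restrictScalars k).smul_mem t h
  have hzW : z ∈ W := by
    change z ∈ W.restrictScalars k
    rw [hW]; trivial
  refine hz ((show ∀ s ∈ W, s ∈ Submodule.span A _ from fun s hs => ?_) z hzW)
  induction hs using Submodule.span_induction with
  | mem s hs => exact Submodule.subset_span hs
  | zero => exact zero_mem _
  | add s s' _ _ h h' => exact add_mem h h'
  | smul e s _ h => exact Submodule.smul_mem _ (⟨e, hA' e.2⟩ : A) h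

end IsRegularOfType14641

end DoubleExt
end

/-! ### A frame inside every right double extension. -/

noncomputable section

namespace DoubleExt

open Sum

variable {k : Type u} {B : Type v} [Field k] [Ring B] [Algebra k B] {ℬ : ℕ → Submodule k B}

namespace IsRightDoubleExtension

variable {A : Subalgebra k B} {y₁ y₂ : B} (h : IsRightDoubleExtension ℬ A y₁ y₂)
include h

/-- The generators in a right double extension have degree one. -/
theorem mem_one [IsAlgClosed k] [IsDomain B] (hB : IsRegularOfType14641 ℬ) :
    y₁ ∈ ℬ 1 ∧ y₂ ∈ ℬ 1 ∧
      ℬ 1 ≤ Subalgebra.toSubmodule A ⊓ ℬ 1 ⊔ Submodule.span k {y₁, y₂} := by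
  obtain ⟨d₁, d₂, hd₁, hd₂, hy₁, hy₂, -⟩ := h.2.2.1
  have hV := h.mem_of_mem_one hB.regular.connected hd₁ hd₂ hy₁ hy₂
  by_cases h₁ : d₁ = 1 <;> by_cases h₂ : d₂ = 1
  · subst h₁ h₂
    refine ⟨hy₁, hy₂, hV.trans_eq ?_⟩
    congr 2
    ext y
    simp
  · subst h₁
    exfalso
    refine hB.false_of_three (A := A) (z := y₂) hy₁ ?_ ?_ ?_ h.2.2.2.2.1
    · simpa [h₂] using hV
    · intro a b c d h0
      obtain ⟨-, hb, -, hd, -⟩ := h.eq_zero_of_quadratic (a := a) (b := b) (c := c) (d := d)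
        (e := 0) (f := 0) (by simpa using h0)
      exact ⟨hb, hd⟩
    · have := h.linearIndependent.notMem_span_image (s := Set.range fun j : ℕ => (j, 0))
        (x := (0, 1)) (by simp)
      rw [← Set.range_comp] at this
      simpa [Function.comp_def] using this
  · subst h₂
    exfalso
    refine hB.false_of_three (A := A) (z := y₁) hy₂ ?_ ?_ ?_ fun r => ?_
    · simpa [h₁] using hV
    · intro a b c d h0
      obtain ⟨-, -, hb, -, -, hd⟩ := h.eq_zero_of_quadratic (a := a) (b := c) (c := b) (d := 0)
        (e := 0) (f := d) (by rw [← h0]; simp; abel)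
      exact ⟨hb, hd⟩
    · have := h.linearIndependent.notMem_span_image (s := Set.range fun j : ℕ => (0, j))
        (x := (1, 0)) (by simp)
      rw [← Set.range_comp] at this
      simpa [Function.comp_def] using this
    · obtain ⟨a, b, c, hr⟩ := h.2.2.2.2.2 r
      exact ⟨b, a, c, by rw [hr]; abel⟩
  · exfalso
    -- With neither generator in degree one, A contains B₁ and hence is B; then y₁ lies in A,
    -- against freeness.
    have hA : A = ⊤ := hB.subalgebra_eq_top (hV.trans (by simp [h₁, h₂]))
    subst hA
    obtain ⟨-, h1, -⟩ := h.eq_zero_of_quadratic (a := -⟨y₁, trivial⟩) (b := 1) (c := 0) (d := 0)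
      (e := 0) (f := 0) (by simp)
    exact one_ne_zero h1

theorem linearIndependent_elim {m : ℕ} {u : Fin m → B} (hu : LinearIndependent k u)
    (huA : ∀ i, u i ∈ A) : LinearIndependent k (Sum.elim u ![y₁, y₂]) := by
  have := h.1.nontrivial
  have key (s t : k) (hst : s • y₁ + t • y₂ ∈ A) : s = 0 ∧ t = 0 := by
    obtain ⟨-, hs, ht, -⟩ := h.eq_zero_of_quadratic (a := ⟨_, hst⟩) (b := algebraMap k A (-s))
      (c := algebraMap k A (-t)) (d := 0) (e := 0) (f := 0) (by simp [Algebra.smul_def])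
    rw [FaithfulSMul.algebraMap_eq_zero_iff, neg_eq_zero] at hs ht
    exact ⟨hs, ht⟩
  refine hu.sum_type (LinearIndependent.pair_iff.2 fun s t hst => key s t ?_) ?_
  · rw [hst]; exact zero_mem _
  · rw [Submodule.disjoint_def]
    intro b hb hby
    rw [Matrix.range_cons_cons_empty, Submodule.mem_span_pair] at hby
    obtain ⟨s, t, rfl⟩ := hby
    have hsub : Submodule.span k (Set.range u) ≤ Subalgebra.toSubmodule A :=
      Submodule.span_le.2 (Set.range_subset_iff.2 huA)
    obtain ⟨rfl, rfl⟩ := key s t (hsub hb)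
    simp

/-- A regular algebra of type (14641) that is a right double extension has a frame with the same
subalgebra and the same generators. -/
theorem exists_isFrame [IsAlgClosed k] [IsDomain B] (hB : IsRegularOfType14641 ℬ) {p₁₂ p₁₁ : k}
    {τ₁ τ₂ τ₀ : A}
    (hrel : y₂ * y₁ = p₁₂ • (y₁ * y₂) + p₁₁ • y₁ ^ 2 + τ₁ * y₁ + τ₂ * y₂ + τ₀) :
    ∃ (x : Fin 2 → B) (p q : k), Algebra.adjoin k (Set.range x) ≤ A ∧
      IsFrame ℬ x ![y₁, y₂] p q p₁₂ p₁₁ := by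
  obtain ⟨hy₁, hy₂, hV⟩ := h.mem_one hB
  have := hB.finite 1
  have := Submodule.finiteDimensional_of_le (inf_le_right : Subalgebra.toSubmodule A ⊓ ℬ 1 ≤ ℬ 1)
  obtain ⟨m, hm⟩ : ∃ m, Module.finrank k ↥(Subalgebra.toSubmodule A ⊓ ℬ 1) = m := ⟨_, rfl⟩
  obtain ⟨u, hu, hus⟩ := exists_linearIndependent_fin hm
  have huA : ∀ i, u i ∈ Subalgebra.toSubmodule A ⊓ ℬ 1 := fun i =>
    hus ▸ Submodule.subset_span ⟨i, rfl⟩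
  have hli := h.linearIndependent_elim hu fun i => (huA i).1
  have hsp : Submodule.span k (Set.range (Sum.elim u ![y₁, y₂])) = ℬ 1 := by
    rw [Set.Sum.elim_range, Submodule.span_union, hus, Matrix.range_cons_cons_empty]
    exact le_antisymm (sup_le inf_le_right (Submodule.span_le.2 (Set.pair_subset hy₁ hy₂))) hV
  obtain rfl : m = 2 := by
    have := hB.card_eq hli hsp
    simpa using this
  obtain ⟨x, hx⟩ : ∃ x : Fin 2 ⊕ Fin 2 → B, x = Sum.elim u ![y₁, y₂] := ⟨_, rfl⟩
  rw [← hx] at hli hsp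
  have hxu : x ∘ inl = u := by rw [hx, Sum.elim_comp_inl]
  obtain ⟨w, hw, -⟩ := hB.exists_isSuperpotential hli hsp
  let u' (i) : A := ⟨u i, (huA i).1⟩
  choose a b c habc using fun j => h.2.2.2.2.1 ⟨u j, (huA j).1⟩
  choose a' b' c' habc' using fun j => h.2.2.2.2.2 ⟨u j, (huA j).1⟩
  -- The coefficients of y₂y₁ - p₁₂ y₁y₂ - p₁₁ y₁², the part of (R1) that involves only the new
  -- generators.
  let q : Fin 2 → Fin 2 → k := ![![-p₁₁, -p₁₂], ![1, 0]]
  have hrelx (r : Fin 2 ⊕ Fin 2 → Fin 2 ⊕ Fin 2 → k) : ∑ i, ∑ j, r i j • (x i * x j) =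
      ∑ i, ∑ j, r (inl i) (inl j) • (u i * u j) + (∑ i, r (inl i) (inr 0) • u i) * y₁ +
        (∑ i, r (inl i) (inr 1) • u i) * y₂ + ∑ j, r (inr 0) (inl j) • (y₁ * u j) +
        ∑ j, r (inr 1) (inl j) • (y₂ * u j) + r (inr 0) (inr 0) • y₁ ^ 2 +
        r (inr 0) (inr 1) • (y₁ * y₂) + r (inr 1) (inr 0) • (y₂ * y₁) +
        r (inr 1) (inr 1) • y₂ ^ 2 := by
    simp only [Fintype.sum_sum_type, hx, Sum.elim_inl, Sum.elim_inr, Finset.sum_add_distrib,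
      Fin.sum_univ_two (fun i => _ • (_ * ![y₁, y₂] i)), smul_mul_assoc,
      Fin.sum_univ_two, Matrix.cons_val_zero, Matrix.cons_val_one, pow_two, add_mul]
    abel
  have hcoeff (r) (hr : r ∈ relSpace (k := k) x) :
      (∑ i, ∑ j, r (inl i) (inl j) • (u' i * u' j) + ∑ j, r (inr 0) (inl j) • c j +
        ∑ j, r (inr 1) (inl j) • c' j + r (inr 1) (inr 0) • τ₀ = 0) ∧
      (∑ i, r (inl i) (inr 0) • u' i + ∑ j, r (inr 0) (inl j) • a j +
        ∑ j, r (inr 1) (inl j) • a' j + r (inr 1) (inr 0) • τ₁ = 0) ∧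
      (∑ i, r (inl i) (inr 1) • u' i + ∑ j, r (inr 0) (inl j) • b j +
        ∑ j, r (inr 1) (inl j) • b' j + r (inr 1) (inr 0) • τ₂ = 0) ∧
      r (inr 0) (inr 0) + r (inr 1) (inr 0) * p₁₁ = 0 ∧
      r (inr 0) (inr 1) + r (inr 1) (inr 0) * p₁₂ = 0 ∧ r (inr 1) (inr 1) = 0 := by
    have h1 := h.eq_zero_of_quadratic
      (a := ∑ i, ∑ j, r (inl i) (inl j) • (u' i * u' j) + ∑ j, r (inr 0) (inl j) • c j +
        ∑ j, r (inr 1) (inl j) • c' j + r (inr 1) (inr 0) • τ₀)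
      (b := ∑ i, r (inl i) (inr 0) • u' i + ∑ j, r (inr 0) (inl j) • a j +
        ∑ j, r (inr 1) (inl j) • a' j + r (inr 1) (inr 0) • τ₁)
      (c := ∑ i, r (inl i) (inr 1) • u' i + ∑ j, r (inr 0) (inl j) • b j +
        ∑ j, r (inr 1) (inl j) • b' j + r (inr 1) (inr 0) • τ₂)
      (d := algebraMap k A (r (inr 0) (inr 0) + r (inr 1) (inr 0) * p₁₁))
      (e := algebraMap k A (r (inr 0) (inr 1) + r (inr 1) (inr 0) * p₁₂))
      (f := algebraMap k A (r (inr 1) (inr 1))) (by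
        rw [← mem_relSpace.1 hr, hrelx]
        simp only [habc, habc', hrel, smul_add, Finset.sum_add_distrib, Subalgebra.coe_add,
          AddSubmonoidClass.coe_finsetSum, Subalgebra.coe_smul, Subalgebra.coe_mul, u', add_mul,
          Finset.sum_mul, smul_mul_assoc, Subalgebra.coe_algebraMap, ← Algebra.smul_def, add_smul,
          mul_smul]
        abel)
    simpa only [FaithfulSMul.algebraMap_eq_zero_iff] using h1
  have hR : ∀ r ∈ relSpace (k := k) x, ∃ t : k, ∀ i j, r (inr i) (inr j) = t * q i j := by
    intro r hr
    obtain ⟨-, -, -, h1, h2, h3⟩ := hcoeff r hr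
    refine ⟨r (inr 1) (inr 0), Fin.forall_fin_two.2 ⟨Fin.forall_fin_two.2 ⟨?_, ?_⟩,
      Fin.forall_fin_two.2 ⟨?_, ?_⟩⟩⟩
    · simp only [q, Matrix.cons_val_zero]
      linear_combination h1
    · simp only [q, Matrix.cons_val_zero, Matrix.cons_val_one]
      linear_combination h2
    · simp [q]
    · simp [q, h3]
  -- A relation in X ⊗ V, with X the span of `u`, has its coefficients of y₁ and y₂ in A, and these
  -- vanish by freeness. So it lies in X ⊗ X and is a relation of B between the `u`.
  have hrows (r) (hr : r ∈ relSpace (k := k) x) (hr0 : ∀ i j, r (inr i) j = 0) :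
      (∀ i j, r (inl i) (inr j) = 0) ∧ ∑ i, ∑ j, r (inl i) (inl j) • (u i * u j) = 0 := by
    obtain ⟨h1, h2, h3, -⟩ := hcoeff r hr
    simp only [hr0, zero_smul, Finset.sum_const_zero, add_zero] at h1 h2 h3
    have h1' := congrArg (Subtype.val (p := (· ∈ A))) h1
    have h2' := congrArg (Subtype.val (p := (· ∈ A))) h2
    have h3' := congrArg (Subtype.val (p := (· ∈ A))) h3
    simp only [AddSubmonoidClass.coe_finsetSum, Subalgebra.coe_smul, Subalgebra.coe_mul, u',
      ZeroMemClass.coe_zero] at h1' h2' h3'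
    have hu' := Fintype.linearIndependent_iff.1 hu
    exact ⟨fun i => Fin.forall_fin_two.2 ⟨hu' _ h2' i, hu' _ h3' i⟩, h1'⟩
  have hblock (d) (hd : d ∈ relSpace (k := k) x) (hd0 : ∀ i j, d (inr i) j = 0) (hdne : d ≠ 0) :
      (fun i j => d (inl i) (inl j)) ≠ 0 := by
    intro h0
    apply hdne
    ext (i | i) (j | j)
    · exact congrFun (congrFun h0 i) j
    · exact (hrows d hd hd0).1 i j
    · exact hd0 i _
    · exact hd0 i _
  have hprop (r) (hr : r ∈ relSpace (k := k) x) (hr0 : ∀ i j, r (inr i) j = 0) (d)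
      (hd : d ∈ relSpace (k := k) x) (hd0 : ∀ i j, d (inr i) j = 0) (hdne : d ≠ 0) :
      ∃ t : k, r = t • d := by
    obtain ⟨h1, h2⟩ := hrows r hr hr0
    obtain ⟨h3, h4⟩ := hrows d hd hd0
    obtain ⟨t, ht⟩ := exists_smul_eq_of_relations hu (c := fun i j => r (inl i) (inl j))
      (hblock d hd hd0 hdne) h2 h4
    refine ⟨t, ?_⟩
    ext (i | i) (j | j)
    · exact congrFun (congrFun ht i) j
    · simp [h1, h3]
    all_goals simp [hr0, hd0]
  -- The bound is 6 ≤ dim(R ∩ (X ⊗ V)) + (2 · 2 + 1), so there is a nonzero relation d inside X; any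
  -- other one is a multiple of it.
  have hdim := finrank_le_rowsZero _ hR
  rw [hw.finrank_eq, Fintype.card_fin] at hdim
  obtain ⟨d, ⟨hd, hd0⟩, hdne⟩ : ∃ d ∈ relSpace (k := k) x ⊓ rowsZero k (Fin 2) (Fin 2), d ≠ 0 := by
    refine Submodule.exists_mem_ne_zero_of_ne_bot fun h0 => ?_
    rw [h0, finrank_bot] at hdim
    omega
  obtain ⟨hdr, hdu⟩ := hrows d hd hd0
  have hle : Module.finrank k ↥(relSpace (k := k) x ⊓ rowsZero k (Fin 2) (Fin 2)) ≤ 1 := by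
    refine finrank_le_one ⟨d, hd, hd0⟩ fun r => ?_
    obtain ⟨t, ht⟩ := hprop r r.2.1 r.2.2 d hd hd0 hdne
    exact ⟨t, Subtype.ext ht.symm⟩
  have hdcol (i j) : d i (inr j) = 0 := by
    rcases i with i | i
    · exact hdr i j
    · exact hd0 i _
  have hp : p₁₂ ≠ 0 := by
    intro hp
    -- For p₁₂ = 0 the second column of q vanishes and (1, p₁₁) annihilates the first.
    have h0 := hw.nondegenerate q hR d hd hdcol (fun r hr hr0 => hprop r hr hr0 d hd hd0 hdne)
      ![1, p₁₁] (Fin.forall_fin_two.2 ⟨by simp [q], by simp [q, hp]⟩)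
    exact one_ne_zero (congrFun h0 0)
  have hex : ∃ r ∈ relSpace (k := k) x, ∃ i j, r (inr i) (inr j) ≠ 0 := by
    -- If no relation had a part in Y ⊗ Y, the zero form would satisfy the hypothesis of
    -- `IsSuperpotential.nondegenerate`, which is absurd.
    by_contra! h0
    have h1 := hw.nondegenerate 0 (fun r hr => ⟨0, fun i j => by rw [h0 r hr, zero_mul]⟩) d hd hdcol
      (fun r hr hr0 => hprop r hr hr0 d hd hd0 hdne) 1 (by simp)
    exact one_ne_zero (congrFun h1 0)
  have hdet : q 0 0 * q 1 1 - q 0 1 * q 1 0 ≠ 0 := by simpa [q] using hp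
  obtain ⟨hcomm, hsum⟩ := hB.span_inl_mul_comm_and_sum_inr_mem hli hsp hdet hR hex
  have hsup := hsp ▸ span_inl_sup_span_inr (k := k) (x := x)
  rw [hxu] at hcomm hsum hsup
  rw [hx, Sum.elim_comp_inr] at hsup
  obtain ⟨x', s, p, p', hx', -, hp', hrel'⟩ := exists_normal_form u
    (fun i j => d (inl i) (inl j)) (two_form_det_ne_zero hu (hblock d hd hd0 hdne) hdu)
  rw [hdu, smul_zero, sub_sub, sub_eq_zero] at hrel'
  refine ⟨x', p, p', Algebra.adjoin_le ?_, ⟨hB.regular.connected, ?_, hB.pow_eq, ?_, hrel', hp', ?_,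
    hp, hB.six_mul_finrank⟩⟩
  · rintro _ ⟨i, rfl⟩
    have : x' i ∈ Submodule.span k (Set.range u) := hx' ▸ Submodule.subset_span ⟨i, rfl⟩
    rw [hus] at this
    exact this.1
  · rw [hx', hsup]
  · rw [hx', hcomm]
  · rw [hx']
    convert hsum using 1
    simp [hx, q]
    abel

end IsRightDoubleExtension

end DoubleExt
end

/-! ### Uniqueness of the subalgebra, and the theorem. -/

noncomputable section

namespace DoubleExt

variable {k : Type u} {B : Type v} [Field k] [Ring B] [Algebra k B] {ℬ : ℕ → Submodule k B}

/-- A right double extension of a smaller subalgebra with the same generators is the same. -/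
theorem IsRightDoubleExtension.eq_of_le {A A' : Subalgebra k B} {y₁ y₂ : B}
    (h : IsRightDoubleExtension ℬ A y₁ y₂) (h' : IsRightDoubleExtension ℬ A' y₁ y₂) (hA : A' ≤ A) :
    A' = A := by
  refine le_antisymm hA fun a ha => ?_
  obtain ⟨f, hf⟩ := h'.2.2.2.1.2 a
  -- An element of A has both its trivial expansion and the one with coefficients in A'; they agree
  -- over A, so the element is a coefficient from A'.
  have h1 := h.2.2.2.1.1 (a₁ := Finsupp.single (0, 0) ⟨a, ha⟩)
    (a₂ := f.mapRange (Subalgebra.inclusion hA) (map_zero _)) (by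
      simp only
      rw [Finsupp.sum_mapRange_index (by simp), Finsupp.sum_single_index (by simp)]
      simpa using hf.symm)
  have h2 := congrArg (Subtype.val (p := (· ∈ A))) (DFunLike.congr_fun h1 (0, 0))
  rw [Finsupp.single_eq_same, Finsupp.mapRange_apply] at h2
  have h3 : a = (f (0, 0) : B) := h2
  rw [h3]
  exact (f (0, 0)).2

end DoubleExt

end

theorem theorem2p8 {k : Type u} {B : Type v} [Field k] [IsAlgClosed k] [Ring B] [IsDomain B]
    [Algebra k B] (ℬ : ℕ → Submodule k B) (hB : DoubleExt.IsRegularOfType14641 ℬ)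
    (h :
      -- (i) `B` is a right double extension
      (∃ (A : Subalgebra k B) (y₁ y₂ : B), DoubleExt.IsRightDoubleExtension ℬ A y₁ y₂) ∨
      -- (ii) a quadratic relation in `x₁, x₂` alone holds, and `B / (x₁, x₂)` is regular
      (∃ x₁ ∈ ℬ 1, ∃ x₂ ∈ ℬ 1,
        (∃ c : Matrix (Fin 2) (Fin 2) k, c ≠ 0 ∧
          ∑ i, ∑ j, c i j • (![x₁, x₂] i * ![x₁, x₂] j) = 0) ∧
        DoubleExt.IsASRegular
          (DoubleExt.quotGrading ℬ (TwoSidedIdeal.span {x₁, x₂})) 2)) :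
    (∃ (A : Subalgebra k B) (y₁ y₂ : B) (D : DoubleExt.DEData k A),
      -- `A` is regular of dimension 2 and generated in degree 1
      DoubleExt.IsASRegular (DoubleExt.subGrading ℬ A) 2 ∧
      Algebra.adjoin k ((A : Set B) ∩ ℬ 1) = A ∧
      -- `B` is the double extension `A_P[y₁, y₂; σ, δ, τ]` of `A`
      DoubleExt.IsDoubleExtension ℬ A y₁ y₂ ∧ D.Presents y₁ y₂ ∧
      D.p₁₂ ≠ 0 ∧ DoubleExt.IsInvertibleHom D.σ) ∧
    -- likewise for every way to write `B` as a right double extension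
    (∀ (A : Subalgebra k B) (y₁ y₂ : B) (D : DoubleExt.DEData k A),
      DoubleExt.IsRightDoubleExtension ℬ A y₁ y₂ → D.Presents y₁ y₂ →
        D.p₁₂ ≠ 0 ∧ DoubleExt.IsInvertibleHom D.σ) := by
  have main : ∀ (A : Subalgebra k B) (y₁ y₂ : B) (D : DoubleExt.DEData k A),
      DoubleExt.IsRightDoubleExtension ℬ A y₁ y₂ → D.Presents y₁ y₂ →
        D.p₁₂ ≠ 0 ∧ DoubleExt.IsInvertibleHom D.σ := by
    intro A y₁ y₂ D hA hD
    -- The frame has the given generators and the given p₁₂, and its subalgebra lies in A. Both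
    -- subalgebras give right double extensions with these generators, so they coincide, and A
    -- inherits the left-hand properties of the frame.
    obtain ⟨x, p, q, hxA, hx⟩ := hA.exists_isFrame hB hD.1
    have hde := hx.isDoubleExtension
    obtain rfl := hA.eq_of_le hde.1 hxA
    exact ⟨hx.p₁₂_ne_zero, hde.isInvertibleHom hD⟩
  refine ⟨?_, main⟩
  obtain ⟨x, y, p, q, p₁₂, p₁₁, hx⟩ : ∃ (x y : Fin 2 → B) (p q p₁₂ p₁₁ : k),
      DoubleExt.IsFrame ℬ x y p q p₁₂ p₁₁ := by
    rcases h with ⟨A, y₁, y₂, hA⟩ | ⟨x₁, h₁, x₂, h₂, ⟨c, hc0, hc⟩, hreg⟩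
    · obtain ⟨D, hD⟩ := hA.exists_presents
      obtain ⟨x, p, q, -, hx⟩ := hA.exists_isFrame hB hD.1
      exact ⟨x, _, p, q, _, _, hx⟩
    · exact hB.exists_isFrame_of_quotient h₁ h₂ hc0 hc hreg
  have hde := hx.isDoubleExtension
  obtain ⟨D, hD⟩ := hde.1.exists_presents
  exact ⟨_, _, _, D, hx.isASRegular, hx.adjoin_inter_eq, hde, hD, main _ _ _ D hde.1 hD⟩
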